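/- **Theorem (flatness for $C^1$ metrics).** Let $M$ be a smooth manifold (Hausdorff, second countable) of dimension $n$, and let $g$ be a semi-Riemannian metric on $M$ of regularity $C^1$ and of constant signature $(k,l)$, where $k,l\ge 0$ and $k+l=n$. In a smooth chart let $\Gamma^a_{bc}=\tfrac12 g^{ad}(\partial_c g_{db}+\partial_b g_{cd}-\partial_d g_{bc})$ be the (continuous) Christoffel symbols. For a smooth vector field $X$ and a continuous vector field $W$ let $\nabla_X W$ be the distributional vector field with chart components $(\nabla_X W)^a=X^b\partial_b W^a+\Gamma^a_{bc}X^bW^c$, where $\partial_b W^a$ is the distributional derivative; it is a continuous vector field if $W$ is $C^1$. The distributional Riemann tensor is given, for smooth vector fields $X,Y,Z$ on $M$, by $$\mathrm{Riem}_g(X,Y,Z)=\nabla_X\nabla_Y Z-\nabla_Y\nabla_X Z-\nabla_{[X,Y]}Z ,$$ a distributional vector field of order at most one (it can be tested against compactly supported $C^1$ sections of $T^*M\otimes\mathrm{Vol}\,M$). Then the following are equivalent: 1. $\mathrm{Riem}_g=0$ as a distributional tensor of order at most one, i.e. in $\mathcal D'^{(1)}(T^1_3M)$. 2. Every $p\in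 M$ has an open neighbourhood $U$ carrying an orthonormal frame $E_1,\dots,E_n$ of class $C^1$ consisting of parallel vector fields ($\nabla_X E_i=0$ on $U$ for all $X$). 3. Every $p\in M$ has an open neighbourhood $U$ with a $C^2$-diffeomorphism $\phi:U\to\phi(U)$ onto an open subset of $\mathbb R^n$ such that $\phi^*g_{k,l}=g$ on $U$, where $g_{k,l}=\sum_{i\le k}(dx^i)^2-\sum_{k<i\le n}(dx^i)^2$ is the semi-Euclidean metric of signature $(k,l)$. -/

import Mathlib

open scoped Manifold ContDiff Distributions

noncomputable section

namespace SemiRiemannian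

open Bundle MeasureTheory TopologicalSpace

/-- The diagonal entries `(1, …, 1, -1, …, -1)`, with `k` entries `1` followed by `l` entries `-1`,
of the semi-Euclidean metric of signature `(k, l)`. -/
def sgn (k l : ℕ) (i : Fin (k + l)) : ℝ := if (i : ℕ) < k then 1 else -1

/-- The semi-Euclidean metric of signature `(k, l)` on `ℝ^(k+l)`. -/
def flatForm (k l : ℕ) (v w : EuclideanSpace ℝ (Fin (k + l))) : ℝ :=
  ∑ i, sgn k l i * v i * w i

/-- A `C^1` semi-Riemannian metric of signature `(k, l)` on a smooth manifold `M` of dimension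
`k + l`: a `C^1` section of the bundle of bilinear forms on the tangent spaces which is at every
point symmetric and has the diagonal matrix `sgn k l` in some basis of the tangent space (this is
what signature `(k, l)` means; in particular it is nondegenerate). -/
structure C1Metric (k l : ℕ) (M : Type*) [TopologicalSpace M]
    [ChartedSpace (EuclideanSpace ℝ (Fin (k + l))) M] [IsManifold (𝓡 (k + l)) ∞ M] where
  toForm (x : M) :
    TangentSpace (𝓡 (k + l)) x →L[ℝ] TangentSpace (𝓡 (k + l)) x →L[ℝ] ℝ
  symm (x : M) (v w : TangentSpace (𝓡 (k + l)) x) : toForm x v w = toForm x w v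
  signature (x : M) : ∃ b : Module.Basis (Fin (k + l)) ℝ (TangentSpace (𝓡 (k + l)) x),
    ∀ i j, toForm x (b i) (b j) = if i = j then sgn k l i else 0
  contMDiff : ContMDiff (𝓡 (k + l))
    ((𝓡 (k + l)).prod 𝓘(ℝ, EuclideanSpace ℝ (Fin (k + l)) →L[ℝ]
      EuclideanSpace ℝ (Fin (k + l)) →L[ℝ] ℝ)) 1
    (fun x ↦ TotalSpace.mk' (EuclideanSpace ℝ (Fin (k + l)) →L[ℝ]
      EuclideanSpace ℝ (Fin (k + l)) →L[ℝ] ℝ) x (toForm x))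

/-- The partial derivative `∂_i f` on `ℝ^n`. -/
def partialD {n : ℕ} (i : Fin n) (f : EuclideanSpace ℝ (Fin n) → ℝ)
    (y : EuclideanSpace ℝ (Fin n)) : ℝ :=
  fderiv ℝ f y (EuclideanSpace.single i 1)

/-- The open set `φ(U)`, for a chart `φ : U → φ(U) ⊆ ℝ^n`. -/
def chartImage {n : ℕ} {M : Type*} [TopologicalSpace M]
    (e : OpenPartialHomeomorph M (EuclideanSpace ℝ (Fin n))) :
    Opens (EuclideanSpace ℝ (Fin n)) :=
  ⟨e.target, e.open_target⟩

/-- The components of a vector field `X` in a chart, as a function of the coordinates. -/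
def inChart {n : ℕ} {M : Type*} [TopologicalSpace M]
    [ChartedSpace (EuclideanSpace ℝ (Fin n)) M]
    (e : OpenPartialHomeomorph M (EuclideanSpace ℝ (Fin n)))
    (X : (x : M) → TangentSpace (𝓡 n) x) (y : EuclideanSpace ℝ (Fin n)) :
    EuclideanSpace ℝ (Fin n) :=
  mfderiv (𝓡 n) (𝓡 n) e (e.symm y) (X (e.symm y))

/-- The function `f`, locally integrable on `Ω`, viewed as the distribution
`ψ ↦ ∫ ψ f` of order at most `m` on `Ω`. -/
def funDist {n : ℕ} (Ω : Opens (EuclideanSpace ℝ (Fin n))) (m : ℕ∞)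
    (f : EuclideanSpace ℝ (Fin n) → ℝ) : 𝓓'^{m}(Ω, ℝ) :=
  TestFunction.integralAgainstBilinCLM (ContinuousLinearMap.mul ℝ ℝ) volume f

/-- The distribution `h ∂_i f` of order at most one on `Ω`, for continuous `f` and `C^1` `h`. Here
`∂_i` is the distributional derivative, and the product is
`h ∂_i f = ∂_i (h f) - (∂_i h) f`, i.e. `ψ ↦ -∫ f ∂_i (h ψ)`. -/
def mulPartialDist {n : ℕ} (Ω : Opens (EuclideanSpace ℝ (Fin n))) (i : Fin n)
    (h f : EuclideanSpace ℝ (Fin n) → ℝ) : 𝓓'^{1}(Ω, ℝ) :=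
  Distribution.lineDerivCLM (EuclideanSpace.single i (1 : ℝ))
      (funDist Ω 0 (fun y ↦ h y * f y))
    - funDist Ω 1 (fun y ↦ partialD i h y * f y)

namespace C1Metric

variable {k l : ℕ} {M : Type*} [TopologicalSpace M]
  [ChartedSpace (EuclideanSpace ℝ (Fin (k + l))) M] [IsManifold (𝓡 (k + l)) ∞ M]

/-- The components `g_{ij} = g(∂_i, ∂_j)` of the metric in a chart. -/
def coeff (g : C1Metric k l M)
    (e : OpenPartialHomeomorph M (EuclideanSpace ℝ (Fin (k + l)))) (i j : Fin (k + l))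
    (y : EuclideanSpace ℝ (Fin (k + l))) : ℝ :=
  g.toForm (e.symm y)
    (mfderiv (𝓡 (k + l)) (𝓡 (k + l)) e.symm y (EuclideanSpace.single i (1 : ℝ)))
    (mfderiv (𝓡 (k + l)) (𝓡 (k + l)) e.symm y (EuclideanSpace.single j (1 : ℝ)))

/-- The Christoffel symbols
`Γ^a_{bc} = (1/2) g^{ad} (∂_c g_{db} + ∂_b g_{cd} - ∂_d g_{bc})` in a chart. -/
def christoffel (g : C1Metric k l M)
    (e : OpenPartialHomeomorph M (EuclideanSpace ℝ (Fin (k + l)))) (a b c : Fin (k + l))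
    (y : EuclideanSpace ℝ (Fin (k + l))) : ℝ :=
  (1 / 2) * ∑ d, (Matrix.of fun i j ↦ g.coeff e i j y)⁻¹ a d *
    (partialD c (g.coeff e d b) y + partialD b (g.coeff e c d) y - partialD d (g.coeff e b c) y)

/-- The components in a chart of the Levi-Civita covariant derivative `∇_X Y` of a `C^1` vector
field `Y`, where `X` and `Y` are given by their components in the chart:
`(∇_X Y)^a = X^b ∂_b Y^a + Γ^a_{bc} X^b Y^c`. -/
def covDeriv (g : C1Metric k l M)
    (e : OpenPartialHomeomorph M (EuclideanSpace ℝ (Fin (k + l))))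
    (X Y : EuclideanSpace ℝ (Fin (k + l)) → EuclideanSpace ℝ (Fin (k + l)))
    (y : EuclideanSpace ℝ (Fin (k + l))) : EuclideanSpace ℝ (Fin (k + l)) :=
  WithLp.toLp 2 fun a ↦ ∑ b, X y b * partialD b (fun z ↦ Y z a) y
    + ∑ b, ∑ c, g.christoffel e a b c y * X y b * Y y c

/-- The extension of `∇_X` from `C^1` to continuous vector fields `W`, with values in distributional
vector fields: the component `(∇_X W)^a = X^b ∂_b W^a + Γ^a_{bc} X^b W^c`, a distribution on the
image of the chart, where `∂_b W^a` is a distributional derivative. -/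
def distCovDeriv (g : C1Metric k l M)
    (e : OpenPartialHomeomorph M (EuclideanSpace ℝ (Fin (k + l))))
    (X W : EuclideanSpace ℝ (Fin (k + l)) → EuclideanSpace ℝ (Fin (k + l)))
    (a : Fin (k + l)) : 𝓓'^{1}(chartImage e, ℝ) :=
  ∑ b, mulPartialDist (chartImage e) b (fun y ↦ X y b) (fun y ↦ W y a)
    + funDist (chartImage e) 1 (fun y ↦ ∑ b, ∑ c, g.christoffel e a b c y * X y b * W y c)

/-- The components in a chart of the distributional vector field
`Riem(X, Y, Z) = ∇_X ∇_Y Z - ∇_Y ∇_X Z - ∇_[X,Y] Z`, for smooth vector fields `X, Y, Z` on `M`. -/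
def riem (g : C1Metric k l M)
    (e : OpenPartialHomeomorph M (EuclideanSpace ℝ (Fin (k + l))))
    (X Y Z : (x : M) → TangentSpace (𝓡 (k + l)) x) (a : Fin (k + l)) :
    𝓓'^{1}(chartImage e, ℝ) :=
  g.distCovDeriv e (inChart e X) (g.covDeriv e (inChart e Y) (inChart e Z)) a
    - g.distCovDeriv e (inChart e Y) (g.covDeriv e (inChart e X) (inChart e Z)) a
    - g.distCovDeriv e (VectorField.lieBracket ℝ (inChart e X) (inChart e Y)) (inChart e Z) a

/-- Vanishing of the distributional Riemann tensor (of order at most one): for all smooth vector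
fields `X, Y, Z` on `M`, the distributional vector field `Riem(X, Y, Z)` is zero, that is, its
components in every smooth chart vanish as distributions, tested against compactly supported `C^1`
functions (the coefficients of the test sections of `T^*M ⊗ Vol M` supported in the chart). -/
def IsCurvatureFlat (g : C1Metric k l M) : Prop :=
  ∀ X Y Z : (x : M) → TangentSpace (𝓡 (k + l)) x,
    ContMDiff (𝓡 (k + l)) (𝓡 (k + l)).tangent ∞
      (fun x ↦ (⟨x, X x⟩ : TangentBundle (𝓡 (k + l)) M)) →
    ContMDiff (𝓡 (k + l)) (𝓡 (k + l)).tangent ∞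
      (fun x ↦ (⟨x, Y x⟩ : TangentBundle (𝓡 (k + l)) M)) →
    ContMDiff (𝓡 (k + l)) (𝓡 (k + l)).tangent ∞
      (fun x ↦ (⟨x, Z x⟩ : TangentBundle (𝓡 (k + l)) M)) →
    ∀ e ∈ IsManifold.maximalAtlas (𝓡 (k + l)) ∞ M, ∀ a, g.riem e X Y Z a = 0

/-- A `C^1` vector field `V` on the open set `U` is parallel: `∇_X V = 0` on `U` for all `X`,
expressed in every smooth chart. -/
def IsParallelOn (g : C1Metric k l M) (V : (x : M) → TangentSpace (𝓡 (k + l)) x)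
    (U : Set M) : Prop :=
  ∀ e ∈ IsManifold.maximalAtlas (𝓡 (k + l)) ∞ M,
    ∀ y ∈ e.target, e.symm y ∈ U → ∀ v : EuclideanSpace ℝ (Fin (k + l)),
      g.covDeriv e (fun _ ↦ v) (inChart e V) y = 0

/-- `C^1` frame-flatness: around every point there are `k + l` parallel vector fields of class
`C^1` which are orthonormal (hence a frame) at every point. -/
def IsFrameFlat (g : C1Metric k l M) : Prop :=
  ∀ p : M, ∃ U : Set M, IsOpen U ∧ p ∈ U ∧
    ∃ V : Fin (k + l) → (x : M) → TangentSpace (𝓡 (k + l)) x,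
      (∀ i, ContMDiffOn (𝓡 (k + l)) (𝓡 (k + l)).tangent 1
        (fun x ↦ (⟨x, V i x⟩ : TangentBundle (𝓡 (k + l)) M)) U) ∧
      (∀ x ∈ U, ∀ i j, g.toForm x (V i x) (V j x) = if i = j then sgn k l i else 0) ∧
      ∀ i, g.IsParallelOn (V i) U

/-- `C^2` coordinate-flatness: every point lies in the domain of a `C^2` diffeomorphism `φ` from an
open subset of `M` onto an open subset of `ℝ^(k+l)` with `φ^* g_{k,l} = g`, where `g_{k,l}` is the
semi-Euclidean metric. -/
def IsCoordinateFlat (g : C1Metric k l M) : Prop :=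
  ∀ p : M, ∃ φ : PartialDiffeomorph (𝓡 (k + l)) (𝓡 (k + l)) M (EuclideanSpace ℝ (Fin (k + l))) 2,
    p ∈ φ.source ∧ ∀ x ∈ φ.source, ∀ v w : TangentSpace (𝓡 (k + l)) x,
      flatForm k l (mfderiv (𝓡 (k + l)) (𝓡 (k + l)) φ x v)
        (mfderiv (𝓡 (k + l)) (𝓡 (k + l)) φ x w) = g.toForm x v w

end C1Metric

end SemiRiemannian

end

/-!
The three conditions are linked by parallel frames: curvature-flatness gives `C^1` parallel frames,
these are the coordinate frames of `C^2` isometries to semi-Euclidean space, and both implications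
can be reversed.

*Vanishing curvature gives parallel frames.* Evaluated on coordinate vector fields, cut off to
smooth vector fields on `M`, the hypothesis says that the continuous connection form `Γ` of
a chart satisfies `dΓ + Γ ∧ Γ = 0` in the sense of distributions. Parallel sections of `d + Γ` are
found by Picard iteration along rays, `V ↦ v - K (Γ V)`, where `K` is the radial primitive of
a one-form (`radialPrimitive`). Nothing here is differentiable a priori, but the homotopy formula
`d (K α) = α - K (d α)` holds for a continuous one-form `α` with continuous distributional exterior
derivative (`HasWeakExteriorDeriv.hasFDerivAt_radialPrimitive`, by mollification). For a `C^1`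
section `V`, weak flatness gives `d (Γ V) = - Γ ∧ (dV + Γ V)`, which is continuous
(`HasWeakZeroCurvature.hasWeakExteriorDeriv`). Hence all iterates are `C^1`, their covariant
differentials satisfy a linear recursion which is a contraction on a small ball, and the iterates
converge in `C^1` to a parallel section (`HasWeakZeroCurvature.exists_parallel`). The connection is
metric, so sections which are orthonormal at the centre stay orthonormal.

*Parallel frames give flat coordinates.* Since the Christoffel symbols are symmetric, the dual
coframe of a parallel `C^1` frame is closed, and primitives of it are `C^2` flat coordinates
(`HasParallelFrameNear.exists_isometry`).

*Flat coordinates give parallel frames.* If `f` is a `C^2` isometry to semi-Euclidean space, the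
Koszul formula gives `Df (Γ(u, v)) = D²f (u, v)` (`fderiv_christoffelForm_of_isometry`), and the
coordinate vector fields `(Df)⁻¹ e_i` are parallel.

*Parallel frames give vanishing curvature.* Distributions can be tested locally, and with respect to
a parallel frame the covariant derivative is the componentwise derivative
(`distCovDeriv_apply_of_parallel`). What remains is that `X Y ζ - Y X ζ = [X, Y] ζ` in the sense of
distributions of order one, for a function `ζ` of class `C^1` (`integral_commutator`). This follows
from the symmetry of second distributional derivatives against `C^1` test functions
(`integral_fderiv_mul_fderiv_comm`).
-/

namespace SemiRiemannian

set_option maxSynthPendingDepth 3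
set_option linter.unusedSectionVars false

/-! ### The radial homotopy operator for `C^1` one-forms -/

section RadialPrimitive

open MeasureTheory Metric Set Filter Topology

variable {E F : Type*} [NormedAddCommGroup E] [NormedSpace ℝ E] [FiniteDimensional ℝ E]
  [NormedAddCommGroup F] [NormedSpace ℝ F]

/-- Differentiation under the integral sign. -/
theorem hasFDerivAt_intervalIntegral_of_continuous {h : E → ℝ → F} {h' : E → ℝ → E →L[ℝ] F}
    (hc : Continuous (Function.uncurry h)) (hc' : Continuous (Function.uncurry h'))
    (hd : ∀ x t, HasFDerivAt (fun y ↦ h y t) (h' x t) x) (x : E) :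
    HasFDerivAt (fun y ↦ ∫ t in (0 : ℝ)..1, h y t) (∫ t in (0 : ℝ)..1, h' x t) x := by
  obtain ⟨C, hC⟩ := ((isCompact_closedBall x 1).prod (isCompact_Icc (a := (0 : ℝ)) (b := 1))
    ).exists_bound_of_continuousOn hc'.continuousOn
  refine intervalIntegral.hasFDerivAt_integral_of_dominated_of_fderiv_le
    (F := h) (F' := h') (bound := fun _ ↦ C) (s := closedBall x 1) (closedBall_mem_nhds x one_pos)
    ?_ ?_ ?_ ?_ ?_ ?_
  · exact Eventually.of_forall fun y ↦
      (hc.comp (Continuous.prodMk_right y)).aestronglyMeasurable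
  · exact (hc.comp (Continuous.prodMk_right x)).intervalIntegrable _ _
  · exact (hc'.comp (Continuous.prodMk_right x)).aestronglyMeasurable
  · refine Eventually.of_forall fun t ht y hy ↦ hC (y, t) ⟨hy, ?_⟩
    rw [uIoc_of_le zero_le_one] at ht
    exact ⟨ht.1.le, ht.2⟩
  · exact intervalIntegrable_const
  · exact Eventually.of_forall fun t _ y _ ↦ hd y t

/-- The radial primitive `x ↦ ∫_{[x₀, x]} α` of a one-form `α`, the integral being taken along the
segment from `x₀` to `x`. -/
noncomputable def radialPrimitive (x₀ : E) (α : E → E →L[ℝ] F) (x : E) : F :=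
  ∫ t in (0 : ℝ)..1, α (x₀ + t • (x - x₀)) (x - x₀)

/-- The radial homotopy operator on two-forms, with values in one-forms:
`(K β)(x)(w) = ∫₀¹ t β(x₀ + t (x - x₀))(x - x₀, w) dt`. -/
noncomputable def radialContraction (x₀ : E) (β : E → E →L[ℝ] E →L[ℝ] F) (x : E) : E →L[ℝ] F :=
  ∫ t in (0 : ℝ)..1, t • β (x₀ + t • (x - x₀)) (x - x₀)

/-- The homotopy formula `d (K α) = α - K (d α)` for `C^1` one-forms. -/
theorem hasFDerivAt_radialPrimitive_of_contDiff [CompleteSpace F] (x₀ : E) {α : E → E →L[ℝ] F}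
    (hα : ContDiff ℝ 1 α) (x : E) :
    HasFDerivAt (radialPrimitive x₀ α)
      (α x - radialContraction x₀ (fun y ↦ fderiv ℝ α y - (fderiv ℝ α y).flip) x) x := by
  have hcα := hα.continuous
  have hcd := hα.continuous_fderiv one_ne_zero
  have hd : Differentiable ℝ α := hα.differentiable one_ne_zero
  obtain ⟨A, hA, hAc⟩ : ∃ A : E → E →L[ℝ] E →L[ℝ] F,
      (∀ y, A y = (fderiv ℝ α y).flip) ∧ Continuous A :=
    ⟨_, fun _ ↦ rfl, (ContinuousLinearMap.flipₗᵢ ℝ E E F).continuous.comp hcd⟩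
  set h' : E → ℝ → E →L[ℝ] F := fun x t ↦
    α (x₀ + t • (x - x₀)) + t • A (x₀ + t • (x - x₀)) (x - x₀) with hh'
  have hc' : Continuous (Function.uncurry h') := by
    simp only [hh', Function.uncurry_def]
    fun_prop
  have key := hasFDerivAt_intervalIntegral_of_continuous
    (h := fun x t ↦ α (x₀ + t • (x - x₀)) (x - x₀)) (h' := h')
    (by simp only [Function.uncurry_def]; fun_prop) hc' (fun y t ↦ by
      have h1 : HasFDerivAt (fun y ↦ x₀ + t • (y - x₀)) (t • ContinuousLinearMap.id ℝ E) y :=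
        (((hasFDerivAt_id y).sub_const x₀).const_smul t).const_add x₀
      have h2 := (hd (x₀ + t • (y - x₀))).hasFDerivAt.comp y h1
      have h3 := h2.clm_apply ((hasFDerivAt_id y).sub_const x₀)
      refine h3.congr_fderiv ?_
      ext w
      simp [hh', hA]) x
  refine key.congr_fderiv ?_
  -- The value `α x` is the integral of the derivative of `t ↦ t α(x₀ + t (x - x₀))` over `[0, 1]`.
  have hgd : ∀ t : ℝ, HasDerivAt (fun t : ℝ ↦ t • α (x₀ + t • (x - x₀)))
      (α (x₀ + t • (x - x₀)) + t • (fderiv ℝ α (x₀ + t • (x - x₀))) (x - x₀)) t := by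
    intro t
    have h1 : HasDerivAt (fun t : ℝ ↦ x₀ + t • (x - x₀)) (x - x₀) t := by
      simpa using ((hasDerivAt_id t).smul_const (x - x₀)).const_add x₀
    have h2 := (hd (x₀ + t • (x - x₀))).hasFDerivAt.comp_hasDerivAt t h1
    have h3 := (hasDerivAt_id t).smul h2
    refine h3.congr_deriv ?_
    simp [add_comm]
  have hgc : Continuous fun t : ℝ ↦
      α (x₀ + t • (x - x₀)) + t • (fderiv ℝ α (x₀ + t • (x - x₀))) (x - x₀) := by fun_prop
  have hftc := intervalIntegral.integral_eq_sub_of_hasDerivAt (a := 0) (b := 1)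
    (fun t _ ↦ hgd t) (hgc.intervalIntegrable _ _)
  have hαx : α x = ∫ t in (0 : ℝ)..1,
      α (x₀ + t • (x - x₀)) + t • (fderiv ℝ α (x₀ + t • (x - x₀))) (x - x₀) := by
    rw [hftc]; simp
  rw [hαx, radialContraction, ← intervalIntegral.integral_sub (hgc.intervalIntegrable _ _)]
  · refine intervalIntegral.integral_congr fun t _ ↦ ?_
    simp only [hh', ← hA, _root_.sub_apply, smul_sub]
    abel
  · refine Continuous.intervalIntegrable ?_ _ _
    simp only [← hA]
    fun_prop

end RadialPrimitive

/-! ### The homotopy formula for continuous one-forms -/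

section WeakPoincare

open MeasureTheory Metric Set Filter Topology Convolution ContinuousLinearMap

variable {E F : Type*} [NormedAddCommGroup E] [NormedSpace ℝ E] [FiniteDimensional ℝ E]
  [MeasurableSpace E] [BorelSpace E] {μ : Measure E} [μ.IsAddHaarMeasure]
  [NormedAddCommGroup F] [NormedSpace ℝ F]

/-- Mollifications of a function converge uniformly on balls strictly inside a closed ball on which
the function is continuous. -/
theorem tendstoUniformlyOn_normed_convolution [CompleteSpace F] {g : E → F} {x₀ : E} {r R : ℝ}
    (hm : AEStronglyMeasurable g μ) (hg : ContinuousOn g (closedBall x₀ R)) (hr : r < R)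
    {φ : ℕ → ContDiffBump (0 : E)} (hφ : Tendsto (fun m ↦ (φ m).rOut) atTop (𝓝 0)) :
    TendstoUniformlyOn (fun m ↦ ((φ m).normed μ ⋆[lsmul ℝ ℝ, μ] g : E → F)) g atTop
      (closedBall x₀ r) := by
  have huc := (isCompact_closedBall x₀ R).uniformContinuousOn_of_continuous hg
  rw [Metric.uniformContinuousOn_iff] at huc
  rw [Metric.tendstoUniformlyOn_iff]
  intro ε hε
  obtain ⟨δ, hδ, h⟩ := huc (ε / 2) (half_pos hε)
  filter_upwards [hφ.eventually (gt_mem_nhds (lt_min hδ (sub_pos.2 hr)))] with m hm' y hy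
  rw [dist_comm]
  refine ((φ m).dist_normed_convolution_le (ε := ε / 2) hm fun z hz ↦ ?_).trans_lt
    (half_lt_self hε)
  rw [mem_ball] at hz
  rw [mem_closedBall] at hy
  refine (h z ?_ y (mem_closedBall.2 (hy.trans hr.le))
    (hz.trans (hm'.trans_le (min_le_left _ _)))).le
  rw [mem_closedBall]
  have := dist_triangle z y x₀
  have := hm'.trans_le (min_le_right δ (R - r))
  linarith

/-- The continuous two-form `β` is the exterior derivative of the continuous one-form `α` on `Ω` in
the sense of distributions, tested against `C^1` functions with compact support in `Ω`. -/
def HasWeakExteriorDeriv (μ : Measure E) (Ω : Set E) (α : E → E →L[ℝ] F)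
    (β : E → E →L[ℝ] E →L[ℝ] F) : Prop :=
  ∀ ψ : E → ℝ, ContDiff ℝ 1 ψ → HasCompactSupport ψ → tsupport ψ ⊆ Ω → ∀ u w : E,
    ∫ x, (fderiv ℝ ψ x u • α x w - fderiv ℝ ψ x w • α x u) ∂μ = -∫ x, ψ x • β x u w ∂μ

theorem fderiv_convolution_apply [CompleteSpace F] {ρ : E → ℝ} (hρ : ContDiff ℝ 1 ρ)
    (hρc : HasCompactSupport ρ) {α : E → E →L[ℝ] F} (hα : LocallyIntegrable α μ) (y u w : E) :
    Integrable (fun z ↦ fderiv ℝ ρ (y - z) u • α z w) μ ∧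
    fderiv ℝ (ρ ⋆[lsmul ℝ ℝ, μ] α : E → E →L[ℝ] F) y u w
      = ∫ z, fderiv ℝ ρ (y - z) u • α z w ∂μ := by
  have hex : ConvolutionExistsAt (fderiv ℝ ρ) α y
      ((lsmul ℝ ℝ : ℝ →L[ℝ] (E →L[ℝ] F) →L[ℝ] (E →L[ℝ] F)).precompL E) μ :=
    (hρc.fderiv ℝ).convolutionExists_left _ (hρ.continuous_fderiv one_ne_zero) hα y
  have hint : Integrable (fun t ↦ fderiv ℝ ρ t u • α (y - t) w) μ := by
    have h1 := (hex.integrable.apply_continuousLinearMap u).apply_continuousLinearMap w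
    simpa using h1
  constructor
  · have := hint.comp_sub_left y
    simpa using this
  · rw [(hρc.hasFDerivAt_convolution_left (lsmul ℝ ℝ) hρ hα y).fderiv, convolution_def,
      ContinuousLinearMap.integral_apply hex.integrable,
      ContinuousLinearMap.integral_apply (hex.integrable.apply_continuousLinearMap u),
      ← integral_sub_left_eq_self _ _ y]
    simp

/-- Mollification commutes with the weak exterior derivative: `d (ρ ⋆ α) = ρ ⋆ β` at points `y` such
that `y - supp ρ` lies in `Ω`. The forms `α'` and `β'` are integrable extensions of `α` and `β`. -/
theorem fderiv_convolution_antisymm [CompleteSpace F] {ρ : E → ℝ} (hρ : ContDiff ℝ 1 ρ)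
    (hρc : HasCompactSupport ρ) {Ω : Set E} {α α' : E → E →L[ℝ] F} {β β' : E → E →L[ℝ] E →L[ℝ] F}
    (hw : HasWeakExteriorDeriv μ Ω α β) (hα' : LocallyIntegrable α' μ)
    (hβ' : LocallyIntegrable β' μ) {K : Set E} (hK : K ⊆ Ω) (hαα' : EqOn α' α K)
    (hββ' : EqOn β' β K) {y : E} (hy : ∀ z ∉ K, y - z ∉ tsupport ρ) (u w : E) :
    fderiv ℝ (ρ ⋆[lsmul ℝ ℝ, μ] α' : E → E →L[ℝ] F) y u w
      - fderiv ℝ (ρ ⋆[lsmul ℝ ℝ, μ] α' : E → E →L[ℝ] F) y w u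
      = (ρ ⋆[lsmul ℝ ℝ, μ] β' : E → E →L[ℝ] E →L[ℝ] F) y u w := by
  obtain ⟨h1, h1'⟩ := fderiv_convolution_apply hρ hρc hα' y u w
  obtain ⟨h2, h2'⟩ := fderiv_convolution_apply hρ hρc hα' y w u
  have hhom : (fun z ↦ ρ (y - z)) = ρ ∘ (Homeomorph.subLeft y) := rfl
  have hts : tsupport (fun z ↦ ρ (y - z)) ⊆ K := by
    intro z hz
    by_contra hzK
    refine hy z hzK ?_
    rw [hhom, tsupport_comp_eq_preimage] at hz
    exact hz
  have hψ : ContDiff ℝ 1 (fun z ↦ ρ (y - z)) := hρ.comp (contDiff_const.sub contDiff_id)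
  have hψc : HasCompactSupport (fun z ↦ ρ (y - z)) := by
    rw [hhom]; exact hρc.comp_homeomorph _
  have hfd : ∀ z v, fderiv ℝ (fun z ↦ ρ (y - z)) z v = -fderiv ℝ ρ (y - z) v := by
    intro z v
    have h := (hρ.differentiable one_ne_zero (y - z)).hasFDerivAt.comp z
      ((hasFDerivAt_id z).const_sub y)
    have h' : fderiv ℝ (fun z ↦ ρ (y - z)) z = _ := h.fderiv
    rw [h']; simp
  have key := hw _ hψ hψc (hts.trans hK) u w
  have hex : ConvolutionExistsAt ρ β' y
      (lsmul ℝ ℝ : ℝ →L[ℝ] (E →L[ℝ] E →L[ℝ] F) →L[ℝ] (E →L[ℝ] E →L[ℝ] F)) μ :=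
    hρc.convolutionExists_left _ hρ.continuous hβ' y
  have hzero : ∀ z ∉ K, fderiv ℝ ρ (y - z) = 0 := fun z hz ↦
    image_eq_zero_of_notMem_tsupport fun h ↦ hy z hz (tsupport_fderiv_subset ℝ h)
  rw [h1', h2', ← integral_sub h1 h2, convolution_def,
      ContinuousLinearMap.integral_apply hex.integrable,
      ContinuousLinearMap.integral_apply (hex.integrable.apply_continuousLinearMap u),
      ← integral_sub_left_eq_self (fun t ↦ lsmul ℝ ℝ (ρ t) (β' (y - t)) u w) _ y]
  have e1 : ∫ z, (fderiv ℝ ρ (y - z) u • α' z w - fderiv ℝ ρ (y - z) w • α' z u) ∂μ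
      = -∫ x, (fderiv ℝ (fun z ↦ ρ (y - z)) x u • α x w
        - fderiv ℝ (fun z ↦ ρ (y - z)) x w • α x u) ∂μ := by
    rw [← integral_neg]
    refine integral_congr_ae (Eventually.of_forall fun z ↦ ?_)
    simp only [hfd]
    by_cases hz : z ∈ K
    · rw [hαα' hz]; simp; abel
    · simp [hzero z hz]
  rw [e1, key, neg_neg]
  refine integral_congr_ae (Eventually.of_forall fun z ↦ ?_)
  by_cases hz : z ∈ K
  · simp [hββ' hz]
  · have : ρ (y - z) = 0 := image_eq_zero_of_notMem_tsupport (hy z hz)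
    simp [this]

theorem segment_mem_closedBall {x₀ x : E} {r t : ℝ} (hx : x ∈ closedBall x₀ r)
    (ht : t ∈ Icc (0 : ℝ) 1) : x₀ + t • (x - x₀) ∈ closedBall x₀ r := by
  have h := (convex_closedBall x₀ r).add_smul_sub_mem
    (mem_closedBall_self (dist_nonneg.trans (mem_closedBall.1 hx))) hx ht
  exact h

theorem _root_.ContinuousOn.comp_radial {G : Type*} [NormedAddCommGroup G]
    {g : E → G} {x₀ x : E} {r : ℝ}
    (hg : ContinuousOn g (closedBall x₀ r)) (hx : x ∈ closedBall x₀ r) :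
    ContinuousOn (fun t : ℝ ↦ g (x₀ + t • (x - x₀))) (uIcc 0 1) := by
  rw [uIcc_of_le zero_le_one]
  exact hg.comp (by fun_prop) fun t ht ↦ segment_mem_closedBall hx ht

theorem norm_radialPrimitive_le {α : E → E →L[ℝ] F} {x₀ x : E} {r C : ℝ}
    (hx : x ∈ closedBall x₀ r) (hC : ∀ y ∈ closedBall x₀ r, ‖α y‖ ≤ C) :
    ‖radialPrimitive x₀ α x‖ ≤ C * r := by
  rw [radialPrimitive]
  have h0 : 0 ≤ C := (norm_nonneg _).trans (hC x hx)
  refine (intervalIntegral.norm_integral_le_of_norm_le_const (C := C * r) fun t ht ↦ ?_).trans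
    (by simp)
  rw [uIoc_of_le zero_le_one] at ht
  refine (le_opNorm _ _).trans ?_
  gcongr
  · exact hC _ (segment_mem_closedBall hx ⟨ht.1.le, ht.2⟩)
  · rwa [← dist_eq_norm]

theorem norm_radialContraction_le {β : E → E →L[ℝ] E →L[ℝ] F} {x₀ x : E} {r C : ℝ}
    (hx : x ∈ closedBall x₀ r) (hC : ∀ y ∈ closedBall x₀ r, ‖β y‖ ≤ C) :
    ‖radialContraction x₀ β x‖ ≤ C * r := by
  rw [radialContraction]
  have h0 : 0 ≤ C := (norm_nonneg _).trans (hC x hx)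
  have hr : 0 ≤ r := dist_nonneg.trans (mem_closedBall.1 hx)
  refine (intervalIntegral.norm_integral_le_of_norm_le_const (C := C * r) fun t ht ↦ ?_).trans
    (by simp)
  rw [uIoc_of_le zero_le_one] at ht
  rw [norm_smul, Real.norm_of_nonneg ht.1.le]
  refine (mul_le_mul ht.2 (le_opNorm _ _) (norm_nonneg _) zero_le_one).trans ?_
  rw [one_mul]
  gcongr
  · exact hC _ (segment_mem_closedBall hx ⟨ht.1.le, ht.2⟩)
  · rwa [← dist_eq_norm]

theorem radialPrimitive_sub {α α' : E → E →L[ℝ] F} {x₀ x : E} {r : ℝ}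
    (hα : ContinuousOn α (closedBall x₀ r)) (hα' : ContinuousOn α' (closedBall x₀ r))
    (hx : x ∈ closedBall x₀ r) :
    radialPrimitive x₀ (fun y ↦ α y - α' y) x
      = radialPrimitive x₀ α x - radialPrimitive x₀ α' x := by
  simp only [radialPrimitive, sub_apply]
  refine intervalIntegral.integral_sub ?_ ?_
  · exact ((hα.comp_radial hx).clm_apply continuousOn_const).intervalIntegrable
  · exact ((hα'.comp_radial hx).clm_apply continuousOn_const).intervalIntegrable

theorem radialContraction_sub {β β' : E → E →L[ℝ] E →L[ℝ] F} {x₀ x : E} {r : ℝ}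
    (hβ : ContinuousOn β (closedBall x₀ r)) (hβ' : ContinuousOn β' (closedBall x₀ r))
    (hx : x ∈ closedBall x₀ r) :
    radialContraction x₀ (fun y ↦ β y - β' y) x
      = radialContraction x₀ β x - radialContraction x₀ β' x := by
  have h : ∀ {b : E → E →L[ℝ] E →L[ℝ] F}, ContinuousOn b (closedBall x₀ r) →
      IntervalIntegrable (fun t : ℝ ↦ t • b (x₀ + t • (x - x₀)) (x - x₀)) volume 0 1 := fun hb ↦
    (continuousOn_id.smul
      ((hb.comp_radial hx).clm_apply continuousOn_const)).intervalIntegrable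
  simp only [radialContraction]
  rw [← intervalIntegral.integral_sub (h hβ) (h hβ')]
  refine intervalIntegral.integral_congr fun t _ ↦ ?_
  simp only [sub_apply, smul_sub (t : ℝ) (_ : E →L[ℝ] F)]

/-- The homotopy formula `d (K α) = α - K (d α)` for continuous one-forms with continuous weak
exterior derivative. -/
theorem HasWeakExteriorDeriv.hasFDerivAt_radialPrimitive [CompleteSpace F] {x₀ : E} {R : ℝ}
    {α : E → E →L[ℝ] F} {β : E → E →L[ℝ] E →L[ℝ] F}
    (hw : HasWeakExteriorDeriv μ (ball x₀ R) α β) (hα : ContinuousOn α (ball x₀ R))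
    (hβ : ContinuousOn β (ball x₀ R)) {x : E} (hx : x ∈ ball x₀ R) :
    HasFDerivAt (radialPrimitive x₀ α) (α x - radialContraction x₀ β x) x := by
  obtain ⟨R₂, hxR₂, hR₂⟩ := exists_between (mem_ball.1 hx)
  obtain ⟨R₁, hxR₁, hR₁⟩ := exists_between hxR₂
  have hR₁0 : 0 ≤ R₁ := dist_nonneg.trans hxR₁.le
  have hsub : closedBall x₀ R₂ ⊆ ball x₀ R := closedBall_subset_ball hR₂
  have hsub₁ : closedBall x₀ R₁ ⊆ closedBall x₀ R₂ := closedBall_subset_closedBall hR₁.le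
  have hα₂ := hα.mono hsub
  have hβ₂ := hβ.mono hsub
  -- Cut off the forms to make them integrable; this changes nothing near the smaller ball.
  set α' := indicator (closedBall x₀ R₂) α with hα'
  set β' := indicator (closedBall x₀ R₂) β with hβ'
  have eα : EqOn α' α (closedBall x₀ R₂) := fun y hy ↦ indicator_of_mem hy _
  have eβ : EqOn β' β (closedBall x₀ R₂) := fun y hy ↦ indicator_of_mem hy _
  have iα : Integrable α' μ :=
    (hα₂.integrableOn_compact (isCompact_closedBall x₀ R₂)).integrable_indicator
      measurableSet_closedBall
  have iβ : Integrable β' μ :=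
    (hβ₂.integrableOn_compact (isCompact_closedBall x₀ R₂)).integrable_indicator
      measurableSet_closedBall
  set δ : ℕ → ℝ := fun m ↦ (R₂ - R₁) / (m + 1) with hδ
  have hδ0 : ∀ m, 0 < δ m := fun m ↦ div_pos (sub_pos.2 hR₁) (by positivity)
  have hδ1 : ∀ m, δ m ≤ R₂ - R₁ := fun m ↦
    div_le_self (sub_pos.2 hR₁).le (by linarith [Nat.cast_nonneg (α := ℝ) m])
  let φ : ℕ → ContDiffBump (0 : E) := fun m ↦
    ⟨δ m / 2, δ m, half_pos (hδ0 m), half_lt_self (hδ0 m)⟩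
  have hφ : Tendsto (fun m ↦ (φ m).rOut) atTop (𝓝 0) :=
    tendsto_const_div_atTop_nhds_zero_nat (R₂ - R₁) |>.comp (tendsto_add_atTop_nat 1) |>.congr
      fun m ↦ by simp [φ, hδ]
  set A : ℕ → E → E →L[ℝ] F := fun m ↦ (φ m).normed μ ⋆[lsmul ℝ ℝ, μ] α' with hA
  set B : ℕ → E → E →L[ℝ] E →L[ℝ] F := fun m ↦ (φ m).normed μ ⋆[lsmul ℝ ℝ, μ] β' with hB
  have hAc : ∀ m, ContDiff ℝ 1 (A m) := fun m ↦
    (φ m).hasCompactSupport_normed.contDiff_convolution_left _ ((φ m).contDiff_normed)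
      iα.locallyIntegrable
  have hBc : ∀ m, Continuous (B m) := fun m ↦
    (φ m).hasCompactSupport_normed.continuous_convolution_left _ ((φ m).continuous_normed)
      iβ.locallyIntegrable
  have uA : TendstoUniformlyOn A α atTop (closedBall x₀ R₁) :=
    (tendstoUniformlyOn_normed_convolution iα.1 (hα₂.congr eα) hR₁ hφ).congr_right
      (eα.mono hsub₁)
  have uB : TendstoUniformlyOn B β atTop (closedBall x₀ R₁) :=
    (tendstoUniformlyOn_normed_convolution iβ.1 (hβ₂.congr eβ) hR₁ hφ).congr_right
      (eβ.mono hsub₁)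
  have hcurl : ∀ m, ∀ y ∈ closedBall x₀ R₁,
      fderiv ℝ (A m) y - (fderiv ℝ (A m) y).flip = B m y := by
    intro m y hy
    ext u w
    refine fderiv_convolution_antisymm (φ m).contDiff_normed (φ m).hasCompactSupport_normed hw
      iα.locallyIntegrable iβ.locallyIntegrable hsub eα eβ (fun z hz hz' ↦ hz ?_) u w
    rw [(φ m).tsupport_normed_eq, mem_closedBall, dist_zero_right, ← dist_eq_norm] at hz'
    have h1 := dist_triangle z y x₀
    have h2 := hδ1 m
    have h3 : dist y z ≤ δ m := hz'
    rw [mem_closedBall] at hy ⊢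
    rw [dist_comm] at h3
    linarith
  have hdA : ∀ m, ∀ y ∈ ball x₀ R₁, HasFDerivAt (radialPrimitive x₀ (A m))
      (A m y - radialContraction x₀ (B m) y) y := by
    intro m y hy
    refine (hasFDerivAt_radialPrimitive_of_contDiff x₀ (hAc m) y).congr_fderiv ?_
    congr 1
    refine intervalIntegral.integral_congr fun t ht ↦ ?_
    rw [uIcc_of_le zero_le_one] at ht
    simp only
    rw [hcurl m _ (segment_mem_closedBall (ball_subset_closedBall hy) ht)]
  refine hasFDerivAt_of_tendstoUniformlyOn (l := atTop) (𝕜 := ℝ)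
    (g' := fun y ↦ α y - radialContraction x₀ β y) isOpen_ball ?_ hdA ?_
    (mem_ball.2 hxR₁)
  · rw [Metric.tendstoUniformlyOn_iff] at uA uB ⊢
    intro ε hε
    have hR : 0 < R₁ + 2 := by linarith
    filter_upwards [uA _ (div_pos hε hR), uB _ (div_pos hε hR)] with m h1 h2 y hy
    have hy' := ball_subset_closedBall hy
    have h3 := norm_radialContraction_le (β := fun y ↦ β y - B m y) hy'
      (C := ε / (R₁ + 2)) fun z hz ↦ by
        rw [← dist_eq_norm]; exact (h2 z hz).le
    rw [radialContraction_sub (hβ₂.mono hsub₁) (hBc m).continuousOn hy'] at h3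
    have h4 := h1 y hy'
    rw [dist_eq_norm] at h4 ⊢
    have e : α y - radialContraction x₀ β y - (A m y - radialContraction x₀ (B m) y)
      = (α y - A m y) - (radialContraction x₀ β y - radialContraction x₀ (B m) y) := by abel
    rw [e]
    refine (norm_sub_le _ _).trans_lt ((add_lt_add_of_lt_of_le h4 h3).trans ?_)
    have : ε / (R₁ + 2) + ε / (R₁ + 2) * R₁ = ε * ((R₁ + 1) / (R₁ + 2)) := by field_simp; ring
    rw [this]
    refine mul_lt_of_lt_one_right hε ?_
    rw [div_lt_one hR]; linarith
  · intro y hy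
    have hy' := ball_subset_closedBall hy
    rw [Metric.tendsto_atTop']
    rw [Metric.tendstoUniformlyOn_iff] at uA
    intro ε hε
    have hR : 0 < R₁ + 1 := by linarith
    obtain ⟨N, hN⟩ := eventually_atTop.1 (uA _ (div_pos hε hR))
    refine ⟨N, fun m hm ↦ ?_⟩
    have h3 := norm_radialPrimitive_le (α := fun y ↦ α y - A m y) hy'
      (C := ε / (R₁ + 1)) fun z hz ↦ by
        rw [← dist_eq_norm]; exact (hN m hm.le z hz).le
    rw [radialPrimitive_sub (hα₂.mono hsub₁) (hAc m).continuous.continuousOn hy'] at h3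
    rw [dist_comm, dist_eq_norm]
    refine h3.trans_lt ?_
    rw [div_mul_eq_mul_div, div_lt_iff₀ hR]
    nlinarith

end WeakPoincare

/-! ### Products with compactly supported functions -/

section TestFunctions

open MeasureTheory Metric Set Filter Topology ContinuousLinearMap

variable {E G : Type*} [NormedAddCommGroup E] [NormedSpace ℝ E] [NormedAddCommGroup G]
  [NormedSpace ℝ G]

theorem contDiff_smul_of_tsupport_subset {m : WithTop ℕ∞} {ψ : E → ℝ} {g : E → G} {Ω : Set E}
    (hΩ : IsOpen Ω) (hψ : ContDiff ℝ m ψ) (hs : tsupport ψ ⊆ Ω) (hg : ContDiffOn ℝ m g Ω) :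
    ContDiff ℝ m fun x ↦ ψ x • g x := by
  rw [contDiff_iff_contDiffAt]
  intro x
  by_cases hx : x ∈ tsupport ψ
  · exact hψ.contDiffAt.smul (hg.contDiffAt (hΩ.mem_nhds (hs hx)))
  · refine (contDiffAt_const (c := (0 : G))).congr_of_eventuallyEq ?_
    filter_upwards [(isClosed_tsupport ψ).isOpen_compl.mem_nhds hx] with y hy
    rw [image_eq_zero_of_notMem_tsupport hy, zero_smul]

theorem continuous_smul_of_tsupport_subset {ψ : E → ℝ} {g : E → G} {Ω : Set E}
    (hΩ : IsOpen Ω) (hψ : Continuous ψ) (hs : tsupport ψ ⊆ Ω) (hg : ContinuousOn g Ω) :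
    Continuous fun x ↦ ψ x • g x :=
  contDiff_zero.1 <| contDiff_smul_of_tsupport_subset hΩ (contDiff_zero.2 hψ) hs
    (contDiffOn_zero.2 hg)

theorem integrable_smul_of_tsupport_subset [MeasurableSpace E] [OpensMeasurableSpace E]
    {μ : Measure E} [IsFiniteMeasureOnCompacts μ] {ψ : E → ℝ} {g : E → G} {Ω : Set E}
    (hΩ : IsOpen Ω) (hψ : Continuous ψ) (hc : HasCompactSupport ψ) (hs : tsupport ψ ⊆ Ω)
    (hg : ContinuousOn g Ω) : Integrable (fun x ↦ ψ x • g x) μ :=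
  (continuous_smul_of_tsupport_subset hΩ hψ hs hg).integrable_of_hasCompactSupport hc.smul_right

theorem integrable_fderiv_smul_of_tsupport_subset [MeasurableSpace E] [OpensMeasurableSpace E]
    {μ : Measure E} [IsFiniteMeasureOnCompacts μ] {ψ : E → ℝ} {g : E → G} {Ω : Set E}
    (hΩ : IsOpen Ω) (hψ : ContDiff ℝ 1 ψ) (hc : HasCompactSupport ψ) (hs : tsupport ψ ⊆ Ω)
    (hg : ContinuousOn g Ω) (u : E) : Integrable (fun x ↦ fderiv ℝ ψ x u • g x) μ :=
  integrable_smul_of_tsupport_subset hΩ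
    ((hψ.continuous_fderiv one_ne_zero).clm_apply continuous_const) (hc.fderiv_apply ℝ u)
    ((tsupport_fderiv_apply_subset ℝ u).trans hs) hg

theorem contDiffOn_one_of_hasFDerivAt {f : E → G} {f' : E → E →L[ℝ] G} {s : Set E} (hs : IsOpen s)
    (hf : ∀ x ∈ s, HasFDerivAt f (f' x) x) (hf' : ContinuousOn f' s) : ContDiffOn ℝ 1 f s := by
  rw [show (1 : WithTop ℕ∞) = 0 + 1 from rfl, contDiffOn_succ_iff_fderiv_of_isOpen hs]
  refine ⟨fun x hx ↦ (hf x hx).differentiableAt.differentiableWithinAt, by simp, ?_⟩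
  rw [contDiffOn_zero]
  exact hf'.congr fun x hx ↦ (hf x hx).fderiv

end TestFunctions

/-! ### Continuous connections with weakly vanishing curvature -/

section Connection

open MeasureTheory Metric Set Filter Topology ContinuousLinearMap

variable {E F : Type*} [NormedAddCommGroup E] [NormedSpace ℝ E] [FiniteDimensional ℝ E]
  [MeasurableSpace E] [BorelSpace E] {μ : Measure E} [μ.IsAddHaarMeasure]
  [NormedAddCommGroup F] [NormedSpace ℝ F]

/-- The connection `d + Γ` on the trivial bundle with fibre `F` over `Ω`, with continuous connection
form `Γ`, has vanishing curvature `dΓ + Γ ∧ Γ` in the sense of distributions, tested against `C^1`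
functions with compact support in `Ω`. -/
def HasWeakZeroCurvature (μ : Measure E) (Ω : Set E) (Γ : E → E →L[ℝ] F →L[ℝ] F) : Prop :=
  ∀ ψ : E → ℝ, ContDiff ℝ 1 ψ → HasCompactSupport ψ → tsupport ψ ⊆ Ω → ∀ (u w : E) (v : F),
    ∫ x, (fderiv ℝ ψ x u • Γ x w v - fderiv ℝ ψ x w • Γ x u v) ∂μ
      = ∫ x, ψ x • (Γ x u (Γ x w v) - Γ x w (Γ x u v)) ∂μ

theorem HasWeakZeroCurvature.mono {Ω Ω' : Set E} {Γ : E → E →L[ℝ] F →L[ℝ] F}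
    (h : HasWeakZeroCurvature μ Ω Γ) (hs : Ω' ⊆ Ω) : HasWeakZeroCurvature μ Ω' Γ :=
  fun ψ h1 h2 h3 ↦ h ψ h1 h2 (h3.trans hs)

/-- The covariant differential `dV + Γ V` of a section `V` of the trivial bundle. -/
noncomputable def covariantDifferential (Γ : E → E →L[ℝ] F →L[ℝ] F) (V : E → F) (x : E) :
    E →L[ℝ] F :=
  fderiv ℝ V x + (Γ x).flip (V x)

/-- The wedge product `Γ ∧ η` of a matrix-valued and a vector-valued one-form, up to sign:
`(u, w) ↦ Γ(w) η(u) - Γ(u) η(w)`. -/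
noncomputable def wedgeForm (Γ : E →L[ℝ] F →L[ℝ] F) (η : E →L[ℝ] F) : E →L[ℝ] E →L[ℝ] F :=
  Γ.flip.comp η - (Γ.flip.comp η).flip

theorem wedgeForm_apply (Γ : E →L[ℝ] F →L[ℝ] F) (η : E →L[ℝ] F) (u w : E) :
    wedgeForm Γ η u w = Γ w (η u) - Γ u (η w) := rfl

theorem norm_wedgeForm_le (Γ : E →L[ℝ] F →L[ℝ] F) (η : E →L[ℝ] F) :
    ‖wedgeForm Γ η‖ ≤ 2 * (‖Γ‖ * ‖η‖) := by
  have h : ‖Γ.flip.comp η‖ ≤ ‖Γ‖ * ‖η‖ := (opNorm_comp_le _ _).trans (by rw [opNorm_flip])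
  refine (norm_sub_le _ _).trans ?_
  rw [opNorm_flip]
  linarith

theorem continuousOn_wedgeForm {Γ : E → E →L[ℝ] F →L[ℝ] F} {η : E → E →L[ℝ] F} {s : Set E}
    (hΓ : ContinuousOn Γ s) (hη : ContinuousOn η s) :
    ContinuousOn (fun x ↦ wedgeForm (Γ x) (η x)) s := by
  have h1 : ContinuousOn (fun x ↦ (Γ x).flip) s :=
    (flipₗᵢ ℝ E F F).continuous.comp_continuousOn hΓ
  have h2 : ContinuousOn (fun x ↦ (Γ x).flip.comp (η x)) s := h1.clm_comp hη
  exact h2.sub ((flipₗᵢ ℝ E E F).continuous.comp_continuousOn h2)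

theorem continuousOn_flip_apply {Γ : E → E →L[ℝ] F →L[ℝ] F} {V : E → F} {s : Set E}
    (hΓ : ContinuousOn Γ s) (hV : ContinuousOn V s) :
    ContinuousOn (fun x ↦ (Γ x).flip (V x)) s :=
  ((flipₗᵢ ℝ E F F).continuous.comp_continuousOn hΓ).clm_apply hV

theorem continuousOn_covariantDifferential {Γ : E → E →L[ℝ] F →L[ℝ] F} {V : E → F} {s : Set E}
    (hs : IsOpen s) (hΓ : ContinuousOn Γ s) (hV : ContDiffOn ℝ 1 V s) :
    ContinuousOn (covariantDifferential Γ V) s :=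
  (hV.continuousOn_fderiv_of_isOpen hs le_rfl).add (continuousOn_flip_apply hΓ hV.continuousOn)

/-- For a flat connection, `d (Γ V) = - Γ ∧ (dV + Γ V)` holds weakly: the curvature terms cancel.
The functions `ψ ℓ(V)`, for coordinates `ℓ` on `F`, serve as `C^1` test functions. -/
theorem HasWeakZeroCurvature.hasWeakExteriorDeriv [FiniteDimensional ℝ F] {Ω : Set E}
    {Γ : E → E →L[ℝ] F →L[ℝ] F} (h : HasWeakZeroCurvature μ Ω Γ) (hΩ : IsOpen Ω)
    (hΓ : ContinuousOn Γ Ω) {V : E → F} (hV : ContDiffOn ℝ 1 V Ω) :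
    HasWeakExteriorDeriv μ Ω (fun x ↦ (Γ x).flip (V x))
      (fun x ↦ wedgeForm (Γ x) (covariantDifferential Γ V x)) := by
  intro ψ hψ hψc hψs u w
  let b := Module.finBasis ℝ F
  let ℓ := fun i ↦ (b.coord i).toContinuousLinearMap
  have hsum : ∀ (T : F →L[ℝ] F) (v : F), ∑ i, ℓ i v • T (b i) = T v := by
    intro T v
    conv_rhs => rw [← b.sum_repr v, map_sum]
    refine Finset.sum_congr rfl fun i _ ↦ ?_
    rw [map_smul]
    rfl
  have hχ : ∀ i, ContDiff ℝ 1 fun x ↦ ψ x * ℓ i (V x) := fun i ↦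
    contDiff_smul_of_tsupport_subset hΩ hψ hψs ((ℓ i).contDiff.comp_contDiffOn hV)
  have hχs : ∀ i, tsupport (fun x ↦ ψ x * ℓ i (V x)) ⊆ tsupport ψ := fun i ↦
    tsupport_mul_subset_left
  have hχc : ∀ i, HasCompactSupport fun x ↦ ψ x * ℓ i (V x) := fun i ↦ hψc.mul_right
  have key := Finset.sum_congr (rfl : (Finset.univ : Finset (Fin (Module.finrank ℝ F))) = _)
    fun i _ ↦ h _ (hχ i) (hχc i) ((hχs i).trans hψs) u w (b i)
  have hfd : ∀ x ∈ Ω, ∀ i v, fderiv ℝ (fun x ↦ ψ x * ℓ i (V x)) x v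
      = ψ x * ℓ i (fderiv ℝ V x v) + fderiv ℝ ψ x v * ℓ i (V x) := by
    intro x hx i v
    have h1 := (hψ.differentiable one_ne_zero x).hasFDerivAt
    have h2 := ((hV.differentiableOn one_ne_zero).differentiableAt (hΩ.mem_nhds hx)).hasFDerivAt
    have h3 : HasFDerivAt (fun x ↦ ℓ i (V x)) _ x := (ℓ i).hasFDerivAt.comp x h2
    have h4 : HasFDerivAt (fun x ↦ ψ x * ℓ i (V x)) _ x := h1.mul h3
    rw [h4.fderiv]
    simp [mul_comm]
  have hΓc : ∀ (u : E) (v : F), ContinuousOn (fun x ↦ Γ x u v) Ω := fun u v ↦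
    (hΓ.clm_apply continuousOn_const).clm_apply continuousOn_const
  have hVc := hV.continuousOn
  have hVd : ∀ v, ContinuousOn (fun x ↦ fderiv ℝ V x v) Ω := fun v ↦
    (hV.continuousOn_fderiv_of_isOpen hΩ le_rfl).clm_apply continuousOn_const
  have hΓV : ∀ u, ContinuousOn (fun x ↦ Γ x u (V x)) Ω := fun u ↦
    (hΓ.clm_apply continuousOn_const).clm_apply hVc
  have hΓD : ∀ u v, ContinuousOn (fun x ↦ Γ x u (fderiv ℝ V x v)) Ω := fun u v ↦
    (hΓ.clm_apply continuousOn_const).clm_apply (hVd v)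
  have hΓΓ : ∀ (u w : E) (v : F), ContinuousOn (fun x ↦ Γ x u (Γ x w v)) Ω := fun u w v ↦
    (hΓ.clm_apply continuousOn_const).clm_apply (hΓc w v)
  have hΓΓV : ∀ u w : E, ContinuousOn (fun x ↦ Γ x u (Γ x w (V x))) Ω := fun u w ↦
    (hΓ.clm_apply continuousOn_const).clm_apply (hΓV w)
  rw [← integral_finsetSum, ← integral_finsetSum] at key
  rotate_left
  · exact fun i _ ↦ integrable_smul_of_tsupport_subset hΩ (hχ i).continuous (hχc i)
      ((hχs i).trans hψs) ((hΓΓ _ _ _).sub (hΓΓ _ _ _))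
  · exact fun i _ ↦ (integrable_fderiv_smul_of_tsupport_subset hΩ (hχ i) (hχc i)
      ((hχs i).trans hψs) (hΓc _ _) _).sub (integrable_fderiv_smul_of_tsupport_subset hΩ (hχ i)
        (hχc i) ((hχs i).trans hψs) (hΓc _ _) _)
  have e1 : ∀ x, ∑ i, (fderiv ℝ (fun x ↦ ψ x * ℓ i (V x)) x u • Γ x w (b i)
        - fderiv ℝ (fun x ↦ ψ x * ℓ i (V x)) x w • Γ x u (b i))
      = (fderiv ℝ ψ x u • Γ x w (V x) - fderiv ℝ ψ x w • Γ x u (V x))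
        + ψ x • (Γ x w (fderiv ℝ V x u) - Γ x u (fderiv ℝ V x w)) := by
    intro x
    by_cases hx : x ∈ tsupport ψ
    · simp only [hfd x (hψs hx), add_smul, mul_smul, Finset.sum_sub_distrib,
        Finset.sum_add_distrib, ← Finset.smul_sum, hsum, smul_sub]
      abel
    · have h1 : ψ x = 0 := image_eq_zero_of_notMem_tsupport hx
      have h2 : fderiv ℝ ψ x = 0 := image_eq_zero_of_notMem_tsupport
        fun h ↦ hx (tsupport_fderiv_subset ℝ h)
      have h3 : ∀ i, fderiv ℝ (fun x ↦ ψ x * ℓ i (V x)) x = 0 := fun i ↦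
        image_eq_zero_of_notMem_tsupport fun h ↦ hx (hχs i (tsupport_fderiv_subset ℝ h))
      simp [h1, h2, h3]
  have e2 : ∀ x, ∑ i, (ψ x * ℓ i (V x)) • (Γ x u (Γ x w (b i)) - Γ x w (Γ x u (b i)))
      = ψ x • (Γ x u (Γ x w (V x)) - Γ x w (Γ x u (V x))) := by
    intro x
    have := hsum ((Γ x u).comp (Γ x w) - (Γ x w).comp (Γ x u)) (V x)
    simp only [mul_smul, ← Finset.smul_sum]
    congr 1
  simp only [e1, e2] at key
  have i1 : Integrable (fun x ↦ fderiv ℝ ψ x u • Γ x w (V x) - fderiv ℝ ψ x w • Γ x u (V x)) μ :=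
    (integrable_fderiv_smul_of_tsupport_subset hΩ hψ hψc hψs (hΓV _) _).sub
      (integrable_fderiv_smul_of_tsupport_subset hΩ hψ hψc hψs (hΓV _) _)
  have i2 : Integrable (fun x ↦ ψ x • (Γ x w (fderiv ℝ V x u) - Γ x u (fderiv ℝ V x w))) μ :=
    integrable_smul_of_tsupport_subset hΩ hψ.continuous hψc hψs ((hΓD _ _).sub (hΓD _ _))
  have i3 : Integrable (fun x ↦ ψ x • (Γ x u (Γ x w (V x)) - Γ x w (Γ x u (V x)))) μ :=
    integrable_smul_of_tsupport_subset hΩ hψ.continuous hψc hψs ((hΓΓV _ _).sub (hΓΓV _ _))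
  rw [integral_add i1 i2, ← eq_sub_iff_add_eq, ← integral_sub i3 i2] at key
  simp only [flip_apply]
  rw [key, ← integral_neg]
  refine integral_congr_ae (Eventually.of_forall fun x ↦ ?_)
  simp only [wedgeForm_apply, covariantDifferential, _root_.add_apply, flip_apply, map_add,
    smul_sub, smul_add]
  abel

theorem continuousOn_radialContraction [CompleteSpace F] {β : E → E →L[ℝ] E →L[ℝ] F} {x₀ : E}
    {r : ℝ} (hβ : ContinuousOn β (ball x₀ r)) :
    ContinuousOn (radialContraction x₀ β) (ball x₀ r) := by
  intro x hx
  obtain ⟨r', hxr', hr'⟩ := exists_between (mem_ball.1 hx)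
  have hsub : closedBall x₀ r' ⊆ ball x₀ r := closedBall_subset_ball hr'
  obtain ⟨C, hC⟩ := (isCompact_closedBall x₀ r').exists_bound_of_continuousOn (hβ.mono hsub)
  have hnhds : ball x₀ r' ∈ 𝓝[ball x₀ r] x :=
    mem_nhdsWithin_of_mem_nhds (isOpen_ball.mem_nhds (mem_ball.2 hxr'))
  refine intervalIntegral.continuousWithinAt_of_dominated_interval (bound := fun _ ↦ C * r')
    ?_ ?_ intervalIntegrable_const ?_
  · filter_upwards [hnhds] with y hy
    have hc : ContinuousOn (fun t : ℝ ↦ t • β (x₀ + t • (y - x₀)) (y - x₀)) (uIcc 0 1) :=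
      continuousOn_id.smul (((hβ.mono hsub).comp_radial (ball_subset_closedBall hy)).clm_apply
        continuousOn_const)
    exact (hc.mono uIoc_subset_uIcc).aestronglyMeasurable measurableSet_uIoc
  · filter_upwards [hnhds] with y hy
    refine Eventually.of_forall fun t ht ↦ ?_
    rw [uIoc_of_le zero_le_one] at ht
    have h1 := hC _ (segment_mem_closedBall (ball_subset_closedBall hy) ⟨ht.1.le, ht.2⟩)
    rw [norm_smul, Real.norm_of_nonneg ht.1.le]
    refine (mul_le_mul ht.2 (le_opNorm _ _) (norm_nonneg _) zero_le_one).trans ?_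
    rw [one_mul]
    exact mul_le_mul h1 (by rw [← dist_eq_norm]; exact hy.le) (norm_nonneg _)
      ((norm_nonneg _).trans h1)
  · refine Eventually.of_forall fun t ht ↦ ?_
    rw [uIoc_of_le zero_le_one] at ht
    have hmem := hsub (segment_mem_closedBall (mem_closedBall.2 hxr'.le) ⟨ht.1.le, ht.2⟩)
    have h1 : ContinuousAt (fun y ↦ β (x₀ + t • (y - x₀))) x :=
      ContinuousAt.comp (f := fun y ↦ x₀ + t • (y - x₀)) (g := β)
        (hβ.continuousAt (isOpen_ball.mem_nhds hmem)) (by fun_prop)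
    exact ((h1.clm_apply (by fun_prop)).const_smul t).continuousWithinAt

end Connection

/-! ### Existence of parallel sections -/

section ParallelSections

open MeasureTheory Metric Set Filter Topology ContinuousLinearMap

variable {E F : Type*} [NormedAddCommGroup E] [NormedSpace ℝ E] [FiniteDimensional ℝ E]
  [MeasurableSpace E] [BorelSpace E] {μ : Measure E} [μ.IsAddHaarMeasure]
  [NormedAddCommGroup F] [NormedSpace ℝ F]

theorem norm_radialPrimitive_le_of_mem_ball {α : E → E →L[ℝ] F} {x₀ x : E} {r C : ℝ}
    (hx : x ∈ ball x₀ r) (hC : ∀ y ∈ ball x₀ r, ‖α y‖ ≤ C) :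
    ‖radialPrimitive x₀ α x‖ ≤ C * r :=
  (norm_radialPrimitive_le (mem_closedBall.2 le_rfl) fun y hy ↦
    hC y (closedBall_subset_ball hx hy)).trans
    (mul_le_mul_of_nonneg_left (mem_ball.1 hx).le ((norm_nonneg _).trans (hC x hx)))

theorem norm_radialContraction_le_of_mem_ball {β : E → E →L[ℝ] E →L[ℝ] F} {x₀ x : E} {r C : ℝ}
    (hx : x ∈ ball x₀ r) (hC : ∀ y ∈ ball x₀ r, ‖β y‖ ≤ C) :
    ‖radialContraction x₀ β x‖ ≤ C * r :=
  (norm_radialContraction_le (mem_closedBall.2 le_rfl) fun y hy ↦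
    hC y (closedBall_subset_ball hx hy)).trans
    (mul_le_mul_of_nonneg_left (mem_ball.1 hx).le ((norm_nonneg _).trans (hC x hx)))

/-- The Picard iterates `V ↦ v - K (Γ V)` for the radial parallel transport of `v`. -/
noncomputable def parallelIterate (x₀ : E) (Γ : E → E →L[ℝ] F →L[ℝ] F) (v : F) : ℕ → E → F
  | 0 => fun _ ↦ v
  | m + 1 => fun x ↦ v - radialPrimitive x₀ (fun y ↦ (Γ y).flip (parallelIterate x₀ Γ v m y)) x

theorem parallelIterate_center (x₀ : E) (Γ : E → E →L[ℝ] F →L[ℝ] F) (v : F) (m : ℕ) :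
    parallelIterate x₀ Γ v m x₀ = v := by
  cases m with
  | zero => rfl
  | succ m => simp [parallelIterate, radialPrimitive]

variable [FiniteDimensional ℝ F] {x₀ : E} {r : ℝ} {Γ : E → E →L[ℝ] F →L[ℝ] F}

theorem hasFDerivAt_parallelIterate_succ (h : HasWeakZeroCurvature μ (ball x₀ r) Γ)
    (hΓ : ContinuousOn Γ (ball x₀ r)) (v : F) {m : ℕ}
    (hm : ContDiffOn ℝ 1 (parallelIterate x₀ Γ v m) (ball x₀ r)) {x : E} (hx : x ∈ ball x₀ r) :
    HasFDerivAt (parallelIterate x₀ Γ v (m + 1))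
      (radialContraction x₀ (fun y ↦ wedgeForm (Γ y)
          (covariantDifferential Γ (parallelIterate x₀ Γ v m) y)) x
        - (Γ x).flip (parallelIterate x₀ Γ v m x)) x := by
  have h1 := (h.hasWeakExteriorDeriv isOpen_ball hΓ hm).hasFDerivAt_radialPrimitive
    (continuousOn_flip_apply hΓ hm.continuousOn)
    (continuousOn_wedgeForm hΓ (continuousOn_covariantDifferential isOpen_ball hΓ hm)) hx
  exact (h1.const_sub v).congr_fderiv (neg_sub _ _)

theorem contDiffOn_parallelIterate (h : HasWeakZeroCurvature μ (ball x₀ r) Γ)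
    (hΓ : ContinuousOn Γ (ball x₀ r)) (v : F) (m : ℕ) :
    ContDiffOn ℝ 1 (parallelIterate x₀ Γ v m) (ball x₀ r) := by
  induction m with
  | zero => exact contDiffOn_const
  | succ m hm =>
    refine contDiffOn_one_of_hasFDerivAt isOpen_ball
      (fun x hx ↦ hasFDerivAt_parallelIterate_succ h hΓ v hm hx) ?_
    exact (continuousOn_radialContraction (continuousOn_wedgeForm hΓ
      (continuousOn_covariantDifferential isOpen_ball hΓ hm))).sub
        (continuousOn_flip_apply hΓ hm.continuousOn)

/-- The recursion for the covariant differentials of the Picard iterates. It does not involve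
derivatives of `Γ`, by the weak flatness of the connection. -/
theorem covariantDifferential_parallelIterate_succ (h : HasWeakZeroCurvature μ (ball x₀ r) Γ)
    (hΓ : ContinuousOn Γ (ball x₀ r)) (v : F) (m : ℕ) {x : E} (hx : x ∈ ball x₀ r) :
    covariantDifferential Γ (parallelIterate x₀ Γ v (m + 1)) x
      = radialContraction x₀ (fun y ↦ wedgeForm (Γ y)
          (covariantDifferential Γ (parallelIterate x₀ Γ v m) y)) x
        + (Γ x).flip (parallelIterate x₀ Γ v (m + 1) x - parallelIterate x₀ Γ v m x) := by
  rw [covariantDifferential, (hasFDerivAt_parallelIterate_succ h hΓ v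
    (contDiffOn_parallelIterate h hΓ v m) hx).fderiv, map_sub]
  abel

theorem norm_parallelIterate_sub_le (h : HasWeakZeroCurvature μ (ball x₀ r) Γ)
    (hΓ : ContinuousOn Γ (ball x₀ r)) (v : F) {C : ℝ} (hC : ∀ x ∈ ball x₀ r, ‖Γ x‖ ≤ C)
    (hCr : C * r ≤ 1 / 8) (m : ℕ) {x : E} (hx : x ∈ ball x₀ r) :
    ‖parallelIterate x₀ Γ v (m + 1) x - parallelIterate x₀ Γ v m x‖ ≤ ‖v‖ * (1 / 8) ^ m := by
  have hC0 : 0 ≤ C := (norm_nonneg _).trans (hC x hx)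
  have hflip : ∀ (w : F), ∀ y ∈ ball x₀ r, ‖(Γ y).flip w‖ ≤ C * ‖w‖ := fun w y hy ↦
    ((Γ y).flip.le_opNorm w).trans (by rw [opNorm_flip]; gcongr; exact hC y hy)
  induction m generalizing x with
  | zero =>
    have h1 := norm_radialPrimitive_le_of_mem_ball hx (hflip v)
    have h2 : parallelIterate x₀ Γ v (0 + 1) x - parallelIterate x₀ Γ v 0 x
      = -radialPrimitive x₀ (fun y ↦ (Γ y).flip v) x := by simp [parallelIterate]
    rw [h2, norm_neg]
    refine h1.trans ?_
    nlinarith [norm_nonneg v]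
  | succ m ih =>
    have hc : ∀ j, ContinuousOn (fun y ↦ (Γ y).flip (parallelIterate x₀ Γ v j y)) (ball x₀ r) :=
      fun j ↦ continuousOn_flip_apply hΓ (contDiffOn_parallelIterate h hΓ v j).continuousOn
    have hsub : closedBall x₀ (dist x x₀) ⊆ ball x₀ r := closedBall_subset_ball hx
    have h2 : parallelIterate x₀ Γ v (m + 1 + 1) x - parallelIterate x₀ Γ v (m + 1) x
        = -radialPrimitive x₀ (fun y ↦ (Γ y).flip (parallelIterate x₀ Γ v (m + 1) y)
          - (Γ y).flip (parallelIterate x₀ Γ v m y)) x := by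
      rw [radialPrimitive_sub ((hc _).mono hsub) ((hc _).mono hsub) (mem_closedBall.2 le_rfl)]
      simp only [parallelIterate]
      abel
    rw [h2, norm_neg]
    refine (norm_radialPrimitive_le_of_mem_ball (C := C * (‖v‖ * (1 / 8) ^ m)) hx
      fun y hy ↦ ?_).trans ?_
    · rw [← map_sub]
      refine (hflip _ y hy).trans ?_
      gcongr
      exact ih hy
    · have : 0 ≤ ‖v‖ * (1 / 8) ^ m := by positivity
      rw [pow_succ]
      nlinarith

theorem norm_covariantDifferential_parallelIterate_le
    (h : HasWeakZeroCurvature μ (ball x₀ r) Γ)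
    (hΓ : ContinuousOn Γ (ball x₀ r)) (v : F) {C : ℝ} (hC : ∀ x ∈ ball x₀ r, ‖Γ x‖ ≤ C)
    (hCr : C * r ≤ 1 / 8) (m : ℕ) {x : E} (hx : x ∈ ball x₀ r) :
    ‖covariantDifferential Γ (parallelIterate x₀ Γ v m) x‖ ≤ 4 * C * ‖v‖ * (1 / 2) ^ m := by
  have hC0 : 0 ≤ C := (norm_nonneg _).trans (hC x hx)
  have hflip : ∀ (w : F), ∀ y ∈ ball x₀ r, ‖(Γ y).flip w‖ ≤ C * ‖w‖ := fun w y hy ↦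
    ((Γ y).flip.le_opNorm w).trans (by rw [opNorm_flip]; gcongr; exact hC y hy)
  induction m generalizing x with
  | zero =>
    have h2 : covariantDifferential Γ (parallelIterate x₀ Γ v 0) x = (Γ x).flip v := by
      simp [covariantDifferential, parallelIterate]
    rw [h2]
    refine (hflip v x hx).trans ?_
    nlinarith [mul_nonneg hC0 (norm_nonneg v)]
  | succ m ih =>
    rw [covariantDifferential_parallelIterate_succ h hΓ v m hx]
    have h1 := norm_radialContraction_le_of_mem_ball (x := x) (r := r) (x₀ := x₀)
      (β := fun y ↦ wedgeForm (Γ y) (covariantDifferential Γ (parallelIterate x₀ Γ v m) y))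
      (C := 2 * (C * (4 * C * ‖v‖ * (1 / 2) ^ m))) hx fun y hy ↦ by
        refine (norm_wedgeForm_le _ _).trans ?_
        gcongr
        · exact hC y hy
        · exact ih hy
    have h2 := (hflip _ x hx).trans (mul_le_mul_of_nonneg_left
      (norm_parallelIterate_sub_le h hΓ v hC hCr m hx) hC0)
    refine (norm_add_le _ _).trans ((add_le_add h1 h2).trans ?_)
    have h3 : (1 / 8 : ℝ) ^ m ≤ (1 / 2) ^ m := by gcongr; norm_num
    have h4 : 0 ≤ C * ‖v‖ := mul_nonneg hC0 (norm_nonneg v)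
    have h5 : 0 ≤ C * ‖v‖ * (1 / 2) ^ m := by positivity
    have h6 := mul_le_mul_of_nonneg_left h3 h4
    rw [pow_succ]
    nlinarith

/-- **Frobenius theorem for continuous connections.** If the curvature of a continuous connection
form vanishes in the sense of distributions, then every vector extends to a parallel `C^1` section
on a ball of fixed radius. -/
theorem HasWeakZeroCurvature.exists_parallel {R : ℝ} (hR : 0 < R)
    (h : HasWeakZeroCurvature μ (ball x₀ R) Γ) (hΓ : ContinuousOn Γ (ball x₀ R)) :
    ∃ r, 0 < r ∧ r ≤ R ∧ ∀ v : F, ∃ V : E → F, V x₀ = v ∧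
      ∀ x ∈ ball x₀ r, HasFDerivAt V (-(Γ x).flip (V x)) x := by
  obtain ⟨C, hC⟩ := (isCompact_closedBall x₀ (R / 2)).exists_bound_of_continuousOn
    (hΓ.mono (closedBall_subset_ball (half_lt_self hR)))
  have hC0 : 0 ≤ C := (norm_nonneg _).trans (hC x₀ (mem_closedBall_self (half_pos hR).le))
  set r := min (R / 2) (1 / (8 * (C + 1))) with hr
  have hr0 : 0 < r := lt_min (half_pos hR) (by positivity)
  have hrR : r ≤ R := (min_le_left _ _).trans (half_le_self hR.le)
  have hCr : C * r ≤ 1 / 8 := by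
    have h1 : r ≤ 1 / (8 * (C + 1)) := min_le_right _ _
    rw [le_div_iff₀ (by positivity)] at h1
    nlinarith
  have hsub : ball x₀ r ⊆ ball x₀ R := ball_subset_ball hrR
  have hC' : ∀ x ∈ ball x₀ r, ‖Γ x‖ ≤ C := fun x hx ↦
    hC x (closedBall_subset_closedBall (min_le_left _ _) (ball_subset_closedBall hx))
  have h' := h.mono hsub
  have hΓ' := hΓ.mono hsub
  refine ⟨r, hr0, hrR, fun v ↦ ?_⟩
  -- The iterates converge pointwise and their covariant differentials converge to `0` uniformly.
  have hdist : ∀ x ∈ ball x₀ r, ∀ m, dist (parallelIterate x₀ Γ v m x)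
      (parallelIterate x₀ Γ v (m + 1) x) ≤ ‖v‖ * (1 / 8) ^ m := fun x hx m ↦ by
    rw [dist_comm, dist_eq_norm]
    exact norm_parallelIterate_sub_le h' hΓ' v hC' hCr m hx
  have hlim : ∀ x, ∃ y, x ∈ ball x₀ r →
      Tendsto (fun m ↦ parallelIterate x₀ Γ v m x) atTop (𝓝 y) := by
    intro x
    by_cases hx : x ∈ ball x₀ r
    · obtain ⟨y, hy⟩ := cauchySeq_tendsto_of_complete
        (cauchySeq_of_le_geometric (1 / 8) ‖v‖ (by norm_num) (hdist x hx))
      exact ⟨y, fun _ ↦ hy⟩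
    · exact ⟨0, fun h ↦ absurd h hx⟩
  choose V hV using hlim
  refine ⟨V, ?_, fun x hx ↦ ?_⟩
  · refine tendsto_nhds_unique (hV x₀ (mem_ball_self hr0)) ?_
    simp only [parallelIterate_center]
    exact tendsto_const_nhds
  refine hasFDerivAt_of_tendstoUniformlyOn (l := atTop) (𝕜 := ℝ) (s := ball x₀ r)
    (g' := fun y ↦ -(Γ y).flip (V y)) (f := fun m ↦ parallelIterate x₀ Γ v m)
    (f' := fun m ↦ fderiv ℝ (parallelIterate x₀ Γ v m)) isOpen_ball ?_
    (fun m y hy ↦ (((contDiffOn_parallelIterate h' hΓ' v m).differentiableOn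
      one_ne_zero).differentiableAt (isOpen_ball.mem_nhds hy)).hasFDerivAt) (fun y hy ↦ hV y hy) hx
  rw [Metric.tendstoUniformlyOn_iff]
  intro ε hε
  have hb : Tendsto (fun m : ℕ ↦ 4 * C * ‖v‖ * (1 / 2 : ℝ) ^ m
      + C * (‖v‖ * (1 / 8 : ℝ) ^ m / (1 - 1 / 8))) atTop (𝓝 0) := by
    have h1 := (tendsto_pow_atTop_nhds_zero_of_lt_one (r := (1 / 2 : ℝ)) (by norm_num)
      (by norm_num)).const_mul (4 * C * ‖v‖)
    have h2 := (((tendsto_pow_atTop_nhds_zero_of_lt_one (r := (1 / 8 : ℝ)) (by norm_num)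
      (by norm_num)).const_mul ‖v‖).div_const (1 - 1 / 8)).const_mul C
    simpa using h1.add h2
  filter_upwards [hb.eventually (gt_mem_nhds hε)] with m hm y hy
  refine lt_of_le_of_lt ?_ hm
  rw [dist_comm, dist_eq_norm]
  have e : fderiv ℝ (parallelIterate x₀ Γ v m) y - -(Γ y).flip (V y)
      = covariantDifferential Γ (parallelIterate x₀ Γ v m) y
        - (Γ y).flip (parallelIterate x₀ Γ v m y - V y) := by
    rw [covariantDifferential, map_sub]; abel
  rw [e]
  refine (norm_sub_le _ _).trans (add_le_add
    (norm_covariantDifferential_parallelIterate_le h' hΓ' v hC' hCr m hy) ?_)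
  refine ((Γ y).flip.le_opNorm _).trans ?_
  rw [opNorm_flip, ← dist_eq_norm]
  exact mul_le_mul (hC' y hy) (dist_le_of_le_geometric_of_tendsto (1 / 8) ‖v‖ (by norm_num)
    (hdist y hy) (hV y hy) m) dist_nonneg hC0

end ParallelSections

/-! ### Symmetry of second distributional derivatives -/

section WeakSymmetry

open MeasureTheory Metric Set Filter Topology ContinuousLinearMap Convolution

variable {E : Type*} [NormedAddCommGroup E] [NormedSpace ℝ E] [FiniteDimensional ℝ E]
  [MeasurableSpace E] [BorelSpace E] {μ : Measure E} [μ.IsAddHaarMeasure]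

theorem integral_fderiv_mul_of_tsupport_subset {Ω : Set E} (hΩ : IsOpen Ω) {ζ θ : E → ℝ}
    (hζ : ContDiffOn ℝ 1 ζ Ω) (hθ : ContDiff ℝ 1 θ) (hc : HasCompactSupport θ)
    (hs : tsupport θ ⊆ Ω) (u : E) :
    ∫ x, fderiv ℝ ζ x u * θ x ∂μ = -∫ x, ζ x * fderiv ℝ θ x u ∂μ := by
  have h := integral_mul_fderiv_eq_neg_fderiv_mul_of_integrable (μ := μ) (f := ζ) (g := θ) (v := u)
    ?_ ?_ ?_ ?_ ?_
  · rw [h, neg_neg]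
  · have := integrable_smul_of_tsupport_subset (μ := μ) hΩ hθ.continuous hc hs
      ((hζ.continuousOn_fderiv_of_isOpen hΩ le_rfl).clm_apply (continuousOn_const (c := u)))
    exact this.congr (Eventually.of_forall fun x ↦ mul_comm _ _)
  · have := integrable_fderiv_smul_of_tsupport_subset (μ := μ) hΩ hθ hc hs hζ.continuousOn u
    exact this.congr (Eventually.of_forall fun x ↦ mul_comm _ _)
  · have := integrable_smul_of_tsupport_subset (μ := μ) hΩ hθ.continuous hc hs hζ.continuousOn
    exact this.congr (Eventually.of_forall fun x ↦ mul_comm _ _)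
  · exact fun x hx ↦ (hζ.differentiableOn one_ne_zero).differentiableAt (hΩ.mem_nhds (hs hx))
  · exact fun x _ ↦ hθ.differentiable one_ne_zero x

theorem integral_fderiv_mul_fderiv_comm_of_contDiff_two {Ω : Set E} (hΩ : IsOpen Ω) {ζ θ : E → ℝ}
    (hζ : ContDiffOn ℝ 1 ζ Ω) (hθ : ContDiff ℝ 2 θ) (hc : HasCompactSupport θ)
    (hs : tsupport θ ⊆ Ω) (u w : E) :
    ∫ x, fderiv ℝ ζ x u * fderiv ℝ θ x w ∂μ = ∫ x, fderiv ℝ ζ x w * fderiv ℝ θ x u ∂μ := by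
  have hd : ContDiff ℝ 1 (fderiv ℝ θ) := hθ.fderiv_right (by norm_num)
  have hdv : ∀ v, ContDiff ℝ 1 (fun x ↦ fderiv ℝ θ x v) := fun v ↦ hd.clm_apply contDiff_const
  rw [integral_fderiv_mul_of_tsupport_subset hΩ hζ (hdv w) (hc.fderiv_apply ℝ w)
      ((tsupport_fderiv_apply_subset ℝ w).trans hs) u,
    integral_fderiv_mul_of_tsupport_subset hΩ hζ (hdv u) (hc.fderiv_apply ℝ u)
      ((tsupport_fderiv_apply_subset ℝ u).trans hs) w]
  congr 1
  refine integral_congr_ae (Eventually.of_forall fun x ↦ ?_)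
  have hdd : ∀ v, HasFDerivAt (fun x ↦ fderiv ℝ θ x v) ((fderiv ℝ (fderiv ℝ θ) x).flip v) x :=
    fun v ↦ by
      refine ((hd.differentiable one_ne_zero x).hasFDerivAt.clm_apply
        (hasFDerivAt_const v x)).congr_fderiv ?_
      ext; simp
  have hsymm : IsSymmSndFDerivAt ℝ θ x := hθ.contDiffAt.isSymmSndFDerivAt (by simp)
  simp only [(hdd w).fderiv, (hdd u).fderiv, flip_apply]
  rw [hsymm.eq u w]

/-- Second distributional derivatives of a `C^1` function `ζ` commute, also when tested against a
function `θ` which is only of class `C^1`. -/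
theorem integral_fderiv_mul_fderiv_comm {Ω : Set E} (hΩ : IsOpen Ω) {ζ θ : E → ℝ}
    (hζ : ContDiffOn ℝ 1 ζ Ω) (hθ : ContDiff ℝ 1 θ) (hc : HasCompactSupport θ)
    (hs : tsupport θ ⊆ Ω) (u w : E) :
    ∫ x, fderiv ℝ ζ x u * fderiv ℝ θ x w ∂μ = ∫ x, fderiv ℝ ζ x w * fderiv ℝ θ x u ∂μ := by
  obtain ⟨δ, hδ, hδs⟩ := hc.exists_cthickening_subset_open hΩ hs
  set K := cthickening δ (tsupport θ) with hK
  have hKc : IsCompact K := hc.isCompact.cthickening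
  have hKm : MeasurableSet K := isClosed_cthickening.measurableSet
  obtain ⟨R, hR⟩ := hKc.isBounded.subset_closedBall (0 : E)
  let φ : ℕ → ContDiffBump (0 : E) := fun m ↦
    ⟨δ / (m + 1) / 2, δ / (m + 1), by positivity, half_lt_self (by positivity)⟩
  have hφ : Tendsto (fun m ↦ (φ m).rOut) atTop (𝓝 0) :=
    tendsto_const_div_atTop_nhds_zero_nat δ |>.comp (tendsto_add_atTop_nat 1) |>.congr
      fun m ↦ by simp [φ]
  -- Approximate `θ` by mollification; this converges in `C^1`.
  set Θ : ℕ → E → ℝ := fun m ↦ (φ m).normed μ ⋆[lsmul ℝ ℝ, μ] θ with hΘ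
  have hΘc : ∀ m, ContDiff ℝ 2 (Θ m) := fun m ↦
    (φ m).hasCompactSupport_normed.contDiff_convolution_left _ ((φ m).contDiff_normed)
      hθ.continuous.locallyIntegrable
  have hΘd : ∀ m x, fderiv ℝ (Θ m) x
      = ((φ m).normed μ ⋆[lsmul ℝ ℝ, μ] fderiv ℝ θ : E → E →L[ℝ] ℝ) x := fun m x ↦
    (hc.hasFDerivAt_convolution_right (lsmul ℝ ℝ)
      ((φ m).continuous_normed.locallyIntegrable) hθ x).fderiv
  have hΘs : ∀ m, tsupport (Θ m) ⊆ K := by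
    intro m
    refine closure_minimal ?_ isClosed_cthickening
    refine (support_convolution_subset _).trans ?_
    rintro _ ⟨a, ha, b, hb, rfl⟩
    rw [(φ m).support_normed_eq, mem_ball, dist_zero_right] at ha
    refine mem_cthickening_of_dist_le _ b _ _ (subset_tsupport _ hb) ?_
    have h1 : (φ m).rOut ≤ δ := div_le_self hδ.le (by linarith [Nat.cast_nonneg (α := ℝ) m])
    simpa using ha.le.trans h1
  have hΘcs : ∀ m, HasCompactSupport (Θ m) := fun m ↦
    hKc.of_isClosed_subset (isClosed_tsupport _) (hΘs m)
  have hdc := hθ.continuous_fderiv one_ne_zero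
  have hu := tendstoUniformlyOn_normed_convolution (x₀ := (0 : E)) (r := R) (R := R + 1) (μ := μ)
    hdc.aestronglyMeasurable hdc.continuousOn (by linarith) hφ
  have hζd := hζ.continuousOn_fderiv_of_isOpen hΩ le_rfl
  have hlim : ∀ u w : E, Tendsto (fun m ↦ ∫ x, fderiv ℝ ζ x u * fderiv ℝ (Θ m) x w ∂μ) atTop
      (𝓝 (∫ x, fderiv ℝ ζ x u * fderiv ℝ θ x w ∂μ)) := by
    intro u w
    have hζu : ContinuousOn (fun x ↦ fderiv ℝ ζ x u) Ω := hζd.clm_apply continuousOn_const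
    have hset : ∀ f : E → ℝ, tsupport f ⊆ K →
        ∫ x, fderiv ℝ ζ x u * fderiv ℝ f x w ∂μ
          = ∫ x in K, fderiv ℝ ζ x u * fderiv ℝ f x w ∂μ := by
      intro f hf
      refine (setIntegral_eq_integral_of_forall_compl_eq_zero fun x hx ↦ ?_).symm
      have : fderiv ℝ f x = 0 := image_eq_zero_of_notMem_tsupport
        fun h ↦ hx (hf (tsupport_fderiv_subset ℝ h))
      simp [this]
    have hθK : tsupport θ ⊆ K := self_subset_cthickening _
    rw [hset θ hθK]
    simp only [fun m ↦ hset (Θ m) (hΘs m)]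
    obtain ⟨C, hC⟩ := hKc.exists_bound_of_continuousOn (hζu.mono hδs)
    obtain ⟨D, hD⟩ := hKc.exists_bound_of_continuousOn (hdc.continuousOn (s := K))
    have : IsFiniteMeasure (μ.restrict K) := ⟨by simpa using hKc.measure_lt_top⟩
    have hu' := Metric.tendstoUniformlyOn_iff.1 hu
    refine tendsto_integral_filter_of_dominated_convergence (fun _ ↦ C * ((D + 1) * ‖w‖))
      (Eventually.of_forall fun m ↦ ?_) ?_ (integrable_const _) ?_
    · exact ((hζu.mono hδs).mul (((hΘc m).continuous_fderiv two_ne_zero).clm_apply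
        continuous_const).continuousOn).aestronglyMeasurable hKm
    · filter_upwards [hu' 1 one_pos] with m hm
      refine (ae_restrict_mem hKm).mono fun x hx ↦ ?_
      rw [norm_mul]
      have h1 : ‖fderiv ℝ (Θ m) x‖ ≤ D + 1 := by
        have h2 := hm x (hR hx)
        rw [← hΘd, dist_eq_norm] at h2
        have h3 := norm_le_norm_add_norm_sub' (fderiv ℝ (Θ m) x) (fderiv ℝ θ x)
        rw [norm_sub_rev] at h3
        linarith [hD x hx]
      refine mul_le_mul (hC x hx) ((le_opNorm _ _).trans ?_) (norm_nonneg _)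
        ((norm_nonneg _).trans (hC x hx))
      gcongr
    · refine (ae_restrict_mem hKm).mono fun x hx ↦ ?_
      have h1 : Tendsto (fun m ↦ fderiv ℝ (Θ m) x) atTop (𝓝 (fderiv ℝ θ x)) := by
        simp only [hΘd]
        exact hu.tendsto_at (hR hx)
      have h2 : Tendsto (fun m ↦ fderiv ℝ (Θ m) x w) atTop (𝓝 (fderiv ℝ θ x w)) :=
        ((ContinuousLinearMap.apply ℝ ℝ w).continuous.tendsto _).comp h1
      exact h2.const_mul _
  refine tendsto_nhds_unique (hlim u w) ((hlim w u).congr fun m ↦ ?_)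
  exact (integral_fderiv_mul_fderiv_comm_of_contDiff_two hΩ hζ (hΘc m) (hΘcs m)
    ((hΘs m).trans hδs) w u)

end WeakSymmetry

/-! ### Images of vector fields under tangent maps -/

section TangentMap

open Bundle MeasureTheory TopologicalSpace Set

variable {E : Type*} [NormedAddCommGroup E] [NormedSpace ℝ E] {H : Type*} [TopologicalSpace H]
  {I : ModelWithCorners ℝ E H} {M : Type*} [TopologicalSpace M] [ChartedSpace H M]
  {E' : Type*} [NormedAddCommGroup E'] [NormedSpace ℝ E'] {H' : Type*} [TopologicalSpace H']
  {I' : ModelWithCorners ℝ E' H'} {M' : Type*} [TopologicalSpace M'] [ChartedSpace H' M']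
  {E'' : Type*} [NormedAddCommGroup E''] [NormedSpace ℝ E''] {H'' : Type*} [TopologicalSpace H'']
  {J : ModelWithCorners ℝ E'' H''} {N : Type*} [TopologicalSpace N] [ChartedSpace H'' N]
  {m n : WithTop ℕ∞}

/-- The image of a vector field `V` along a map `b` under the tangent map of `f`, as a vector field
along `f ∘ b`. -/
theorem _root_.ContMDiffOn.mfderiv_apply_section [IsManifold I 1 M] [IsManifold I' 1 M']
    {f : M → M'} {s : Set M} (hs : IsOpen s) (hf : ContMDiffOn I I' n f s) (hmn : m + 1 ≤ n)
    {b : N → M} {V : (z : N) → TangentSpace I (b z)} {t : Set N} (hb : MapsTo b t s)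
    (hV : ContMDiffOn J I.tangent m (fun z ↦ (⟨b z, V z⟩ : TangentBundle I M)) t) :
    ContMDiffOn J I'.tangent m
      (fun z ↦ (⟨f (b z), mfderiv I I' f (b z) (V z)⟩ : TangentBundle I' M')) t := by
  have h := (hf.contMDiffOn_tangentMapWithin hmn hs.uniqueMDiffOn).comp hV fun z hz ↦ hb hz
  refine h.congr fun z hz ↦ ?_
  simp only [Function.comp, tangentMapWithin, mfderivWithin_of_isOpen hs (hb hz)]

end TangentMap

/-! ### Coordinates of Euclidean space -/

theorem _root_.EuclideanSpace.sum_smul_single {n : ℕ} (v : EuclideanSpace ℝ (Fin n)) :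
    ∑ i, v i • EuclideanSpace.single i (1 : ℝ) = v := by
  conv_rhs => rw [← (EuclideanSpace.basisFun (Fin n) ℝ).sum_repr v]
  simp

theorem _root_.EuclideanSpace.clm_ext {n : ℕ} {F : Type*} [NormedAddCommGroup F] [NormedSpace ℝ F]
    {S T : EuclideanSpace ℝ (Fin n) →L[ℝ] F}
    (h : ∀ i, S (EuclideanSpace.single i 1) = T (EuclideanSpace.single i 1)) : S = T := by
  ext v
  rw [← EuclideanSpace.sum_smul_single v]
  simp [h]

theorem _root_.EuclideanSpace.clm_apply_eq_sum {n : ℕ} {F : Type*} [NormedAddCommGroup F]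
    [NormedSpace ℝ F]
    (T : EuclideanSpace ℝ (Fin n) →L[ℝ] F) (v : EuclideanSpace ℝ (Fin n)) :
    T v = ∑ b, v b • T (EuclideanSpace.single b 1) := by
  conv_lhs => rw [← EuclideanSpace.sum_smul_single v, map_sum]
  simp

theorem partialD_component {n : ℕ} {Y : EuclideanSpace ℝ (Fin n) → EuclideanSpace ℝ (Fin n)}
    {y : EuclideanSpace ℝ (Fin n)} (hY : DifferentiableAt ℝ Y y) (a b : Fin n) :
    partialD b (fun z ↦ Y z a) y = fderiv ℝ Y y (EuclideanSpace.single b 1) a := by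
  have h : HasFDerivAt (fun z ↦ Y z a) _ y :=
    (EuclideanSpace.proj a : EuclideanSpace ℝ (Fin n) →L[ℝ] ℝ).hasFDerivAt.comp y hY.hasFDerivAt
  rw [partialD, h.fderiv]
  rfl

/-! ### Vector fields in charts -/

section Charts

open Bundle MeasureTheory TopologicalSpace Set

variable {n : ℕ} {M : Type*} [TopologicalSpace M] [ChartedSpace (EuclideanSpace ℝ (Fin n)) M]
  [IsManifold (𝓡 n) ∞ M] {e : OpenPartialHomeomorph M (EuclideanSpace ℝ (Fin n))}

local notation "𝕍" => EuclideanSpace ℝ (Fin n)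

theorem isManifold_one : IsManifold (𝓡 n) 1 M := .of_le (n := ∞) (by simp)

attribute [local instance] isManifold_one

theorem mdifferentiable_of_mem_maximalAtlas (he : e ∈ IsManifold.maximalAtlas (𝓡 n) ∞ M) :
    e.MDifferentiable (𝓡 n) (𝓡 n) :=
  ⟨(contMDiffOn_of_mem_maximalAtlas he).mdifferentiableOn (by simp),
    (contMDiffOn_symm_of_mem_maximalAtlas he).mdifferentiableOn (by simp)⟩

theorem mfderiv_chart_mfderiv_symm (he : e ∈ IsManifold.maximalAtlas (𝓡 n) ∞ M) {y : 𝕍}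
    (hy : y ∈ e.target) (v : 𝕍) :
    mfderiv (𝓡 n) (𝓡 n) e (e.symm y) (mfderiv (𝓡 n) (𝓡 n) e.symm y v) = v :=
  congrArg (fun T : 𝕍 →L[ℝ] 𝕍 ↦ T v)
    ((mdifferentiable_of_mem_maximalAtlas he).comp_symm_deriv hy)

theorem mfderiv_symm_mfderiv_chart (he : e ∈ IsManifold.maximalAtlas (𝓡 n) ∞ M) {y : 𝕍}
    (hy : y ∈ e.target) (v : TangentSpace (𝓡 n) (e.symm y)) :
    mfderiv (𝓡 n) (𝓡 n) e.symm y (mfderiv (𝓡 n) (𝓡 n) e (e.symm y) v) = v := by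
  have h := (mdifferentiable_of_mem_maximalAtlas he).symm_comp_deriv (e.map_target hy)
  rw [e.right_inv hy] at h
  exact congrArg (fun T : 𝕍 →L[ℝ] 𝕍 ↦ T v) h

theorem mfderiv_symm_inChart (he : e ∈ IsManifold.maximalAtlas (𝓡 n) ∞ M) {y : 𝕍}
    (hy : y ∈ e.target) (X : (x : M) → TangentSpace (𝓡 n) x) :
    mfderiv (𝓡 n) (𝓡 n) e.symm y (inChart e X y) = X (e.symm y) :=
  mfderiv_symm_mfderiv_chart he hy _

/-- Vector fields with constant components in a chart are smooth. -/
theorem contMDiffOn_mfderiv_symm_const (he : e ∈ IsManifold.maximalAtlas (𝓡 n) ∞ M) (v : 𝕍) :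
    ContMDiffOn (𝓡 n) (𝓡 n).tangent ∞
      (fun y ↦ (⟨e.symm y, mfderiv (𝓡 n) (𝓡 n) e.symm y v⟩ : TangentBundle (𝓡 n) M))
      e.target := by
  refine (contMDiffOn_symm_of_mem_maximalAtlas he).mfderiv_apply_section (b := id)
    (V := fun _ ↦ v) e.open_target (by simp) (mapsTo_id _) ?_
  exact contMDiffOn_vectorSpace_iff_contDiffOn.2 contDiffOn_const

theorem contDiffOn_inChart (he : e ∈ IsManifold.maximalAtlas (𝓡 n) ∞ M) {m : WithTop ℕ∞}
    (hm : m + 1 ≤ ∞) {X : (x : M) → TangentSpace (𝓡 n) x} {U : Set M} {t : Set 𝕍}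
    (ht : t ⊆ e.target) (htU : MapsTo e.symm t U)
    (hX : ContMDiffOn (𝓡 n) (𝓡 n).tangent m
      (fun x ↦ (⟨x, X x⟩ : TangentBundle (𝓡 n) M)) U) : ContDiffOn ℝ m (inChart e X) t := by
  have hsymm : ContMDiffOn (𝓡 n) (𝓡 n) m e.symm t :=
    ((contMDiffOn_symm_of_mem_maximalAtlas he).mono ht).of_le (le_self_add.trans hm)
  have h := (contMDiffOn_of_mem_maximalAtlas he).mfderiv_apply_section (b := e.symm)
    (V := fun y ↦ X (e.symm y)) e.open_source hm (fun y hy ↦ e.map_target (ht hy))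
    (hX.comp hsymm htU)
  exact ((contMDiff_snd_tangentBundle_modelSpace 𝕍 (𝓡 n)).comp_contMDiffOn h).contDiffOn

theorem contDiffOn_inChart_of_contMDiff (he : e ∈ IsManifold.maximalAtlas (𝓡 n) ∞ M)
    {X : (x : M) → TangentSpace (𝓡 n) x}
    (hX : ContMDiff (𝓡 n) (𝓡 n).tangent ∞
      (fun x ↦ (⟨x, X x⟩ : TangentBundle (𝓡 n) M))) : ContDiffOn ℝ ∞ (inChart e X) e.target :=
  contDiffOn_inChart he (by simp) subset_rfl (mapsTo_univ _ _) hX.contMDiffOn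

end Charts

/-! ### The metric in a chart -/

section MetricInChart

open Bundle MeasureTheory TopologicalSpace Set

variable {k l : ℕ} {M : Type*} [TopologicalSpace M]
  [ChartedSpace (EuclideanSpace ℝ (Fin (k + l))) M] [IsManifold (𝓡 (k + l)) ∞ M]
  {e : OpenPartialHomeomorph M (EuclideanSpace ℝ (Fin (k + l)))}

local notation "𝕍" => EuclideanSpace ℝ (Fin (k + l))

attribute [local instance] isManifold_one

namespace C1Metric

/-- The metric in a chart, as a function with values in the bilinear forms on `ℝ^(k+l)`. -/
noncomputable def chartForm (g : C1Metric k l M) (e : OpenPartialHomeomorph M 𝕍) (y : 𝕍) :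
    𝕍 →L[ℝ] 𝕍 →L[ℝ] ℝ :=
  (show 𝕍 →L[ℝ] 𝕍 →L[ℝ] ℝ from g.toForm (e.symm y)).bilinearComp
    (show 𝕍 →L[ℝ] 𝕍 from mfderiv (𝓡 (k + l)) (𝓡 (k + l)) e.symm y)
    (show 𝕍 →L[ℝ] 𝕍 from mfderiv (𝓡 (k + l)) (𝓡 (k + l)) e.symm y)

theorem chartForm_apply (g : C1Metric k l M) (y v w : 𝕍) :
    g.chartForm e y v w = g.toForm (e.symm y)
      (mfderiv (𝓡 (k + l)) (𝓡 (k + l)) e.symm y v)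
      (mfderiv (𝓡 (k + l)) (𝓡 (k + l)) e.symm y w) := rfl

theorem coeff_eq_chartForm (g : C1Metric k l M) (i j : Fin (k + l)) (y : 𝕍) :
    g.coeff e i j y
      = g.chartForm e y (EuclideanSpace.single i 1) (EuclideanSpace.single j 1) := rfl

theorem chartForm_symm (g : C1Metric k l M) (y v w : 𝕍) :
    g.chartForm e y v w = g.chartForm e y w v :=
  g.symm _ _ _

theorem contDiffOn_chartForm (g : C1Metric k l M)
    (he : e ∈ IsManifold.maximalAtlas (𝓡 (k + l)) ∞ M) :
    ContDiffOn ℝ 1 (g.chartForm e) e.target := by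
  rw [contDiffOn_clm_apply]
  intro v
  rw [contDiffOn_clm_apply]
  intro w
  have hsymm : ContMDiffOn (𝓡 (k + l)) (𝓡 (k + l)) 1 e.symm e.target :=
    (contMDiffOn_symm_of_mem_maximalAtlas he).of_le (by simp)
  have h : ContMDiffOn (𝓡 (k + l)) ((𝓡 (k + l)).prod 𝓘(ℝ)) 1
      (fun y ↦ TotalSpace.mk' ℝ (E := Bundle.Trivial M ℝ) (e.symm y)
        (g.toForm (e.symm y) (mfderiv (𝓡 (k + l)) (𝓡 (k + l)) e.symm y v)
          (mfderiv (𝓡 (k + l)) (𝓡 (k + l)) e.symm y w))) e.target := by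
    apply ContMDiffOn.clm_bundle_apply₂ (F₁ := 𝕍) (F₂ := 𝕍)
      (E₁ := (TangentSpace (𝓡 (k + l)) : M → Type _))
      (E₂ := (TangentSpace (𝓡 (k + l)) : M → Type _))
    · exact g.contMDiff.comp_contMDiffOn hsymm
    · exact (contMDiffOn_mfderiv_symm_const he v).of_le (by simp)
    · exact (contMDiffOn_mfderiv_symm_const he w).of_le (by simp)
  intro y hy
  have h2 := h y hy
  rw [contMDiffWithinAt_totalSpace] at h2
  exact h2.2.contDiffWithinAt

theorem toForm_eq_zero_of_forall (g : C1Metric k l M) {x : M} {v : TangentSpace (𝓡 (k + l)) x}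
    (h : ∀ w, g.toForm x w v = 0) : v = 0 := by
  obtain ⟨b, hb⟩ := g.signature x
  refine b.ext_elem fun i ↦ ?_
  have h1 := h (b i)
  rw [← b.sum_repr v, map_sum] at h1
  simp only [map_smul, hb, smul_eq_mul, mul_ite, mul_zero, Finset.sum_ite_eq, Finset.mem_univ,
    if_true] at h1
  have h2 : sgn k l i ≠ 0 := by unfold sgn; split_ifs <;> norm_num
  simpa [h2] using h1

/-- The metric is nondegenerate in a chart. -/
theorem chartForm_eq_zero_of_forall (g : C1Metric k l M)
    (he : e ∈ IsManifold.maximalAtlas (𝓡 (k + l)) ∞ M) {y : 𝕍} (hy : y ∈ e.target) {v : 𝕍}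
    (h : ∀ w, g.chartForm e y v w = 0) : v = 0 := by
  have h1 : mfderiv (𝓡 (k + l)) (𝓡 (k + l)) e.symm y v = 0 := by
    refine g.toForm_eq_zero_of_forall fun w ↦ ?_
    have h2 : g.toForm (e.symm y) (mfderiv (𝓡 (k + l)) (𝓡 (k + l)) e.symm y v)
      (mfderiv (𝓡 (k + l)) (𝓡 (k + l)) e.symm y
        (mfderiv (𝓡 (k + l)) (𝓡 (k + l)) e (e.symm y) w)) = 0 := h _
    rw [mfderiv_symm_mfderiv_chart he hy] at h2
    rw [g.symm]
    exact h2
  have h3 := mfderiv_chart_mfderiv_symm he hy v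
  rw [h1, map_zero] at h3
  exact h3.symm

theorem isUnit_det_coeff (g : C1Metric k l M)
    (he : e ∈ IsManifold.maximalAtlas (𝓡 (k + l)) ∞ M) {y : 𝕍} (hy : y ∈ e.target) :
    IsUnit (Matrix.of fun i j ↦ g.coeff e i j y).det := by
  rw [isUnit_iff_ne_zero]
  intro hdet
  obtain ⟨v, hv0, hv⟩ := Matrix.exists_mulVec_eq_zero_iff.2 hdet
  refine hv0 ?_
  have h : WithLp.toLp 2 v = 0 := by
    refine g.chartForm_eq_zero_of_forall he hy fun w ↦ ?_
    rw [← EuclideanSpace.sum_smul_single w,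
      ← EuclideanSpace.sum_smul_single (WithLp.toLp 2 v)]
    simp only [map_sum, map_smul, _root_.sum_apply, _root_.smul_apply,
      smul_eq_mul, ← coeff_eq_chartForm]
    refine Finset.sum_eq_zero fun i _ ↦ ?_
    have h1 : ∑ j, g.coeff e i j y * v j = 0 := congrFun hv i
    have h2 : ∀ j, g.coeff e j i y = g.coeff e i j y := fun j ↦ g.chartForm_symm _ _ _
    simp only [h2, mul_comm (v _), h1, mul_zero]
  simpa using congrArg WithLp.ofLp h

end C1Metric

end MetricInChart

/-! ### The Levi-Civita connection in a chart -/

section Koszul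

open Bundle MeasureTheory TopologicalSpace Set

variable {k l : ℕ} {M : Type*} [TopologicalSpace M]
  [ChartedSpace (EuclideanSpace ℝ (Fin (k + l))) M] [IsManifold (𝓡 (k + l)) ∞ M]
  {e : OpenPartialHomeomorph M (EuclideanSpace ℝ (Fin (k + l)))}

local notation "𝕍" => EuclideanSpace ℝ (Fin (k + l))

namespace C1Metric

/-- The Christoffel symbols in a chart, assembled to the bilinear map
`(u, v) ↦ Γ(u, v) = (Γ^a_{bc} u^b v^c)_a`. -/
noncomputable def christoffelForm (g : C1Metric k l M) (e : OpenPartialHomeomorph M 𝕍) (y : 𝕍) :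
    𝕍 →L[ℝ] 𝕍 →L[ℝ] 𝕍 :=
  ∑ a, ∑ b, ∑ c, g.christoffel e a b c y •
    (EuclideanSpace.proj b : 𝕍 →L[ℝ] ℝ).smulRight
      ((EuclideanSpace.proj c : 𝕍 →L[ℝ] ℝ).smulRight (EuclideanSpace.single a (1 : ℝ)))

theorem christoffelForm_apply (g : C1Metric k l M) (y u v : 𝕍) (a : Fin (k + l)) :
    g.christoffelForm e y u v a = ∑ b, ∑ c, g.christoffel e a b c y * u b * v c := by
  simp only [christoffelForm, _root_.sum_apply, _root_.smul_apply,
    ContinuousLinearMap.smulRight_apply, PiLp.proj_apply, WithLp.ofLp_sum,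
    WithLp.ofLp_smul, Finset.sum_apply, Pi.smul_apply, PiLp.single_apply, smul_eq_mul,
    mul_ite, mul_one, mul_zero]
  rw [Finset.sum_eq_single a]
  · simp [mul_assoc]
  · exact fun b _ hb ↦ by simp [hb.symm]
  · simp

theorem partialD_coeff (g : C1Metric k l M)
    (he : e ∈ IsManifold.maximalAtlas (𝓡 (k + l)) ∞ M) {y : 𝕍} (hy : y ∈ e.target)
    (i j m : Fin (k + l)) :
    partialD m (g.coeff e i j) y = fderiv ℝ (g.chartForm e) y (EuclideanSpace.single m 1)
      (EuclideanSpace.single i 1) (EuclideanSpace.single j 1) := by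
  have h1 := (((g.contDiffOn_chartForm he).differentiableOn one_ne_zero).differentiableAt
    (e.open_target.mem_nhds hy)).hasFDerivAt
  have h2 := (h1.clm_apply (hasFDerivAt_const (EuclideanSpace.single i (1 : ℝ)) y)).clm_apply
    (hasFDerivAt_const (EuclideanSpace.single j (1 : ℝ)) y)
  have h3 : HasFDerivAt (g.coeff e i j) _ y := h2
  rw [partialD, h3.fderiv]
  simp

theorem continuousOn_coeff (g : C1Metric k l M)
    (he : e ∈ IsManifold.maximalAtlas (𝓡 (k + l)) ∞ M) (i j : Fin (k + l)) :
    ContinuousOn (g.coeff e i j) e.target :=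
  ((g.contDiffOn_chartForm he).continuousOn.clm_apply continuousOn_const).clm_apply
    continuousOn_const

/-- The inverse of the metric is continuous because the determinant does not vanish, so that the
Christoffel symbols of a `C^1` metric are continuous. -/
theorem continuousOn_christoffelForm (g : C1Metric k l M)
    (he : e ∈ IsManifold.maximalAtlas (𝓡 (k + l)) ∞ M) :
    ContinuousOn (g.christoffelForm e) e.target := by
  have hp : ∀ i j m, ContinuousOn (partialD m (g.coeff e i j)) e.target := fun i j m ↦ by
    have h := (g.contDiffOn_chartForm he).continuousOn_fderiv_of_isOpen e.open_target le_rfl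
    have h' := ((h.clm_apply (continuousOn_const (c := EuclideanSpace.single m (1 : ℝ)))).clm_apply
      (continuousOn_const (c := EuclideanSpace.single i (1 : ℝ)))).clm_apply
      (continuousOn_const (c := EuclideanSpace.single j (1 : ℝ)))
    exact h'.congr fun y hy ↦ g.partialD_coeff he hy i j m
  have hmat : ContinuousOn (fun y ↦ Matrix.of fun i j ↦ g.coeff e i j y) e.target :=
    continuousOn_pi.2 fun i ↦ continuousOn_pi.2 fun j ↦ g.continuousOn_coeff he i j
  have hinv : ∀ a d, ContinuousOn (fun y ↦ (Matrix.of fun i j ↦ g.coeff e i j y)⁻¹ a d)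
      e.target := by
    intro a d
    simp only [Matrix.inv_def, Matrix.smul_apply, Ring.inverse_eq_inv', smul_eq_mul]
    refine ContinuousOn.mul ?_ ?_
    · exact (continuous_id.matrix_det.comp_continuousOn hmat).inv₀ fun y hy ↦
        (g.isUnit_det_coeff he hy).ne_zero
    · exact ((continuous_id.matrix_adjugate).matrix_elem a d).comp_continuousOn hmat
  have hΓ : ∀ a b c, ContinuousOn (g.christoffel e a b c) e.target := fun a b c ↦
    continuousOn_const.mul <| continuousOn_finsetSum _ fun d _ ↦
      (hinv a d).mul (((hp _ _ _).add (hp _ _ _)).sub (hp _ _ _))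
  exact continuousOn_finsetSum _ fun a _ ↦ continuousOn_finsetSum _ fun b _ ↦
    continuousOn_finsetSum _ fun c _ ↦ (hΓ a b c).smul continuousOn_const

theorem christoffelForm_single (g : C1Metric k l M) (y : 𝕍) (a b c : Fin (k + l)) :
    g.christoffelForm e y (EuclideanSpace.single b 1) (EuclideanSpace.single c 1) a
      = g.christoffel e a b c y := by
  rw [christoffelForm_apply]
  simp

/-- The Christoffel symbols of the first kind. -/
theorem sum_coeff_mul_christoffel (g : C1Metric k l M)
    (he : e ∈ IsManifold.maximalAtlas (𝓡 (k + l)) ∞ M) {y : 𝕍} (hy : y ∈ e.target)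
    (b c d : Fin (k + l)) :
    ∑ a, g.coeff e d a y * g.christoffel e a b c y = (1 / 2) *
      (partialD c (g.coeff e d b) y + partialD b (g.coeff e c d) y
        - partialD d (g.coeff e b c) y) := by
  set S : Fin (k + l) → ℝ := fun d ↦
    partialD c (g.coeff e d b) y + partialD b (g.coeff e c d) y - partialD d (g.coeff e b c) y
    with hS
  set G : Matrix (Fin (k + l)) (Fin (k + l)) ℝ := Matrix.of fun i j ↦ g.coeff e i j y with hG
  have h1 : ∀ a, g.christoffel e a b c y = (1 / 2) * (G⁻¹.mulVec S) a := fun a ↦ rfl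
  have h2 : G.mulVec (G⁻¹.mulVec S) = S := by
    rw [Matrix.mulVec_mulVec, Matrix.mul_nonsing_inv _ (g.isUnit_det_coeff he hy),
      Matrix.one_mulVec]
  have h3 := congrFun h2 d
  calc ∑ a, g.coeff e d a y * g.christoffel e a b c y
      = (1 / 2) * ∑ a, G d a * (G⁻¹.mulVec S) a := by
        rw [Finset.mul_sum]
        refine Finset.sum_congr rfl fun a _ ↦ ?_
        rw [h1, hG, Matrix.of_apply]; ring
    _ = (1 / 2) * S d := by rw [← h3]; rfl

theorem fderiv_chartForm_symm (g : C1Metric k l M)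
    (he : e ∈ IsManifold.maximalAtlas (𝓡 (k + l)) ∞ M) {y : 𝕍} (hy : y ∈ e.target) (u v w : 𝕍) :
    fderiv ℝ (g.chartForm e) y u v w = fderiv ℝ (g.chartForm e) y u w v := by
  have h1 := (((g.contDiffOn_chartForm he).differentiableOn one_ne_zero).differentiableAt
    (e.open_target.mem_nhds hy)).hasFDerivAt
  have h2 := fun v w : 𝕍 ↦ (h1.clm_apply (hasFDerivAt_const v y)).clm_apply
    (hasFDerivAt_const w y)
  have h3 : HasFDerivAt (fun y ↦ g.chartForm e y v w) _ y := h2 v w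
  have h4 : HasFDerivAt (fun y ↦ g.chartForm e y w v) _ y := h2 w v
  have h5 : (fun y ↦ g.chartForm e y v w) = fun y ↦ g.chartForm e y w v :=
    funext fun y ↦ g.chartForm_symm _ _ _
  rw [h5] at h3
  simpa using congrArg (fun T : 𝕍 →L[ℝ] ℝ ↦ T u) (h3.unique h4)

/-- The Koszul formula for the Christoffel symbols. -/
theorem two_mul_chartForm_christoffelForm (g : C1Metric k l M)
    (he : e ∈ IsManifold.maximalAtlas (𝓡 (k + l)) ∞ M) {y : 𝕍} (hy : y ∈ e.target) (u v w : 𝕍) :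
    2 * g.chartForm e y (g.christoffelForm e y u v) w
      = fderiv ℝ (g.chartForm e) y v u w + fderiv ℝ (g.chartForm e) y u v w
        - fderiv ℝ (g.chartForm e) y w u v := by
  set D := fderiv ℝ (g.chartForm e) y with hD
  have hDsymm : ∀ u v w, D u v w = D u w v := g.fderiv_chartForm_symm he hy
  let Φ : 𝕍 →L[ℝ] 𝕍 →L[ℝ] 𝕍 →L[ℝ] ℝ :=
    (2 : ℝ) • (ContinuousLinearMap.compL ℝ 𝕍 𝕍 (𝕍 →L[ℝ] ℝ) (g.chartForm e y)).comp
      (g.christoffelForm e y)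
  let Ψ : 𝕍 →L[ℝ] 𝕍 →L[ℝ] 𝕍 →L[ℝ] ℝ :=
    D.flip + D - ((ContinuousLinearMap.flipₗᵢ ℝ 𝕍 𝕍 ℝ).toContinuousLinearEquiv :
      (𝕍 →L[ℝ] 𝕍 →L[ℝ] ℝ) →L[ℝ] (𝕍 →L[ℝ] 𝕍 →L[ℝ] ℝ)).comp D.flip
  have hΦΨ : Φ = Ψ := by
    refine EuclideanSpace.clm_ext fun b ↦ EuclideanSpace.clm_ext fun c ↦
      EuclideanSpace.clm_ext fun d ↦ ?_
    have h1 : Φ (EuclideanSpace.single b 1) (EuclideanSpace.single c 1) (EuclideanSpace.single d 1)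
        = 2 * g.chartForm e y (g.christoffelForm e y (EuclideanSpace.single b 1)
          (EuclideanSpace.single c 1)) (EuclideanSpace.single d 1) := rfl
    have h2 : Ψ (EuclideanSpace.single b 1) (EuclideanSpace.single c 1) (EuclideanSpace.single d 1)
        = D (EuclideanSpace.single c 1) (EuclideanSpace.single b 1) (EuclideanSpace.single d 1)
          + D (EuclideanSpace.single b 1) (EuclideanSpace.single c 1) (EuclideanSpace.single d 1)
          - D (EuclideanSpace.single d 1) (EuclideanSpace.single b 1)
            (EuclideanSpace.single c 1) := rfl
    have h3 := g.sum_coeff_mul_christoffel he hy b c d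
    rw [g.partialD_coeff he hy, g.partialD_coeff he hy, g.partialD_coeff he hy, ← hD,
      hDsymm _ (EuclideanSpace.single d 1) (EuclideanSpace.single b 1)] at h3
    rw [h1, h2, chartForm_symm, ← EuclideanSpace.sum_smul_single (g.christoffelForm e y
      (EuclideanSpace.single b 1) (EuclideanSpace.single c 1)), map_sum]
    simp only [map_smul, christoffelForm_single, smul_eq_mul, ← coeff_eq_chartForm]
    rw [Finset.sum_congr rfl fun a _ ↦ mul_comm _ _, h3]
    ring
  exact congrArg (fun T : 𝕍 →L[ℝ] 𝕍 →L[ℝ] 𝕍 →L[ℝ] ℝ ↦ T u v w) hΦΨ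

/-- The Levi-Civita connection is torsion-free. -/
theorem christoffelForm_symm (g : C1Metric k l M)
    (he : e ∈ IsManifold.maximalAtlas (𝓡 (k + l)) ∞ M) {y : 𝕍} (hy : y ∈ e.target) (u v : 𝕍) :
    g.christoffelForm e y u v = g.christoffelForm e y v u := by
  rw [← sub_eq_zero]
  refine g.chartForm_eq_zero_of_forall he hy fun w ↦ ?_
  have h1 := g.two_mul_chartForm_christoffelForm he hy u v w
  have h2 := g.two_mul_chartForm_christoffelForm he hy v u w
  rw [g.fderiv_chartForm_symm he hy w u v] at h1
  rw [map_sub, _root_.sub_apply]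
  linarith

/-- The Levi-Civita connection is metric. -/
theorem fderiv_chartForm (g : C1Metric k l M)
    (he : e ∈ IsManifold.maximalAtlas (𝓡 (k + l)) ∞ M) {y : 𝕍} (hy : y ∈ e.target) (u v w : 𝕍) :
    fderiv ℝ (g.chartForm e) y u v w = g.chartForm e y (g.christoffelForm e y u v) w
      + g.chartForm e y v (g.christoffelForm e y u w) := by
  have h1 := g.two_mul_chartForm_christoffelForm he hy u v w
  have h2 := g.two_mul_chartForm_christoffelForm he hy u w v
  have h3 := g.fderiv_chartForm_symm he hy w u v
  have h4 := g.fderiv_chartForm_symm he hy v u w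
  have h5 := g.fderiv_chartForm_symm he hy u v w
  rw [g.chartForm_symm y v]
  rw [g.fderiv_chartForm_symm he hy w v u] at *
  linarith

theorem covDeriv_eq (g : C1Metric k l M) {X Y : 𝕍 → 𝕍} {y : 𝕍} (hY : DifferentiableAt ℝ Y y) :
    g.covDeriv e X Y y = fderiv ℝ Y y (X y) + g.christoffelForm e y (X y) (Y y) := by
  ext a
  simp only [covDeriv, PiLp.add_apply, christoffelForm_apply, partialD_component hY]
  congr 1
  conv_rhs => rw [← EuclideanSpace.sum_smul_single (X y), map_sum]
  simp

end C1Metric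

end Koszul

/-! ### Distributions given by functions -/

section Distributions

open Bundle MeasureTheory TopologicalSpace Set Filter Topology

variable {n : ℕ}

local notation "𝕍" => EuclideanSpace ℝ (Fin n)

/-- The divergence of a vector field on `ℝ^n`. -/
noncomputable def divergence (X : 𝕍 → 𝕍) (y : 𝕍) : ℝ := ∑ b, partialD b (fun z ↦ X z b) y

theorem funDist_apply {Ω : Opens 𝕍} {m : ℕ∞} {f : 𝕍 → ℝ} (hf : ContinuousOn f Ω)
    (ψ : 𝓓^{m}(Ω, ℝ)) : funDist Ω m f ψ = ∫ y, ψ y * f y := by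
  have hloc : LocallyIntegrableOn f Ω volume :=
    hf.locallyIntegrableOn Ω.isOpen.measurableSet
  exact TestFunction.integralAgainstBilinCLM_eq_integral hloc

theorem continuousOn_partialD {Ω : Set 𝕍} (hΩ : IsOpen Ω) {h : 𝕍 → ℝ} (hh : ContDiffOn ℝ 1 h Ω)
    (i : Fin n) : ContinuousOn (partialD i h) Ω :=
  (hh.continuousOn_fderiv_of_isOpen hΩ le_rfl).clm_apply continuousOn_const

theorem mulPartialDist_apply {Ω : Opens 𝕍} {h f : 𝕍 → ℝ} (hh : ContDiffOn ℝ 1 h Ω)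
    (hf : ContinuousOn f Ω) (i : Fin n) (ψ : 𝓓^{1}(Ω, ℝ)) :
    mulPartialDist Ω i h f ψ
      = -∫ y, (fderiv ℝ ψ y (EuclideanSpace.single i 1) * (h y * f y)
        + ψ y * (partialD i h y * f y)) := by
  have h1 : mulPartialDist Ω i h f ψ
      = -funDist Ω 0 (fun y ↦ h y * f y)
          (TestFunction.lineDerivCLM ℝ (EuclideanSpace.single i (1 : ℝ)) ψ)
        - funDist Ω 1 (fun y ↦ partialD i h y * f y) ψ := rfl
  have hhf : ContinuousOn (fun y ↦ h y * f y) Ω := hh.continuousOn.mul hf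
  have hdf : ContinuousOn (fun y ↦ partialD i h y * f y) Ω :=
    (continuousOn_partialD Ω.isOpen hh i).mul hf
  rw [h1, funDist_apply hhf, funDist_apply hdf, integral_add, neg_add, sub_eq_add_neg]
  · congr 2
  · exact integrable_fderiv_smul_of_tsupport_subset Ω.isOpen ψ.contDiff ψ.hasCompactSupport
      ψ.tsupport_subset hhf _
  · exact integrable_smul_of_tsupport_subset Ω.isOpen ψ.continuous ψ.hasCompactSupport
      ψ.tsupport_subset hdf

end Distributions

/-! ### The distributional covariant derivative as an integral -/

section DistributionalCovariantDerivative

open Bundle MeasureTheory TopologicalSpace Set Filter Topology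

variable {k l : ℕ} {M : Type*} [TopologicalSpace M]
  [ChartedSpace (EuclideanSpace ℝ (Fin (k + l))) M] [IsManifold (𝓡 (k + l)) ∞ M]
  {e : OpenPartialHomeomorph M (EuclideanSpace ℝ (Fin (k + l)))}

local notation "𝕍" => EuclideanSpace ℝ (Fin (k + l))

theorem continuousOn_divergence {n : ℕ} {X : EuclideanSpace ℝ (Fin n) → EuclideanSpace ℝ (Fin n)}
    {Ω : Set (EuclideanSpace ℝ (Fin n))} (hΩ : IsOpen Ω) (hX : ContDiffOn ℝ 1 X Ω) :
    ContinuousOn (divergence X) Ω :=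
  continuousOn_finsetSum _ fun b _ ↦ continuousOn_partialD hΩ
    ((EuclideanSpace.proj b : EuclideanSpace ℝ (Fin n) →L[ℝ] ℝ).contDiff.comp_contDiffOn hX) b

theorem _root_.ContinuousOn.euclidean_apply {n : ℕ} {T : Type*} [TopologicalSpace T]
    {W : T → EuclideanSpace ℝ (Fin n)} {Ω : Set T} (hW : ContinuousOn W Ω) (a : Fin n) :
    ContinuousOn (fun y ↦ W y a) Ω :=
  (EuclideanSpace.proj a : EuclideanSpace ℝ (Fin n) →L[ℝ] ℝ).continuous.comp_continuousOn hW

theorem _root_.ContDiffOn.euclidean_apply {n : ℕ} {T : Type*} [NormedAddCommGroup T]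
    [NormedSpace ℝ T] {m : WithTop ℕ∞}
    {W : T → EuclideanSpace ℝ (Fin n)} {Ω : Set T} (hW : ContDiffOn ℝ m W Ω) (a : Fin n) :
    ContDiffOn ℝ m (fun y ↦ W y a) Ω :=
  (EuclideanSpace.proj a : EuclideanSpace ℝ (Fin n) →L[ℝ] ℝ).contDiff.comp_contDiffOn hW

namespace C1Metric

/-- The distributional covariant derivative, with all derivatives moved to the test function. -/
theorem distCovDeriv_apply (g : C1Metric k l M)
    (he : e ∈ IsManifold.maximalAtlas (𝓡 (k + l)) ∞ M) {X W : 𝕍 → 𝕍}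
    (hX : ContDiffOn ℝ 1 X e.target) (hW : ContinuousOn W e.target) (a : Fin (k + l))
    (ψ : 𝓓^{1}(chartImage e, ℝ)) :
    g.distCovDeriv e X W a ψ
      = ∫ y, (ψ y * g.christoffelForm e y (X y) (W y) a
          - (fderiv ℝ ψ y (X y) + ψ y * divergence X y) * W y a) := by
  have hΓ : ContinuousOn (fun y ↦ g.christoffelForm e y (X y) (W y)) e.target :=
    ((g.continuousOn_christoffelForm he).clm_apply hX.continuousOn).clm_apply hW
  have hΓ' : ∀ y, ∑ b, ∑ c, g.christoffel e a b c y * X y b * W y c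
      = g.christoffelForm e y (X y) (W y) a := fun y ↦ (g.christoffelForm_apply y _ _ a).symm
  have h1 : g.distCovDeriv e X W a ψ
      = ∑ b, mulPartialDist (chartImage e) b (fun y ↦ X y b) (fun y ↦ W y a) ψ
        + funDist (chartImage e) 1
          (fun y ↦ ∑ b, ∑ c, g.christoffel e a b c y * X y b * W y c) ψ := by
    simp [distCovDeriv]
  have hXb : ∀ b, ContDiffOn ℝ 1 (fun y ↦ X y b) (chartImage e) := fun b ↦ hX.euclidean_apply b
  have hWa : ContinuousOn (fun y ↦ W y a) (chartImage e) := hW.euclidean_apply a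
  rw [h1, Finset.sum_congr rfl fun b _ ↦ mulPartialDist_apply (hXb b) hWa b ψ]
  simp only [hΓ']
  rw [funDist_apply (Ω := chartImage e) (hΓ.euclidean_apply a), Finset.sum_neg_distrib,
    ← integral_finsetSum, neg_add_eq_sub, ← integral_sub]
  · refine integral_congr_ae (Eventually.of_forall fun y ↦ ?_)
    have h2 : fderiv ℝ ψ y (X y) = ∑ b, X y b * fderiv ℝ ψ y (EuclideanSpace.single b 1) := by
      conv_lhs => rw [← EuclideanSpace.sum_smul_single (X y), map_sum]
      simp
    simp only [h2, divergence, Finset.mul_sum, Finset.sum_mul, add_mul, Finset.sum_add_distrib]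
    congr 1
    congr 1
    · exact Finset.sum_congr rfl fun b _ ↦ by ring
    · exact Finset.sum_congr rfl fun b _ ↦ by ring
  · exact integrable_smul_of_tsupport_subset e.open_target ψ.continuous ψ.hasCompactSupport
      ψ.tsupport_subset (hΓ.euclidean_apply a)
  · refine integrable_finsetSum _ fun b _ ↦ ?_
    exact (integrable_fderiv_smul_of_tsupport_subset e.open_target ψ.contDiff ψ.hasCompactSupport
      ψ.tsupport_subset ((hXb b).continuousOn.mul hWa) _).add
      (integrable_smul_of_tsupport_subset e.open_target ψ.continuous ψ.hasCompactSupport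
      ψ.tsupport_subset ((continuousOn_partialD e.open_target (hXb b) b).mul hWa))
  · refine fun b _ ↦ ?_
    exact (integrable_fderiv_smul_of_tsupport_subset e.open_target ψ.contDiff ψ.hasCompactSupport
      ψ.tsupport_subset ((hXb b).continuousOn.mul hWa) _).add
      (integrable_smul_of_tsupport_subset e.open_target ψ.continuous ψ.hasCompactSupport
      ψ.tsupport_subset ((continuousOn_partialD e.open_target (hXb b) b).mul hWa))

end C1Metric

end DistributionalCovariantDerivative

/-! ### Extension of coordinate vector fields -/

section Extension

open Bundle MeasureTheory TopologicalSpace Set Filter Topology Metric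

variable {n : ℕ} {M : Type*} [TopologicalSpace M] [ChartedSpace (EuclideanSpace ℝ (Fin n)) M]
  [IsManifold (𝓡 n) ∞ M] {e : OpenPartialHomeomorph M (EuclideanSpace ℝ (Fin n))}

local notation "𝕍" => EuclideanSpace ℝ (Fin n)

attribute [local instance] isManifold_one

/-- Vector fields with constant components near a point extend to global smooth vector fields, by
multiplication with a bump function. -/
theorem exists_contMDiff_inChart_eq [T2Space M]
    (he : e ∈ IsManifold.maximalAtlas (𝓡 n) ∞ M) {p : M} (hp : p ∈ e.source) :
    ∃ r > 0, ball (e p) r ⊆ e.target ∧ ∀ v : 𝕍, ∃ X : (x : M) → TangentSpace (𝓡 n) x,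
      ContMDiff (𝓡 n) (𝓡 n).tangent ∞ (fun x ↦ (⟨x, X x⟩ : TangentBundle (𝓡 n) M)) ∧
      ∀ y ∈ ball (e p) r, inChart e X y = v := by
  obtain ⟨f, -, hf⟩ := (SmoothBumpFunction.nhds_basis_tsupport (I := 𝓡 n) p).mem_iff.1
    (e.open_source.mem_nhds hp)
  have h1 : {y | f (e.symm y) = 1} ∈ 𝓝 (e p) := by
    have := e.continuousAt_symm (e.map_source hp)
    rw [ContinuousAt, e.left_inv hp] at this
    exact this.eventually f.eventuallyEq_one
  obtain ⟨r, hr, hball⟩ := Metric.mem_nhds_iff.1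
    (inter_mem h1 (e.open_target.mem_nhds (e.map_source hp)))
  refine ⟨r, hr, fun y hy ↦ (hball hy).2, fun v ↦ ?_⟩
  set s : (x : M) → TangentSpace (𝓡 n) x := fun x ↦
    (show 𝕍 →L[ℝ] 𝕍 from mfderiv (𝓡 n) (𝓡 n) e.symm (e x)) v with hs
  have hs' : ContMDiffOn (𝓡 n) (𝓡 n).tangent ∞ (fun x ↦ (⟨x, s x⟩ : TangentBundle (𝓡 n) M))
      e.source := by
    refine ((contMDiffOn_mfderiv_symm_const he v).comp (contMDiffOn_of_mem_maximalAtlas he)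
      e.mapsTo).congr fun x hx ↦ ?_
    exact congrArg (fun q : M ↦ (⟨q, (s x : 𝕍)⟩ : TangentBundle (𝓡 n) M)) (e.left_inv hx).symm
  refine ⟨fun x ↦ f x • s x, ?_, fun y hy ↦ ?_⟩
  · exact ContMDiffOn.smul_section_of_tsupport (ψ := f) f.contMDiff.contMDiffOn e.open_source hf hs'
  · have hy1 : f (e.symm y) = 1 := (hball hy).1
    have hyt := (hball hy).2
    have h2 : (s (e.symm y) : 𝕍) = mfderiv (𝓡 n) (𝓡 n) e.symm y v :=
      congrArg (fun z : 𝕍 ↦ (show 𝕍 →L[ℝ] 𝕍 from mfderiv (𝓡 n) (𝓡 n) e.symm z) v)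
        (e.right_inv hyt)
    have h3 : f (e.symm y) • (s (e.symm y) : 𝕍) = mfderiv (𝓡 n) (𝓡 n) e.symm y v := by
      rw [hy1, one_smul, h2]
    exact (congrArg (show 𝕍 →L[ℝ] 𝕍 from mfderiv (𝓡 n) (𝓡 n) e (e.symm y)) h3).trans
      (mfderiv_chart_mfderiv_symm he hyt v)

end Extension

/-! ### From vanishing curvature to parallel frames -/

section Curvature

open Bundle MeasureTheory TopologicalSpace Set Filter Topology Metric

variable {k l : ℕ} {M : Type*} [TopologicalSpace M]
  [ChartedSpace (EuclideanSpace ℝ (Fin (k + l))) M] [IsManifold (𝓡 (k + l)) ∞ M]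
  {e : OpenPartialHomeomorph M (EuclideanSpace ℝ (Fin (k + l)))}

local notation "𝕍" => EuclideanSpace ℝ (Fin (k + l))

theorem contDiffOn_lieBracket {F : Type*} [NormedAddCommGroup F] [NormedSpace ℝ F] {Ω : Set F}
    (hΩ : IsOpen Ω) {X Y : F → F} (hX : ContDiffOn ℝ ∞ X Ω) (hY : ContDiffOn ℝ ∞ Y Ω) :
    ContDiffOn ℝ ∞ (VectorField.lieBracket ℝ X Y) Ω :=
  ((hY.fderiv_of_isOpen hΩ (by simp)).clm_apply hX).sub
    ((hX.fderiv_of_isOpen hΩ (by simp)).clm_apply hY)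

namespace C1Metric

theorem continuousOn_covDeriv (g : C1Metric k l M)
    (he : e ∈ IsManifold.maximalAtlas (𝓡 (k + l)) ∞ M) {X Y : 𝕍 → 𝕍}
    (hX : ContinuousOn X e.target) (hY : ContDiffOn ℝ 1 Y e.target) :
    ContinuousOn (g.covDeriv e X Y) e.target := by
  have h : ContinuousOn (fun y ↦ fderiv ℝ Y y (X y) + g.christoffelForm e y (X y) (Y y))
      e.target :=
    ((hY.continuousOn_fderiv_of_isOpen e.open_target le_rfl).clm_apply hX).add
      (((g.continuousOn_christoffelForm he).clm_apply hX).clm_apply hY.continuousOn)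
  exact h.congr fun y hy ↦ g.covDeriv_eq
    ((hY.differentiableOn one_ne_zero).differentiableAt (e.open_target.mem_nhds hy))

theorem divergence_eq_zero_of_eventuallyEq {X : 𝕍 → 𝕍} {y v : 𝕍} (h : X =ᶠ[𝓝 y] fun _ ↦ v) :
    divergence X y = 0 := by
  refine Finset.sum_eq_zero fun b _ ↦ ?_
  have h1 : (fun z ↦ X z b) =ᶠ[𝓝 y] fun _ ↦ v b := h.fun_comp (fun z : 𝕍 ↦ z b)
  rw [partialD, h1.fderiv_eq]
  simp

/-- Vanishing of the distributional Riemann tensor, evaluated on coordinate vector fields: the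
curvature of the connection form given by the Christoffel symbols vanishes weakly. -/
theorem IsCurvatureFlat.exists_hasWeakZeroCurvature [T2Space M] {g : C1Metric k l M}
    (hg : g.IsCurvatureFlat) (he : e ∈ IsManifold.maximalAtlas (𝓡 (k + l)) ∞ M) {p : M}
    (hp : p ∈ e.source) : ∃ r > 0, ball (e p) r ⊆ e.target ∧
      HasWeakZeroCurvature volume (ball (e p) r) (g.christoffelForm e) := by
  obtain ⟨r, hr, hball, hext⟩ := exists_contMDiff_inChart_eq he hp
  refine ⟨r, hr, hball, fun ψ hψ hψc hψs u w v ↦ ?_⟩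
  obtain ⟨X, hX, hXu⟩ := hext u
  obtain ⟨Y, hY, hYw⟩ := hext w
  obtain ⟨Z, hZ, hZv⟩ := hext v
  have cX := contDiffOn_inChart_of_contMDiff he hX
  have cY := contDiffOn_inChart_of_contMDiff he hY
  have cZ := contDiffOn_inChart_of_contMDiff he hZ
  let ψ' : 𝓓^{1}(chartImage e, ℝ) := ⟨ψ, hψ, hψc, hψs.trans hball⟩
  have hψ' : ∀ y, ψ' y = ψ y := fun _ ↦ rfl
  have hψ'' : (ψ' : 𝕍 → ℝ) = ψ := rfl
  have hev : ∀ {V : (x : M) → TangentSpace (𝓡 (k + l)) x} {c : 𝕍},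
      (∀ y ∈ ball (e p) r, inChart e V y = c) → ∀ y ∈ ball (e p) r,
        inChart e V =ᶠ[𝓝 y] fun _ ↦ c := fun h y hy ↦
    Filter.eventually_of_mem (isOpen_ball.mem_nhds hy) h
  have hcov : ∀ {V V' : (x : M) → TangentSpace (𝓡 (k + l)) x} {c c' : 𝕍},
      (∀ y ∈ ball (e p) r, inChart e V y = c) → (∀ y ∈ ball (e p) r, inChart e V' y = c') →
      ∀ y ∈ ball (e p) r, g.covDeriv e (inChart e V) (inChart e V') y
        = g.christoffelForm e y c c' := by
    intro V V' c c' h h' y hy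
    have hd : HasFDerivAt (𝕜 := ℝ) (inChart e V') (0 : 𝕍 →L[ℝ] 𝕍) y :=
      (hasFDerivAt_const c' y).congr_of_eventuallyEq (hev h' y hy)
    rw [g.covDeriv_eq hd.differentiableAt, hd.fderiv, h y hy, h' y hy]
    simp
  have hlie : ∀ y ∈ ball (e p) r,
      VectorField.lieBracket ℝ (inChart e X) (inChart e Y) y = 0 := fun y hy ↦ by
    rw [VectorField.lieBracket, (hev hXu y hy).fderiv_eq, (hev hYw y hy).fderiv_eq]
    simp
  have le1 : (1 : WithTop ℕ∞) ≤ ∞ := by simp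
  have hzero : ∀ y ∉ ball (e p) r, ψ y = 0 ∧ fderiv ℝ ψ y = 0 := fun y hy ↦
    ⟨image_eq_zero_of_notMem_tsupport fun h ↦ hy (hψs h),
      image_eq_zero_of_notMem_tsupport fun h ↦ hy (hψs (tsupport_fderiv_subset ℝ h))⟩
  have hΓc : ∀ (u : 𝕍) (v : 𝕍), ContinuousOn (fun x ↦ g.christoffelForm e x u v) e.target :=
    fun u v ↦ ((g.continuousOn_christoffelForm he).clm_apply continuousOn_const).clm_apply
      continuousOn_const
  have hΓΓ : ∀ (u w : 𝕍) (v : 𝕍), ContinuousOn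
      (fun x ↦ g.christoffelForm e x u (g.christoffelForm e x w v)) e.target := fun u w v ↦
    ((g.continuousOn_christoffelForm he).clm_apply continuousOn_const).clm_apply (hΓc w v)
  have hψt := hψs.trans hball
  have iD : ∀ u w v, Integrable (fun y ↦ fderiv ℝ ψ y u • g.christoffelForm e y w v) :=
    fun u w v ↦ integrable_fderiv_smul_of_tsupport_subset e.open_target hψ hψc hψt (hΓc w v) u
  have iψ : ∀ u w v, Integrable
      (fun y ↦ ψ y • g.christoffelForm e y u (g.christoffelForm e y w v)) :=
    fun u w v ↦ integrable_smul_of_tsupport_subset e.open_target hψ.continuous hψc hψt (hΓΓ u w v)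
  have hterm : ∀ {V V' : (x : M) → TangentSpace (𝓡 (k + l)) x} {c c' : 𝕍} (a : Fin (k + l)),
      ContDiffOn ℝ ∞ (inChart e V) e.target → ContDiffOn ℝ ∞ (inChart e V') e.target →
      (∀ y ∈ ball (e p) r, inChart e V y = c) → (∀ y ∈ ball (e p) r, inChart e V' y = c') →
      g.distCovDeriv e (inChart e V) (g.covDeriv e (inChart e V') (inChart e Z)) a ψ'
        = (∫ y, (ψ y • g.christoffelForm e y c (g.christoffelForm e y c' v)
            - fderiv ℝ ψ y c • g.christoffelForm e y c' v)) a := by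
    intro V V' c c' a cV cV' hV hV'
    rw [g.distCovDeriv_apply he (cV.of_le le1)
      (g.continuousOn_covDeriv he cV'.continuousOn (cZ.of_le le1))]
    have h1 := (EuclideanSpace.proj a : 𝕍 →L[ℝ] ℝ).integral_comp_comm
      ((iψ c c' v).sub (iD c c' v))
    refine Eq.trans ?_ h1
    refine integral_congr_ae (Eventually.of_forall fun y ↦ ?_)
    by_cases hy : y ∈ ball (e p) r
    · simp [hψ'', hV y hy, hcov hV' hZv y hy, divergence_eq_zero_of_eventuallyEq (hev hV y hy)]
    · simp [hψ'', hzero y hy]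
  have hlast : ∀ a, g.distCovDeriv e (VectorField.lieBracket ℝ (inChart e X) (inChart e Y))
      (inChart e Z) a ψ' = 0 := by
    intro a
    rw [g.distCovDeriv_apply he ((contDiffOn_lieBracket e.open_target cX cY).of_le le1)
      cZ.continuousOn]
    refine integral_eq_zero_of_ae (Eventually.of_forall fun y ↦ ?_)
    by_cases hy : y ∈ ball (e p) r
    · have hev0 : VectorField.lieBracket ℝ (inChart e X) (inChart e Y) =ᶠ[𝓝 y] fun _ ↦ 0 :=
        Filter.eventually_of_mem (isOpen_ball.mem_nhds hy) hlie
      simp [hlie y hy, divergence_eq_zero_of_eventuallyEq hev0]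
    · simp [hψ'', hzero y hy]
  ext a
  have h := congrArg (fun T : 𝓓'^{1}(chartImage e, ℝ) ↦ T ψ') (hg X Y Z hX hY hZ e he a)
  have h' : g.distCovDeriv e (inChart e X) (g.covDeriv e (inChart e Y) (inChart e Z)) a ψ'
    - g.distCovDeriv e (inChart e Y) (g.covDeriv e (inChart e X) (inChart e Z)) a ψ'
    - g.distCovDeriv e (VectorField.lieBracket ℝ (inChart e X) (inChart e Y)) (inChart e Z) a ψ'
    = 0 := h
  rw [hterm a cX cY hXu hYw, hterm a cY cX hYw hXu, hlast a, sub_zero,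
    integral_sub (iψ _ _ _) (iD _ _ _), integral_sub (iψ _ _ _) (iD _ _ _)] at h'
  simp only [smul_sub]
  rw [integral_sub (iD _ _ _) (iD _ _ _), integral_sub (iψ _ _ _) (iψ _ _ _)]
  simp only [PiLp.sub_apply] at h' ⊢
  linarith

/-- Parallel vector fields are of class `C^1`. -/
theorem contDiffOn_of_parallel {g : C1Metric k l M}
    (he : e ∈ IsManifold.maximalAtlas (𝓡 (k + l)) ∞ M) {Ω : Set 𝕍} (hΩ : IsOpen Ω)
    (hΩe : Ω ⊆ e.target) {V : 𝕍 → 𝕍}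
    (hV : ∀ y ∈ Ω, HasFDerivAt V (-(g.christoffelForm e y).flip (V y)) y) :
    ContDiffOn ℝ 1 V Ω :=
  contDiffOn_one_of_hasFDerivAt hΩ hV (continuousOn_flip_apply
    ((g.continuousOn_christoffelForm he).mono hΩe)
    fun y hy ↦ (hV y hy).continuousAt.continuousWithinAt).neg

/-- In the chart `e`, there is around the point `y₀` a parallel orthonormal frame of class
`C^1`. -/
def HasParallelFrameNear (g : C1Metric k l M) (e : OpenPartialHomeomorph M 𝕍) (y₀ : 𝕍) : Prop :=
  ∃ r > 0, ball y₀ r ⊆ e.target ∧ ∃ F : Fin (k + l) → 𝕍 → 𝕍,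
    (∀ i, ∀ y ∈ ball y₀ r, HasFDerivAt (F i) (-(g.christoffelForm e y).flip (F i y)) y) ∧
    ∀ y ∈ ball y₀ r, ∀ i j, g.chartForm e y (F i y) (F j y) = if i = j then sgn k l i else 0

/-- Parallel sections which are orthonormal at `p` are orthonormal near `p`: their scalar products
have vanishing derivative, as the connection is metric. -/
theorem IsCurvatureFlat.hasParallelFrameNear [T2Space M] {g : C1Metric k l M}
    (hg : g.IsCurvatureFlat) (he : e ∈ IsManifold.maximalAtlas (𝓡 (k + l)) ∞ M) {p : M}
    (hp : p ∈ e.source) : g.HasParallelFrameNear e (e p) := by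
  obtain ⟨R, hR, hball, hflat⟩ := hg.exists_hasWeakZeroCurvature he hp
  obtain ⟨r, hr, hrR, hpar⟩ := hflat.exists_parallel hR
    ((g.continuousOn_christoffelForm he).mono hball)
  obtain ⟨b, hb⟩ := g.signature p
  choose F hF0 hF using hpar
  let w : Fin (k + l) → 𝕍 := fun i ↦ mfderiv (𝓡 (k + l)) (𝓡 (k + l)) e p (b i)
  have hsub : ball (e p) r ⊆ e.target := (ball_subset_ball hrR).trans hball
  refine ⟨r, hr, hsub, fun i ↦ F (w i), fun i y hy ↦ hF (w i) y hy, fun y hy i j ↦ ?_⟩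
  have hp0 := mem_ball_self (x := e p) hr
  have hd : ∀ z ∈ ball (e p) r, HasFDerivAt
      (fun z ↦ g.chartForm e z (F (w i) z) (F (w j) z)) (0 : 𝕍 →L[ℝ] ℝ) z := by
    intro z hz
    have h1 := (((g.contDiffOn_chartForm he).differentiableOn one_ne_zero).differentiableAt
      (e.open_target.mem_nhds (hsub hz))).hasFDerivAt
    refine ((h1.clm_apply (hF (w i) z hz)).clm_apply (hF (w j) z hz)).congr_fderiv ?_
    ext u
    have h2 := g.fderiv_chartForm he (hsub hz) u (F (w i) z) (F (w j) z)
    simp [h2]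
  have hconst := (convex_ball (e p) r).is_const_of_fderivWithin_eq_zero (𝕜 := ℝ)
    (fun z hz ↦ (hd z hz).differentiableAt.differentiableWithinAt)
    (fun z hz ↦ by
      rw [fderivWithin_of_isOpen isOpen_ball hz, (hd z hz).fderiv]) hy hp0
  have hw : ∀ i, mfderiv (𝓡 (k + l)) (𝓡 (k + l)) e.symm (e p) (w i) = b i := fun i ↦
    congrArg (fun T : 𝕍 →L[ℝ] 𝕍 ↦ T (b i))
      ((mdifferentiable_of_mem_maximalAtlas he).symm_comp_deriv hp)
  refine hconst.trans ?_
  rw [hF0, hF0, ← hb i j, chartForm_apply, hw, hw, e.left_inv hp]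

end C1Metric

end Curvature

/-! ### From parallel frames to flat coordinates -/

section Coordinates

open Bundle MeasureTheory TopologicalSpace Set Filter Topology Metric

variable {k l : ℕ} {M : Type*} [TopologicalSpace M]
  [ChartedSpace (EuclideanSpace ℝ (Fin (k + l))) M] [IsManifold (𝓡 (k + l)) ∞ M]
  {e : OpenPartialHomeomorph M (EuclideanSpace ℝ (Fin (k + l)))}

local notation "𝕍" => EuclideanSpace ℝ (Fin (k + l))

attribute [local instance] isManifold_one

theorem two_le_infty : (2 : WithTop ℕ∞) ≤ ∞ := WithTop.coe_le_coe.2 le_top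

theorem one_add_one_le_infty : (1 : WithTop ℕ∞) + 1 ≤ ∞ := two_le_infty

theorem sgn_mul_self (k l : ℕ) (i : Fin (k + l)) : sgn k l i * sgn k l i = 1 := by
  unfold sgn; split_ifs <;> norm_num

theorem flatForm_single (i j : Fin (k + l)) :
    flatForm k l (EuclideanSpace.single i 1) (EuclideanSpace.single j 1)
      = if i = j then sgn k l i else 0 := by
  rw [flatForm, Finset.sum_eq_single i]
  · simp
  · exact fun b _ hb ↦ by simp [hb]
  · simp

namespace C1Metric

theorem IsFrameFlat.hasParallelFrameNear {g : C1Metric k l M}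
    (hg : g.IsFrameFlat) (he : e ∈ IsManifold.maximalAtlas (𝓡 (k + l)) ∞ M) {p : M}
    (hp : p ∈ e.source) : g.HasParallelFrameNear e (e p) := by
  obtain ⟨U, hU, hpU, V, hV, horth, hpar⟩ := hg p
  have h1 : e.symm ⁻¹' U ∈ 𝓝 (e p) :=
    (e.continuousAt_symm (e.map_source hp)).preimage_mem_nhds (by
      rw [e.left_inv hp]; exact hU.mem_nhds hpU)
  obtain ⟨r, hr, hball⟩ := Metric.mem_nhds_iff.1
    (inter_mem h1 (e.open_target.mem_nhds (e.map_source hp)))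
  have hsub : ball (e p) r ⊆ e.target := fun y hy ↦ (hball hy).2
  refine ⟨r, hr, hsub, fun i ↦ inChart e (V i), fun i y hy ↦ ?_, fun y hy i j ↦ ?_⟩
  · have hc : ContDiffOn ℝ 1 (inChart e (V i)) (ball (e p) r) :=
      contDiffOn_inChart he one_add_one_le_infty hsub (fun y hy ↦ (hball hy).1) (hV i)
    have hd := (hc.differentiableOn one_ne_zero).differentiableAt (isOpen_ball.mem_nhds hy)
    refine hd.hasFDerivAt.congr_fderiv ?_
    ext1 v
    have h2 := hpar i e he y (hsub hy) (hball hy).1 v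
    rw [g.covDeriv_eq hd] at h2
    exact eq_neg_of_add_eq_zero_left h2
  · rw [chartForm_apply, mfderiv_symm_inChart he (hsub hy), mfderiv_symm_inChart he (hsub hy)]
    exact horth _ (hball hy).1 i j

/-- A parallel orthonormal frame `F_i` has closed dual coframe `θ^i = ± g(F_i, ·)`, because the
Levi-Civita connection has no torsion. Primitives of the `θ^i` are flat coordinates. -/
theorem HasParallelFrameNear.exists_isometry {g : C1Metric k l M} {y₀ : 𝕍}
    (h : g.HasParallelFrameNear e y₀) (he : e ∈ IsManifold.maximalAtlas (𝓡 (k + l)) ∞ M) :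
    ∃ r > 0, ball y₀ r ⊆ e.target ∧ ∃ f : 𝕍 → 𝕍, ContDiffOn ℝ 2 f (ball y₀ r) ∧
      ∀ y ∈ ball y₀ r, (∃ A : 𝕍 ≃L[ℝ] 𝕍, HasFDerivAt f (A : 𝕍 →L[ℝ] 𝕍) y) ∧
        ∀ v w, flatForm k l (fderiv ℝ f y v) (fderiv ℝ f y w) = g.chartForm e y v w := by
  obtain ⟨r, hr, hsub, F, hF, horth⟩ := h
  refine ⟨r, hr, hsub, ?_⟩
  have hG : ∀ y ∈ ball y₀ r, HasFDerivAt (g.chartForm e) (fderiv ℝ (g.chartForm e) y) y :=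
    fun y hy ↦ (((g.contDiffOn_chartForm he).differentiableOn one_ne_zero).differentiableAt
      (e.open_target.mem_nhds (hsub hy))).hasFDerivAt
  have hFc : ∀ i, ContDiffOn ℝ 1 (F i) (ball y₀ r) := fun i ↦
    contDiffOn_of_parallel he isOpen_ball hsub (hF i)
  let θ : Fin (k + l) → 𝕍 → 𝕍 →L[ℝ] ℝ := fun i y ↦ sgn k l i • g.chartForm e y (F i y)
  have hθc : ∀ i, ContDiffOn ℝ 1 (θ i) (ball y₀ r) := fun i ↦
    (((g.contDiffOn_chartForm he).mono hsub).clm_apply (hFc i)).const_smul (sgn k l i)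
  have hθd : ∀ i, ∀ y ∈ ball y₀ r, ∀ u v, fderiv ℝ (θ i) y u v
      = sgn k l i * g.chartForm e y (F i y) (g.christoffelForm e y u v) := by
    intro i y hy u v
    have h1 : HasFDerivAt (θ i) _ y := ((hG y hy).clm_apply (hF i y hy)).const_smul (sgn k l i)
    have h2 := g.fderiv_chartForm he (hsub hy) u (F i y) v
    rw [h1.fderiv]
    simp only [_root_.smul_apply, _root_.add_apply, ContinuousLinearMap.comp_apply,
      _root_.neg_apply, ContinuousLinearMap.flip_apply, map_neg, h2, smul_eq_mul]
    ring
  -- The forms `θ^i` are closed because `Γ` is symmetric.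
  have hprim : ∀ i, ∃ f : 𝕍 → ℝ, ∀ y ∈ ball y₀ r, HasFDerivAt f (θ i y) y := fun i ↦
    (convex_ball y₀ r).exists_forall_hasFDerivAt_of_fderiv_symmetric isOpen_ball
      ((hθc i).differentiableOn one_ne_zero) fun y hy u v ↦ by
        rw [hθd i y hy, hθd i y hy, g.christoffelForm_symm he (hsub hy)]
  choose f hf using hprim
  let Θ : 𝕍 → 𝕍 →L[ℝ] 𝕍 := fun y ↦ ∑ i, (θ i y).smulRight (EuclideanSpace.single i (1 : ℝ))
  have hfd : ∀ y ∈ ball y₀ r,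
      HasFDerivAt (fun y ↦ ∑ i, f i y • EuclideanSpace.single i (1 : ℝ)) (Θ y) y := fun y hy ↦
    HasFDerivAt.fun_sum fun i _ ↦ (hf i y hy).smul_const _
  have hΘc : ContDiffOn ℝ 1 Θ (ball y₀ r) := ContDiffOn.sum fun i _ ↦
    (hθc i).smulRight contDiffOn_const
  have hΘF : ∀ y ∈ ball y₀ r, ∀ j, Θ y (F j y) = EuclideanSpace.single j 1 := by
    intro y hy j
    simp only [Θ, θ, _root_.sum_apply, ContinuousLinearMap.smulRight_apply, _root_.smul_apply,
      horth y hy, smul_eq_mul]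
    rw [Finset.sum_eq_single j]
    · simp [sgn_mul_self]
    · exact fun b _ hb ↦ by simp [hb]
    · simp
  refine ⟨fun y ↦ ∑ i, f i y • EuclideanSpace.single i (1 : ℝ), ?_, fun y hy ↦ ?_⟩
  · rw [show (2 : WithTop ℕ∞) = 1 + 1 from rfl, contDiffOn_succ_iff_fderiv_of_isOpen isOpen_ball]
    exact ⟨fun y hy ↦ (hfd y hy).differentiableAt.differentiableWithinAt, by simp,
      hΘc.congr fun y hy ↦ (hfd y hy).fderiv⟩
  · let B : 𝕍 →L[ℝ] 𝕍 := ∑ j, (EuclideanSpace.proj j : 𝕍 →L[ℝ] ℝ).smulRight (F j y)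
    have hB : ∀ v, B v = ∑ j, v j • F j y := fun v ↦ by simp [B]
    have hΘB : ∀ v, Θ y (B v) = v := fun v ↦ by
      rw [hB, map_sum]
      simp only [map_smul, hΘF y hy, EuclideanSpace.sum_smul_single]
    have hBΘ : ∀ v, B (Θ y v) = v := by
      have h1 : (Θ y : 𝕍 →ₗ[ℝ] 𝕍) * (B : 𝕍 →ₗ[ℝ] 𝕍) = 1 := LinearMap.ext hΘB
      exact fun v ↦ congrArg (fun T : 𝕍 →ₗ[ℝ] 𝕍 ↦ T v) (mul_eq_one_comm.1 h1)
    refine ⟨⟨ContinuousLinearEquiv.equivOfInverse (Θ y) B hBΘ hΘB, hfd y hy⟩, fun v w ↦ ?_⟩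
    rw [(hfd y hy).fderiv]
    conv_rhs => rw [← hBΘ v, ← hBΘ w, hB, hB]
    simp only [map_sum, map_smul, _root_.sum_apply, _root_.smul_apply, horth y hy, smul_eq_mul,
      mul_ite, mul_zero, Finset.sum_ite_eq', Finset.mem_univ, if_true, flatForm]
    exact Finset.sum_congr rfl fun i _ ↦ by ring

/-- The local isometries given by parallel frames are local diffeomorphisms of class `C^2`, by the
inverse function theorem. -/
theorem isCoordinateFlat_of_hasParallelFrameNear {g : C1Metric k l M}
    (h : ∀ p : M, ∃ e ∈ IsManifold.maximalAtlas (𝓡 (k + l)) ∞ M,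
      p ∈ e.source ∧ g.HasParallelFrameNear e (e p)) :
    g.IsCoordinateFlat := by
  intro p
  obtain ⟨e, he, hp, hframe⟩ := h p
  obtain ⟨r, hr, hsub, f, hfc, hf⟩ := hframe.exists_isometry he
  have hc : ∀ y ∈ ball (e p) r, ContDiffAt ℝ 2 f y := fun y hy ↦
    hfc.contDiffAt (isOpen_ball.mem_nhds hy)
  have hp0 := mem_ball_self (x := e p) hr
  obtain ⟨A, hA⟩ := (hf _ hp0).1
  let h₀ := (hc _ hp0).toOpenPartialHomeomorph f hA two_ne_zero
  -- Restrict to the ball where the derivative is known to be invertible, so that the inverse is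
  -- `C^2`.
  let h₁ := h₀.restrOpen (ball (e p) r) isOpen_ball
  have hcoe : (h₁ : 𝕍 → 𝕍) = f := rfl
  have hsrc : h₁.source ⊆ ball (e p) r := fun y hy ↦ by
    rw [OpenPartialHomeomorph.restrOpen_source] at hy
    exact hy.2
  have hp1 : e p ∈ h₁.source := by
    rw [OpenPartialHomeomorph.restrOpen_source]
    exact ⟨(hc _ hp0).mem_toOpenPartialHomeomorph_source hA two_ne_zero, hp0⟩
  have hsymm : ContDiffOn ℝ 2 h₁.symm h₁.target := by
    intro z hz
    have hz' := hsrc (h₁.map_target hz)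
    obtain ⟨B, hB⟩ := (hf _ hz').1
    exact (h₁.contDiffAt_symm hz hB (hc _ hz')).contDiffWithinAt
  let Φ := e.trans h₁
  have hΦs : ∀ x ∈ Φ.source, x ∈ e.source ∧ e x ∈ h₁.source := fun x hx ↦ by
    rwa [OpenPartialHomeomorph.trans_source] at hx
  have ce : ContMDiffOn (𝓡 (k + l)) (𝓡 (k + l)) 2 e e.source :=
    (contMDiffOn_of_mem_maximalAtlas he).of_le two_le_infty
  have ces : ContMDiffOn (𝓡 (k + l)) (𝓡 (k + l)) 2 e.symm e.target :=
    (contMDiffOn_symm_of_mem_maximalAtlas he).of_le two_le_infty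
  refine ⟨⟨Φ.toPartialEquiv, Φ.open_source, Φ.open_target, ?_, ?_⟩, ?_, ?_⟩
  · exact (hfc.contMDiffOn.mono hsrc).comp (ce.mono fun x hx ↦ (hΦs x hx).1)
      fun x hx ↦ (hΦs x hx).2
  · have ht : ∀ z ∈ Φ.target, z ∈ h₁.target ∧ h₁.symm z ∈ e.target := fun z hz ↦ by
      rwa [OpenPartialHomeomorph.trans_target] at hz
    exact ces.comp (hsymm.contMDiffOn.mono fun z hz ↦ (ht z hz).1) fun z hz ↦ (ht z hz).2
  · exact ⟨hp, hp1⟩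
  · intro x hx v w
    obtain ⟨hx1, hx2⟩ := hΦs x hx
    have hxb := hsrc hx2
    have hd : HasMFDerivAt (𝓡 (k + l)) (𝓡 (k + l)) (f ∘ e) x
        ((fderiv ℝ f (e x)).comp
          (show 𝕍 →L[ℝ] 𝕍 from mfderiv (𝓡 (k + l)) (𝓡 (k + l)) e x)) :=
      HasMFDerivAt.comp x (((hc _ hxb).differentiableAt two_ne_zero).hasFDerivAt.hasMFDerivAt)
        ((mdifferentiable_of_mem_maximalAtlas he).mdifferentiableAt hx1).hasMFDerivAt
    have hd' : mfderiv (𝓡 (k + l)) (𝓡 (k + l)) Φ x = _ := hd.mfderiv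
    have h3 : ∀ v : TangentSpace (𝓡 (k + l)) x, mfderiv (𝓡 (k + l)) (𝓡 (k + l)) e.symm (e x)
        (mfderiv (𝓡 (k + l)) (𝓡 (k + l)) e x v) = v := fun v ↦
      congrArg (fun T : 𝕍 →L[ℝ] 𝕍 ↦ T v)
        ((mdifferentiable_of_mem_maximalAtlas he).symm_comp_deriv hx1)
    have h2 : flatForm k l (fderiv ℝ f (e x) (mfderiv (𝓡 (k + l)) (𝓡 (k + l)) e x v))
        (fderiv ℝ f (e x) (mfderiv (𝓡 (k + l)) (𝓡 (k + l)) e x w))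
        = g.toForm (e.symm (e x)) (mfderiv (𝓡 (k + l)) (𝓡 (k + l)) e.symm (e x)
            (mfderiv (𝓡 (k + l)) (𝓡 (k + l)) e x v))
          (mfderiv (𝓡 (k + l)) (𝓡 (k + l)) e.symm (e x)
            (mfderiv (𝓡 (k + l)) (𝓡 (k + l)) e x w)) := (hf _ hxb).2 _ _
    rw [h3, h3, e.left_inv hx1] at h2
    rw [← h2]
    exact congrArg₂ (flatForm k l) (congrArg (fun T : 𝕍 →L[ℝ] 𝕍 ↦ T v) hd')
      (congrArg (fun T : 𝕍 →L[ℝ] 𝕍 ↦ T w) hd')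

end C1Metric

end Coordinates

/-! ### From flat coordinates to parallel frames -/

section FlatCoordinates

open Bundle MeasureTheory TopologicalSpace Set Filter Topology Metric

variable {k l : ℕ} {M : Type*} [TopologicalSpace M]
  [ChartedSpace (EuclideanSpace ℝ (Fin (k + l))) M] [IsManifold (𝓡 (k + l)) ∞ M]
  {e : OpenPartialHomeomorph M (EuclideanSpace ℝ (Fin (k + l)))}

local notation "𝕍" => EuclideanSpace ℝ (Fin (k + l))

attribute [local instance] isManifold_one

/-- The semi-Euclidean metric as a continuous bilinear form. -/
noncomputable def flatCLM (k l : ℕ) :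
    EuclideanSpace ℝ (Fin (k + l)) →L[ℝ] EuclideanSpace ℝ (Fin (k + l)) →L[ℝ] ℝ :=
  ∑ i, (sgn k l i • (EuclideanSpace.proj i : EuclideanSpace ℝ (Fin (k + l)) →L[ℝ] ℝ)).smulRight
    (EuclideanSpace.proj i : EuclideanSpace ℝ (Fin (k + l)) →L[ℝ] ℝ)

theorem flatCLM_apply (v w : 𝕍) : flatCLM k l v w = flatForm k l v w := by
  simp [flatCLM, flatForm]

theorem flatCLM_symm (v w : 𝕍) : flatCLM k l v w = flatCLM k l w v := by
  simp only [flatCLM_apply, flatForm]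
  exact Finset.sum_congr rfl fun i _ ↦ by ring

theorem eq_zero_of_forall_flatCLM {v : 𝕍} (h : ∀ w, flatCLM k l v w = 0) : v = 0 := by
  ext i
  have h1 := h (EuclideanSpace.single i 1)
  rw [flatCLM_apply, flatForm, Finset.sum_eq_single i] at h1
  · have h2 := sgn_mul_self k l i
    have h3 : sgn k l i ≠ 0 := left_ne_zero_of_mul (h2.trans_ne one_ne_zero)
    simpa [h3] using h1
  · exact fun b _ hb ↦ by simp [hb]
  · simp

namespace C1Metric

variable {g : C1Metric k l M} {f : EuclideanSpace ℝ (Fin (k + l)) → EuclideanSpace ℝ (Fin (k + l))}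
  {N : Set (EuclideanSpace ℝ (Fin (k + l)))}

theorem fderiv_injective_of_isometry (he : e ∈ IsManifold.maximalAtlas (𝓡 (k + l)) ∞ M) {y : 𝕍}
    (hy : y ∈ e.target)
    (hiso : ∀ v w, flatForm k l (fderiv ℝ f y v) (fderiv ℝ f y w) = g.chartForm e y v w) :
    Function.Injective (fderiv ℝ f y) := by
  rw [injective_iff_map_eq_zero]
  intro v hv
  refine g.chartForm_eq_zero_of_forall he hy fun w ↦ ?_
  rw [← hiso, hv, ← flatCLM_apply, map_zero, _root_.zero_apply]

/-- In terms of a local isometry `f` to semi-Euclidean space, the Christoffel symbols are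
`Γ(u, v) = (Df)⁻¹ D²f(u, v)`. -/
theorem fderiv_christoffelForm_of_isometry (he : e ∈ IsManifold.maximalAtlas (𝓡 (k + l)) ∞ M)
    (hN : IsOpen N) (hNe : N ⊆ e.target) (hf : ContDiffOn ℝ 2 f N)
    (hiso : ∀ y ∈ N, ∀ v w,
      flatForm k l (fderiv ℝ f y v) (fderiv ℝ f y w) = g.chartForm e y v w)
    {y : 𝕍} (hy : y ∈ N) (u v : 𝕍) :
    fderiv ℝ f y (g.christoffelForm e y u v) = fderiv ℝ (fderiv ℝ f) y u v := by
  have hfy : ContDiffAt ℝ 2 f y := hf.contDiffAt (hN.mem_nhds hy)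
  have hdf : HasFDerivAt (fderiv ℝ f) (fderiv ℝ (fderiv ℝ f) y) y :=
    (((hfy.fderiv_right (m := 1) le_rfl).differentiableAt one_ne_zero)).hasFDerivAt
  have hsymm : IsSymmSndFDerivAt ℝ f y := hfy.isSymmSndFDerivAt (by simp)
  have hD : ∀ u v w, fderiv ℝ (g.chartForm e) y u v w
      = flatCLM k l (fderiv ℝ (fderiv ℝ f) y u v) (fderiv ℝ f y w)
        + flatCLM k l (fderiv ℝ f y v) (fderiv ℝ (fderiv ℝ f) y u w) := by
    intro u v w
    have h1 := (((g.contDiffOn_chartForm he).differentiableOn one_ne_zero).differentiableAt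
      (e.open_target.mem_nhds (hNe hy))).hasFDerivAt
    have h2 : HasFDerivAt (fun z ↦ g.chartForm e z v w) _ y :=
      (h1.clm_apply (hasFDerivAt_const v y)).clm_apply (hasFDerivAt_const w y)
    have h3 : ∀ v, HasFDerivAt (fun z ↦ fderiv ℝ f z v) _ y := fun v ↦
      hdf.clm_apply (hasFDerivAt_const v y)
    have h4 : HasFDerivAt (fun z ↦ flatCLM k l (fderiv ℝ f z v) (fderiv ℝ f z w)) _ y :=
      ((flatCLM k l).hasFDerivAt.comp y (h3 v)).clm_apply (h3 w)
    have h5 := h4.congr_of_eventuallyEq (f₁ := fun z ↦ g.chartForm e z v w)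
      (Filter.eventually_of_mem (hN.mem_nhds hy) fun z hz ↦ by
        simp only [flatCLM_apply, hiso z hz])
    have h6 := congrArg (fun T : 𝕍 →L[ℝ] ℝ ↦ T u) (h2.unique h5)
    simp at h6
    rw [h6]; ring
  have hsurj : Function.Surjective (fderiv ℝ f y) :=
    LinearMap.surjective_of_injective (f := (fderiv ℝ f y : 𝕍 →ₗ[ℝ] 𝕍))
      (fderiv_injective_of_isometry he (hNe hy) (hiso y hy))
  rw [← sub_eq_zero]
  refine eq_zero_of_forall_flatCLM fun w' ↦ ?_
  obtain ⟨w, rfl⟩ := hsurj w'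
  have h1 := g.two_mul_chartForm_christoffelForm he (hNe hy) u v w
  rw [← hiso y hy, ← flatCLM_apply, hD, hD, hD, hsymm.eq v u, hsymm.eq w u, hsymm.eq w v,
    flatCLM_symm (fderiv ℝ f y u), flatCLM_symm (fderiv ℝ f y v)] at h1
  rw [map_sub, _root_.sub_apply]
  linarith

variable (φ : PartialDiffeomorph (𝓡 (k + l)) (𝓡 (k + l)) M (EuclideanSpace ℝ (Fin (k + l))) 2)

theorem isOpen_chart_preimage (e : OpenPartialHomeomorph M 𝕍) :
    IsOpen (e.target ∩ e.symm ⁻¹' φ.source) :=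
  e.isOpen_inter_preimage_symm φ.open_source

theorem contDiffOn_comp_chart_symm (he : e ∈ IsManifold.maximalAtlas (𝓡 (k + l)) ∞ M) :
    ContDiffOn ℝ 2 (fun y ↦ φ (e.symm y)) (e.target ∩ e.symm ⁻¹' φ.source) :=
  (φ.contMDiffOn_toFun.comp (((contMDiffOn_symm_of_mem_maximalAtlas he).of_le two_le_infty).mono
    inter_subset_left) fun _ hy ↦ hy.2).contDiffOn

theorem fderiv_comp_chart_symm (he : e ∈ IsManifold.maximalAtlas (𝓡 (k + l)) ∞ M) {y : 𝕍}
    (hy : y ∈ e.target ∩ e.symm ⁻¹' φ.source) (v : 𝕍) :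
    fderiv ℝ (fun y ↦ φ (e.symm y)) y v
      = mfderiv (𝓡 (k + l)) (𝓡 (k + l)) φ (e.symm y)
        (mfderiv (𝓡 (k + l)) (𝓡 (k + l)) e.symm y v) := by
  have h1 : MDifferentiableAt (𝓡 (k + l)) (𝓡 (k + l)) φ (e.symm y) :=
    (φ.contMDiffOn_toFun.contMDiffAt (φ.open_source.mem_nhds hy.2)).mdifferentiableAt two_ne_zero
  have h2 := (mdifferentiable_of_mem_maximalAtlas he).mdifferentiableAt_symm hy.1
  have h3 := mfderiv_comp y h1 h2
  rw [← mfderiv_eq_fderiv]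
  exact congrArg (fun T : 𝕍 →L[ℝ] 𝕍 ↦ T v) h3

/-- Flat coordinates on `M`, read in a chart, are an isometry for the metric in this chart. -/
theorem isometry_comp_chart_symm (he : e ∈ IsManifold.maximalAtlas (𝓡 (k + l)) ∞ M)
    (hφ : ∀ x ∈ φ.source, ∀ v w : TangentSpace (𝓡 (k + l)) x,
      flatForm k l (mfderiv (𝓡 (k + l)) (𝓡 (k + l)) φ x v)
        (mfderiv (𝓡 (k + l)) (𝓡 (k + l)) φ x w) = g.toForm x v w) {y : 𝕍}
    (hy : y ∈ e.target ∩ e.symm ⁻¹' φ.source) (v w : 𝕍) :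
    flatForm k l (fderiv ℝ (fun y ↦ φ (e.symm y)) y v) (fderiv ℝ (fun y ↦ φ (e.symm y)) y w)
      = g.chartForm e y v w := by
  rw [fderiv_comp_chart_symm φ he hy, fderiv_comp_chart_symm φ he hy]
  exact hφ _ hy.2 _ _

theorem mfderiv_mfderiv_invFun {x : M} (hx : x ∈ φ.source) (v : 𝕍) :
    mfderiv (𝓡 (k + l)) (𝓡 (k + l)) φ x
      (show 𝕍 from mfderiv (𝓡 (k + l)) (𝓡 (k + l)) φ.invFun (φ x) v) = v := by
  have hx' : φ x ∈ φ.target := φ.map_source hx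
  have hinv : φ.invFun (φ x) = x := φ.left_inv hx
  have h1 : MDifferentiableAt (𝓡 (k + l)) (𝓡 (k + l)) φ (φ.invFun (φ x)) := by
    rw [hinv]
    exact (φ.contMDiffOn_toFun.contMDiffAt (φ.open_source.mem_nhds hx)).mdifferentiableAt
      two_ne_zero
  have h2 : MDifferentiableAt (𝓡 (k + l)) (𝓡 (k + l)) φ.invFun (φ x) :=
    (φ.contMDiffOn_invFun.contMDiffAt (φ.open_target.mem_nhds hx')).mdifferentiableAt two_ne_zero
  have h3 := h1.hasMFDerivAt.comp (φ x) h2.hasMFDerivAt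
  have h4 : HasMFDerivAt (𝓡 (k + l)) (𝓡 (k + l)) (φ ∘ φ.invFun) (φ x)
      (ContinuousLinearMap.id ℝ 𝕍) :=
    (hasMFDerivAt_id (I := 𝓡 (k + l)) (φ x)).congr_of_eventuallyEq
      (Filter.eventually_of_mem (φ.open_target.mem_nhds hx') fun z hz ↦ φ.right_inv hz)
  have h5 := congrArg (fun T : 𝕍 →L[ℝ] 𝕍 ↦ T v) (hasMFDerivAt_unique h3 h4)
  have h6 : (show 𝕍 →L[ℝ] 𝕍 from mfderiv (𝓡 (k + l)) (𝓡 (k + l)) φ (φ.invFun (φ x)))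
      = mfderiv (𝓡 (k + l)) (𝓡 (k + l)) φ x :=
    congrArg (fun z ↦ (show 𝕍 →L[ℝ] 𝕍 from mfderiv (𝓡 (k + l)) (𝓡 (k + l)) φ z)) hinv
  exact (congrArg (fun T : 𝕍 →L[ℝ] 𝕍 ↦
    T (mfderiv (𝓡 (k + l)) (𝓡 (k + l)) φ.invFun (φ x) v)) h6).symm.trans h5

/-- The coordinate vector field `∂_i` of the coordinates `φ`. -/
noncomputable def coordinateField (i : Fin (k + l)) (x : M) : TangentSpace (𝓡 (k + l)) x :=
  (show 𝕍 from mfderiv (𝓡 (k + l)) (𝓡 (k + l)) φ.invFun (φ x) (EuclideanSpace.single i 1))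

theorem mfderiv_coordinateField {x : M} (hx : x ∈ φ.source) (i : Fin (k + l)) :
    mfderiv (𝓡 (k + l)) (𝓡 (k + l)) φ x (coordinateField φ i x) = EuclideanSpace.single i (1 : ℝ) :=
  mfderiv_mfderiv_invFun φ hx _

theorem contMDiffOn_coordinateField (i : Fin (k + l)) :
    ContMDiffOn (𝓡 (k + l)) (𝓡 (k + l)).tangent 1
      (fun x ↦ (⟨x, coordinateField φ i x⟩ : TangentBundle (𝓡 (k + l)) M)) φ.source := by
  have h1 : ContMDiffOn (𝓡 (k + l)) (𝓡 (k + l)).tangent 1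
      (fun z ↦ (⟨φ.invFun z, mfderiv (𝓡 (k + l)) (𝓡 (k + l)) φ.invFun z
        (EuclideanSpace.single i 1)⟩ : TangentBundle (𝓡 (k + l)) M)) φ.target := by
    refine φ.contMDiffOn_invFun.mfderiv_apply_section (b := id)
      (V := fun _ ↦ EuclideanSpace.single i 1) φ.open_target le_rfl (mapsTo_id _) ?_
    exact contMDiffOn_vectorSpace_iff_contDiffOn.2 contDiffOn_const
  refine (h1.comp (φ.contMDiffOn_toFun.of_le (by norm_num)) fun x hx ↦ φ.map_source hx).congr
    fun x hx ↦ ?_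
  exact congrArg (fun q : M ↦ (⟨q, (show 𝕍 from mfderiv (𝓡 (k + l)) (𝓡 (k + l)) φ.invFun (φ x)
    (EuclideanSpace.single i 1))⟩ : TangentBundle (𝓡 (k + l)) M)) (φ.left_inv hx).symm

/-- A vector field whose image under a local isometry to semi-Euclidean space is constant is
parallel. -/
theorem covDeriv_eq_zero_of_isometry (he : e ∈ IsManifold.maximalAtlas (𝓡 (k + l)) ∞ M)
    (hN : IsOpen N) (hNe : N ⊆ e.target) (hf : ContDiffOn ℝ 2 f N)
    (hiso : ∀ y ∈ N, ∀ v w,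
      flatForm k l (fderiv ℝ f y v) (fderiv ℝ f y w) = g.chartForm e y v w)
    {V : 𝕍 → 𝕍} (hV : ContDiffOn ℝ 1 V N) {c : 𝕍} (hfV : ∀ z ∈ N, fderiv ℝ f z (V z) = c)
    {y : 𝕍} (hy : y ∈ N) (X : 𝕍 → 𝕍) : g.covDeriv e X V y = 0 := by
  have hVy : DifferentiableAt ℝ V y :=
    (hV.differentiableOn one_ne_zero).differentiableAt (hN.mem_nhds hy)
  have hfy : ContDiffAt ℝ 2 f y := hf.contDiffAt (hN.mem_nhds hy)
  have hdf : HasFDerivAt (fderiv ℝ f) (fderiv ℝ (fderiv ℝ f) y) y :=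
    (((hfy.fderiv_right (m := 1) le_rfl).differentiableAt one_ne_zero)).hasFDerivAt
  have h1 := hdf.clm_apply hVy.hasFDerivAt
  have h2 : HasFDerivAt (fun z ↦ fderiv ℝ f z (V z)) (0 : 𝕍 →L[ℝ] 𝕍) y :=
    (hasFDerivAt_const c y).congr_of_eventuallyEq
      (Filter.eventually_of_mem (hN.mem_nhds hy) hfV)
  have h3 := congrArg (fun T : 𝕍 →L[ℝ] 𝕍 ↦ T (X y)) (h1.unique h2)
  simp at h3
  refine fderiv_injective_of_isometry he (hNe hy) (hiso y hy) ?_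
  rw [covDeriv_eq g hVy, map_add, fderiv_christoffelForm_of_isometry he hN hNe hf hiso hy, map_zero]
  exact h3

/-- The coordinate vector fields of flat coordinates are a parallel orthonormal frame. -/
theorem IsCoordinateFlat.isFrameFlat (hg : g.IsCoordinateFlat) : g.IsFrameFlat := by
  intro p
  obtain ⟨φ, hp, hφ⟩ := hg p
  refine ⟨φ.source, φ.open_source, hp, coordinateField φ, contMDiffOn_coordinateField φ,
    fun x hx i j ↦ ?_, fun i e he y hy hyφ u ↦ ?_⟩
  · refine (hφ x hx _ _).symm.trans (Eq.trans ?_ (flatForm_single i j))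
    exact congrArg₂ (flatForm k l) (mfderiv_coordinateField φ hx i) (mfderiv_coordinateField φ hx j)
  · refine covDeriv_eq_zero_of_isometry he (isOpen_chart_preimage φ e) inter_subset_left
      (contDiffOn_comp_chart_symm φ he) (fun y hy ↦ isometry_comp_chart_symm φ he hφ hy)
      (contDiffOn_inChart he one_add_one_le_infty inter_subset_left (fun z hz ↦ hz.2)
        (contMDiffOn_coordinateField φ i)) (c := EuclideanSpace.single i 1) (fun z hz ↦ ?_)
      ⟨hy, hyφ⟩ _
    rw [fderiv_comp_chart_symm φ he hz, mfderiv_symm_inChart he hz.1]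
    exact mfderiv_coordinateField φ hz.2 i

end C1Metric

end FlatCoordinates

/-! ### Locality of distributions -/

section Locality

open Bundle MeasureTheory TopologicalSpace Set Filter Topology Metric

variable {E F : Type*} [NormedAddCommGroup E] [NormedSpace ℝ E] [FiniteDimensional ℝ E]
  [NormedAddCommGroup F] [NormedSpace ℝ F]

/-- A distribution which vanishes near every point is zero. -/
theorem distribution_eq_zero_of_locally {Ω : Opens E} (T : 𝓓'^{1}(Ω, F))
    (h : ∀ y ∈ Ω, ∃ U, IsOpen U ∧ y ∈ U ∧ ∀ ψ : 𝓓^{1}(Ω, ℝ), tsupport ψ ⊆ U → T ψ = 0) :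
    T = 0 := by
  ext ψ
  choose! U hUo hyU hU using h
  obtain ⟨f, hf⟩ := SmoothPartitionOfUnity.exists_isSubordinate 𝓘(ℝ, E)
    (isClosed_tsupport ψ) (fun i : Ω ↦ U i) (fun i ↦ hUo i i.2)
    fun y hy ↦ mem_iUnion.2 ⟨⟨y, ψ.tsupport_subset hy⟩, hyU y (ψ.tsupport_subset hy)⟩
  have hfin := f.locallyFinite.finite_nonempty_inter_compact ψ.hasCompactSupport.isCompact
  have hsub : ∀ i, tsupport (fun x ↦ f i x * ψ x) ⊆ tsupport ψ := fun i ↦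
    tsupport_mul_subset_right
  let Ψ : Ω → 𝓓^{1}(Ω, ℝ) := fun i ↦ ⟨fun x ↦ f i x * ψ x,
    ((f i).contMDiff.contDiff.of_le (by simp)).mul ψ.contDiff,
    ψ.hasCompactSupport.of_isClosed_subset (isClosed_tsupport _) (hsub i),
    (hsub i).trans ψ.tsupport_subset⟩
  have hsum : ψ = ∑ i ∈ hfin.toFinset, Ψ i := by
    ext x
    rw [_root_.sum_apply]
    change ψ x = ∑ i ∈ hfin.toFinset, f i x * ψ x
    by_cases hx : x ∈ tsupport ψ
    · rw [← Finset.sum_mul, f.sum_finsupport' x hx, one_mul]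
      intro i hi
      rw [Set.Finite.mem_toFinset]
      exact ⟨x, (f.mem_finsupport x).1 hi, hx⟩
    · simp [image_eq_zero_of_notMem_tsupport hx]
  have hT : T ψ = ∑ i ∈ hfin.toFinset, T (Ψ i) := by
    conv_lhs => rw [hsum]
    exact map_sum T _ _
  rw [hT]
  exact Finset.sum_eq_zero fun i _ ↦ hU i i.2 _ (tsupport_mul_subset_left.trans (hf i))

end Locality

/-! ### The commutator of derivatives along vector fields -/

section CommutatorIdentity

open Bundle MeasureTheory TopologicalSpace Set Filter Topology Metric

variable {n : ℕ}

local notation "𝕍" => EuclideanSpace ℝ (Fin n)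

theorem integrable_of_continuousOn_of_forall_eq_zero {E : Type*} [TopologicalSpace E] [T2Space E]
    [MeasurableSpace E] [OpensMeasurableSpace E] {μ : Measure E} [IsFiniteMeasureOnCompacts μ]
    {f : E → ℝ} {K : Set E} (hK : IsCompact K)
    (hf : ContinuousOn f K) (h0 : ∀ x ∉ K, f x = 0) : Integrable f μ :=
  (integrableOn_iff_integrable_of_support_subset fun x hx ↦ by
    by_contra h; exact hx (h0 x h)).1 (hf.integrableOn_compact hK)

theorem divergence_eq {X : 𝕍 → 𝕍} {y : 𝕍} (hX : DifferentiableAt ℝ X y) :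
    divergence X y = ∑ b, fderiv ℝ X y (EuclideanSpace.single b 1) b :=
  Finset.sum_congr rfl fun b _ ↦ partialD_component hX b b

/-- Integration by parts along a vector field. -/
theorem integral_fderiv_apply_mul {Ω : Set 𝕍} (hΩ : IsOpen Ω) {ζ χ : 𝕍 → ℝ} {V : 𝕍 → 𝕍}
    (hζ : ContDiffOn ℝ 1 ζ Ω) (hχ : ContDiff ℝ 1 χ) (hc : HasCompactSupport χ)
    (hs : tsupport χ ⊆ Ω) (hV : ContDiffOn ℝ 1 V Ω) :
    ∫ x, ζ x * (fderiv ℝ χ x (V x) + χ x * divergence V x) = -∫ x, fderiv ℝ ζ x (V x) * χ x := by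
  let θ : Fin n → 𝕍 → ℝ := fun b x ↦ χ x • V x b
  have hθ : ∀ b, ContDiff ℝ 1 (θ b) := fun b ↦
    contDiff_smul_of_tsupport_subset hΩ hχ hs (hV.euclidean_apply b)
  have hθs : ∀ b, tsupport (θ b) ⊆ tsupport χ := fun b ↦ tsupport_smul_subset_left _ _
  have hθc : ∀ b, HasCompactSupport (θ b) := fun b ↦ hc.smul_right
  have h := fun b ↦ integral_fderiv_mul_of_tsupport_subset (μ := volume) hΩ hζ (hθ b) (hθc b)
    ((hθs b).trans hs) (EuclideanSpace.single b 1)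
  have hsum := Finset.sum_congr (s₁ := Finset.univ) rfl fun b _ ↦ h b
  rw [Finset.sum_neg_distrib, ← integral_finsetSum, ← integral_finsetSum] at hsum
  · have h1 : ∀ x, ∑ b, fderiv ℝ ζ x (EuclideanSpace.single b 1) * θ b x
        = fderiv ℝ ζ x (V x) * χ x := fun x ↦ by
      rw [EuclideanSpace.clm_apply_eq_sum (fderiv ℝ ζ x) (V x), Finset.sum_mul]
      exact Finset.sum_congr rfl fun b _ ↦ by simp only [θ, smul_eq_mul]; ring
    have h2 : ∀ x, ∑ b, ζ x * fderiv ℝ (θ b) x (EuclideanSpace.single b 1)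
        = ζ x * (fderiv ℝ χ x (V x) + χ x * divergence V x) := fun x ↦ by
      by_cases hx : x ∈ tsupport χ
      · have hVx : HasFDerivAt V (fderiv ℝ V x) x :=
          ((hV.differentiableOn one_ne_zero).differentiableAt (hΩ.mem_nhds (hs hx))).hasFDerivAt
        have hd : ∀ b, fderiv ℝ (θ b) x (EuclideanSpace.single b 1)
            = V x b * fderiv ℝ χ x (EuclideanSpace.single b 1)
              + χ x * fderiv ℝ V x (EuclideanSpace.single b 1) b := by
          intro b
          have h1 : HasFDerivAt (fun z ↦ V z b) _ x :=
            (EuclideanSpace.proj b : 𝕍 →L[ℝ] ℝ).hasFDerivAt.comp x hVx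
          have h3 : HasFDerivAt (θ b) _ x :=
            (hχ.differentiable one_ne_zero x).hasFDerivAt.smul h1
          rw [h3.fderiv]
          simp
          ring
        rw [← Finset.mul_sum, divergence_eq hVx.differentiableAt,
          EuclideanSpace.clm_apply_eq_sum (fderiv ℝ χ x) (V x),
          Finset.mul_sum (a := χ x), ← Finset.sum_add_distrib]
        simp only [hd, smul_eq_mul]
      · have h3 : ∀ b, fderiv ℝ (θ b) x = 0 := fun b ↦ image_eq_zero_of_notMem_tsupport
          fun h ↦ hx (hθs b (tsupport_fderiv_subset ℝ h))
        have h4 : fderiv ℝ χ x = 0 := image_eq_zero_of_notMem_tsupport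
          fun h ↦ hx (tsupport_fderiv_subset ℝ h)
        simp [h3, h4, image_eq_zero_of_notMem_tsupport hx]
    simp only [h1, h2] at hsum
    exact neg_eq_iff_eq_neg.1 hsum.symm
  · intro b _
    refine (integrable_fderiv_smul_of_tsupport_subset hΩ (hθ b) (hθc b) ((hθs b).trans hs)
      hζ.continuousOn _).congr (Eventually.of_forall fun x ↦ mul_comm _ _)
  · intro b _
    exact (integrable_smul_of_tsupport_subset hΩ (hθ b).continuous (hθc b) ((hθs b).trans hs)
      ((hζ.continuousOn_fderiv_of_isOpen hΩ le_rfl).clm_apply continuousOn_const)).congr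
      (Eventually.of_forall fun x ↦ mul_comm _ _)

/-- The sum `Σ_{b, c} T(e_c) ∂_b (t v_b w_c)` at a point, where `D`, `A`, `B` are the derivatives of
`t`, `v`, `w`. -/
theorem sum_sum_single_mul (T D : 𝕍 →L[ℝ] ℝ) (A B : 𝕍 →L[ℝ] 𝕍) (v w : 𝕍) (t : ℝ) :
    ∑ b, ∑ c, T (EuclideanSpace.single c 1) * (D (EuclideanSpace.single b 1) * (v b * w c)
        + t * (A (EuclideanSpace.single b 1) b * w c + v b * B (EuclideanSpace.single b 1) c))
      = T w * (D v + t * ∑ b, A (EuclideanSpace.single b 1) b) + t * T (B v) := by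
  have h1 : T (B v) = ∑ b, v b * ∑ c, B (EuclideanSpace.single b 1) c
      * T (EuclideanSpace.single c 1) := by
    rw [← ContinuousLinearMap.comp_apply, EuclideanSpace.clm_apply_eq_sum (T.comp B) v]
    refine Finset.sum_congr rfl fun b _ ↦ ?_
    rw [ContinuousLinearMap.comp_apply, EuclideanSpace.clm_apply_eq_sum T (B _)]
    rfl
  rw [h1, EuclideanSpace.clm_apply_eq_sum T w, EuclideanSpace.clm_apply_eq_sum D v,
    Finset.mul_sum (a := t), ← Finset.sum_add_distrib,
    Finset.mul_sum, Finset.mul_sum (a := t), ← Finset.sum_add_distrib]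
  refine Finset.sum_congr rfl fun b _ ↦ ?_
  rw [Finset.sum_mul, Finset.mul_sum, Finset.mul_sum, ← Finset.sum_add_distrib]
  refine Finset.sum_congr rfl fun c _ ↦ ?_
  simp only [smul_eq_mul]
  ring

/-- For `C^1` functions `ζ`, `χ` and vector fields `X`, `Y`, the commutator of the derivatives
along `X` and `Y` is the derivative along `[X, Y]` in the sense of distributions. -/
theorem integral_commutator {Ω : Set 𝕍} (hΩ : IsOpen Ω) {ζ χ : 𝕍 → ℝ} {X Y : 𝕍 → 𝕍}
    (hζ : ContDiffOn ℝ 1 ζ Ω) (hχ : ContDiff ℝ 1 χ) (hc : HasCompactSupport χ)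
    (hs : tsupport χ ⊆ Ω) (hX : ContDiffOn ℝ 1 X Ω) (hY : ContDiffOn ℝ 1 Y Ω) :
    (∫ x, fderiv ℝ ζ x (Y x) * (fderiv ℝ χ x (X x) + χ x * divergence X x))
      - ∫ x, fderiv ℝ ζ x (X x) * (fderiv ℝ χ x (Y x) + χ x * divergence Y x)
      = -∫ x, fderiv ℝ ζ x (VectorField.lieBracket ℝ X Y x) * χ x := by
  have hXd : ∀ x ∈ Ω, HasFDerivAt X (fderiv ℝ X x) x := fun x hx ↦
    ((hX.differentiableOn one_ne_zero).differentiableAt (hΩ.mem_nhds hx)).hasFDerivAt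
  have hYd : ∀ x ∈ Ω, HasFDerivAt Y (fderiv ℝ Y x) x := fun x hx ↦
    ((hY.differentiableOn one_ne_zero).differentiableAt (hΩ.mem_nhds hx)).hasFDerivAt
  -- Apply the symmetry of second derivatives `∂_b ∂_c ζ = ∂_c ∂_b ζ` to the test functions
  -- `χ X_b Y_c`, and sum over `b` and `c`.
  let θ : Fin n → Fin n → 𝕍 → ℝ := fun b c x ↦ χ x • (X x b * Y x c)
  have hθ : ∀ b c, ContDiff ℝ 1 (θ b c) := fun b c ↦
    contDiff_smul_of_tsupport_subset hΩ hχ hs ((hX.euclidean_apply b).mul (hY.euclidean_apply c))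
  have hθs : ∀ b c, tsupport (θ b c) ⊆ tsupport χ := fun b c ↦ tsupport_smul_subset_left _ _
  have hθc : ∀ b c, HasCompactSupport (θ b c) := fun b c ↦ hc.smul_right
  have hdθ : ∀ b c, ∀ x ∈ Ω, ∀ v, fderiv ℝ (θ b c) x v = fderiv ℝ χ x v * (X x b * Y x c)
      + χ x * (fderiv ℝ X x v b * Y x c + X x b * fderiv ℝ Y x v c) := by
    intro b c x hx v
    have h1 : HasFDerivAt (fun z ↦ X z b) _ x :=
      (EuclideanSpace.proj b : 𝕍 →L[ℝ] ℝ).hasFDerivAt.comp x (hXd x hx)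
    have h2 : HasFDerivAt (fun z ↦ Y z c) _ x :=
      (EuclideanSpace.proj c : 𝕍 →L[ℝ] ℝ).hasFDerivAt.comp x (hYd x hx)
    have h3 : HasFDerivAt (θ b c) _ x :=
      (hχ.differentiable one_ne_zero x).hasFDerivAt.smul (h1.mul h2)
    rw [h3.fderiv]
    simp
    ring
  have hζd := hζ.continuousOn_fderiv_of_isOpen hΩ le_rfl
  have hi : ∀ b c u w, Integrable fun x ↦ fderiv ℝ ζ x u * fderiv ℝ (θ b c) x w :=
    fun b c u w ↦ (integrable_fderiv_smul_of_tsupport_subset hΩ (hθ b c) (hθc b c)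
      ((hθs b c).trans hs) (hζd.clm_apply continuousOn_const) w).congr
      (Eventually.of_forall fun x ↦ mul_comm _ _)
  have hbc : ∀ b c, (∫ x, (fderiv ℝ ζ x (EuclideanSpace.single c 1)
        * fderiv ℝ (θ b c) x (EuclideanSpace.single b 1)
      - fderiv ℝ ζ x (EuclideanSpace.single b 1)
        * fderiv ℝ (θ b c) x (EuclideanSpace.single c 1))) = 0 := fun b c ↦ by
    rw [integral_sub (hi _ _ _ _) (hi _ _ _ _), sub_eq_zero]
    exact integral_fderiv_mul_fderiv_comm hΩ hζ (hθ b c) (hθc b c) ((hθs b c).trans hs) _ _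
  have hsum : (∫ x, ∑ b, ∑ c, (fderiv ℝ ζ x (EuclideanSpace.single c 1)
        * fderiv ℝ (θ b c) x (EuclideanSpace.single b 1)
      - fderiv ℝ ζ x (EuclideanSpace.single b 1)
        * fderiv ℝ (θ b c) x (EuclideanSpace.single c 1))) = 0 := by
    refine (integral_finsetSum _ fun b _ ↦ integrable_finsetSum _ fun c _ ↦
      (hi b c _ _).sub (hi b c _ _)).trans (Finset.sum_eq_zero fun b _ ↦ ?_)
    exact (integral_finsetSum _ fun c _ ↦ (hi b c _ _).sub (hi b c _ _)).trans
      (Finset.sum_eq_zero fun c _ ↦ hbc b c)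
  have hχ0 : ∀ x ∉ tsupport χ, χ x = 0 ∧ fderiv ℝ χ x = 0 := fun x hx ↦
    ⟨image_eq_zero_of_notMem_tsupport hx, image_eq_zero_of_notMem_tsupport
      fun h ↦ hx (tsupport_fderiv_subset ℝ h)⟩
  have hpt : ∀ x, ∑ b, ∑ c, (fderiv ℝ ζ x (EuclideanSpace.single c 1)
        * fderiv ℝ (θ b c) x (EuclideanSpace.single b 1)
      - fderiv ℝ ζ x (EuclideanSpace.single b 1)
        * fderiv ℝ (θ b c) x (EuclideanSpace.single c 1))
      = fderiv ℝ ζ x (Y x) * (fderiv ℝ χ x (X x) + χ x * divergence X x)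
        - fderiv ℝ ζ x (X x) * (fderiv ℝ χ x (Y x) + χ x * divergence Y x)
        + fderiv ℝ ζ x (VectorField.lieBracket ℝ X Y x) * χ x := by
    intro x
    by_cases hx : x ∈ tsupport χ
    · have h1 := sum_sum_single_mul (fderiv ℝ ζ x) (fderiv ℝ χ x) (fderiv ℝ X x) (fderiv ℝ Y x)
        (X x) (Y x) (χ x)
      have h2 := sum_sum_single_mul (fderiv ℝ ζ x) (fderiv ℝ χ x) (fderiv ℝ Y x) (fderiv ℝ X x)
        (Y x) (X x) (χ x)
      rw [Finset.sum_comm] at h2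
      simp only [Finset.sum_sub_distrib, hdθ _ _ x (hs hx)]
      rw [h1, divergence_eq (hXd x (hs hx)).differentiableAt,
        divergence_eq (hYd x (hs hx)).differentiableAt, VectorField.lieBracket, map_sub]
      have h3 : ∑ b, ∑ c, fderiv ℝ ζ x (EuclideanSpace.single b 1)
          * (fderiv ℝ χ x (EuclideanSpace.single c 1) * (X x b * Y x c)
          + χ x * (fderiv ℝ X x (EuclideanSpace.single c 1) b * Y x c
            + X x b * fderiv ℝ Y x (EuclideanSpace.single c 1) c)) = _ := Eq.trans
        (Finset.sum_congr rfl fun b _ ↦ Finset.sum_congr rfl fun c _ ↦ by ring) h2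
      rw [h3]
      ring
    · have h3 : ∀ b c, fderiv ℝ (θ b c) x = 0 := fun b c ↦ image_eq_zero_of_notMem_tsupport
        fun h ↦ hx (hθs b c (tsupport_fderiv_subset ℝ h))
      simp [h3, hχ0 x hx]
  simp only [hpt] at hsum
  have hζK := hζd.mono hs
  have hXK := hX.continuousOn.mono hs
  have hYK := hY.continuousOn.mono hs
  have hχd := hχ.continuous_fderiv one_ne_zero
  have hterm : ∀ {V W : 𝕍 → 𝕍}, ContDiffOn ℝ 1 V Ω → ContDiffOn ℝ 1 W Ω → Integrable fun x ↦
      fderiv ℝ ζ x (V x) * (fderiv ℝ χ x (W x) + χ x * divergence W x) := fun {V W} hV hW ↦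
    integrable_of_continuousOn_of_forall_eq_zero hc.isCompact
      ((hζK.clm_apply (hV.continuousOn.mono hs)).mul
        ((hχd.continuousOn.clm_apply (hW.continuousOn.mono hs)).add
          (hχ.continuous.continuousOn.mul ((continuousOn_divergence hΩ hW).mono hs))))
      fun x hx ↦ by simp [hχ0 x hx]
  have hlie : Integrable fun x ↦ fderiv ℝ ζ x (VectorField.lieBracket ℝ X Y x) * χ x :=
    integrable_of_continuousOn_of_forall_eq_zero hc.isCompact
      ((hζK.clm_apply ((((hY.continuousOn_fderiv_of_isOpen hΩ le_rfl).clm_apply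
        hX.continuousOn).sub ((hX.continuousOn_fderiv_of_isOpen hΩ le_rfl).clm_apply
        hY.continuousOn)).mono hs)).mul hχ.continuous.continuousOn)
      fun x hx ↦ by simp [hχ0 x hx]
  have h1 := (integral_add ((hterm hY hX).sub (hterm hX hY)) hlie).symm.trans hsum
  have h2 := integral_sub (hterm hY hX) (hterm hX hY)
  simp only [Pi.sub_apply] at h1
  linarith

end CommutatorIdentity

/-! ### From parallel frames to vanishing curvature -/

section FlatCurvature

open Bundle MeasureTheory TopologicalSpace Set Filter Topology Metric

variable {k l : ℕ} {M : Type*} [TopologicalSpace M]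
  [ChartedSpace (EuclideanSpace ℝ (Fin (k + l))) M] [IsManifold (𝓡 (k + l)) ∞ M]
  {e : OpenPartialHomeomorph M (EuclideanSpace ℝ (Fin (k + l)))}

local notation "𝕍" => EuclideanSpace ℝ (Fin (k + l))

attribute [local instance] isManifold_one

namespace C1Metric

variable {g : C1Metric k l M}

/-- In terms of a parallel frame, the distributional covariant derivative is the distributional
derivative of the coefficients. -/
theorem distCovDeriv_apply_of_parallel (he : e ∈ IsManifold.maximalAtlas (𝓡 (k + l)) ∞ M)
    {Ω : Set 𝕍} (hΩ : IsOpen Ω) (hΩe : Ω ⊆ e.target) {F : Fin (k + l) → 𝕍 → 𝕍}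
    (hF : ∀ i, ∀ y ∈ Ω, HasFDerivAt (F i) (-(g.christoffelForm e y).flip (F i y)) y)
    {X W : 𝕍 → 𝕍} (hX : ContDiffOn ℝ 1 X e.target) (hW : ContinuousOn W e.target)
    {η : Fin (k + l) → 𝕍 → ℝ} (hη : ∀ i, ContinuousOn (η i) Ω)
    (hWη : ∀ y ∈ Ω, W y = ∑ i, η i y • F i y) (a : Fin (k + l)) (ψ : 𝓓^{1}(chartImage e, ℝ))
    (hψ : tsupport ψ ⊆ Ω) :
    g.distCovDeriv e X W a ψ = -∑ i, ∫ y, η i y * (fderiv ℝ (fun z ↦ ψ z * F i z a) y (X y)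
      + ψ y * F i y a * divergence X y) := by
  have hψc : HasCompactSupport ψ := ψ.hasCompactSupport
  have hχ : ∀ i, ContDiff ℝ 1 (fun z ↦ ψ z * F i z a) := fun i ↦
    contDiff_smul_of_tsupport_subset hΩ ψ.contDiff hψ
      ((contDiffOn_of_parallel he hΩ hΩe (hF i)).euclidean_apply a)
  have hψ0 : ∀ y ∉ tsupport ψ, ψ y = 0 ∧ fderiv ℝ ψ y = 0 ∧
      ∀ i, fderiv ℝ (fun z ↦ ψ z * F i z a) y = 0 := fun y hy ↦
    ⟨image_eq_zero_of_notMem_tsupport hy, image_eq_zero_of_notMem_tsupport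
      fun h ↦ hy (tsupport_fderiv_subset ℝ h), fun i ↦ image_eq_zero_of_notMem_tsupport
      fun h ↦ hy (tsupport_mul_subset_left (tsupport_fderiv_subset ℝ h))⟩
  rw [g.distCovDeriv_apply he hX hW, ← integral_finsetSum, ← integral_neg]
  · refine integral_congr_ae (Eventually.of_forall fun y ↦ ?_)
    by_cases hy : y ∈ tsupport ψ
    · have hd : ∀ i, fderiv ℝ (fun z ↦ ψ z * F i z a) y (X y)
          = fderiv ℝ ψ y (X y) * F i y a - ψ y * g.christoffelForm e y (X y) (F i y) a := by
        intro i
        have h1 : HasFDerivAt (fun z ↦ F i z a) _ y :=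
          (EuclideanSpace.proj a : 𝕍 →L[ℝ] ℝ).hasFDerivAt.comp y (hF i y (hψ hy))
        have h2 : HasFDerivAt (fun z ↦ ψ z * F i z a) _ y :=
          ((ψ.contDiff.differentiable (by simp)) y).hasFDerivAt.mul h1
        rw [h2.fderiv]
        simp
        ring
      have hWa : W y a = ∑ i, η i y * F i y a := by simp [hWη y (hψ hy)]
      have hΓ : g.christoffelForm e y (X y) (W y) a
          = ∑ i, η i y * g.christoffelForm e y (X y) (F i y) a := by simp [hWη y (hψ hy)]
      simp only [hd, hWa, hΓ, Finset.mul_sum, ← Finset.sum_neg_distrib, ← Finset.sum_sub_distrib]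
      exact Finset.sum_congr rfl fun i _ ↦ by ring
    · simp [hψ0 y hy]
  · intro i _
    refine integrable_of_continuousOn_of_forall_eq_zero hψc.isCompact
      (((hη i).mono hψ).mul ((((hχ i).continuous_fderiv one_ne_zero).continuousOn.clm_apply
        (hX.continuousOn.mono (hψ.trans hΩe))).add ((hχ i).continuous.continuousOn.mul
        ((continuousOn_divergence e.open_target hX).mono (hψ.trans hΩe))))) fun y hy ↦ ?_
    simp [hψ0 y hy]

/-- Vectors which are orthonormal in the sense of signature `(k, l)` form a basis, and give the
coefficients with respect to this basis. -/
theorem eq_sum_of_orthonormal {y : 𝕍} {b : Fin (k + l) → 𝕍}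
    (hb : ∀ i j, g.chartForm e y (b i) (b j) = if i = j then sgn k l i else 0) (v : 𝕍) :
    v = ∑ i, (sgn k l i * g.chartForm e y (b i) v) • b i := by
  have hli : LinearIndependent ℝ b := by
    rw [Fintype.linearIndependent_iff]
    intro c hc j
    have h1 := congrArg (fun w ↦ g.chartForm e y w (b j)) hc
    have h2 := left_ne_zero_of_mul ((sgn_mul_self k l j).trans_ne one_ne_zero)
    simpa [hb, h2] using h1
  have hspan := hli.span_eq_top_of_card_eq_finrank' (by simp)
  have hv : v ∈ Submodule.span ℝ (Set.range b) := hspan ▸ Submodule.mem_top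
  obtain ⟨c, rfl⟩ := (Submodule.mem_span_range_iff_exists_fun ℝ).1 hv
  refine Finset.sum_congr rfl fun i _ ↦ ?_
  congr 1
  have h1 : g.chartForm e y (b i) (∑ j, c j • b j) = c i * sgn k l i := by simp [hb]
  rw [h1, mul_left_comm, sgn_mul_self, mul_one]

/-- Near a point around which there is a parallel orthonormal frame, the distributional curvature
vanishes. -/
theorem HasParallelFrameNear.riem_apply_eq_zero
    (he : e ∈ IsManifold.maximalAtlas (𝓡 (k + l)) ∞ M) {y₀ : 𝕍}
    (h : g.HasParallelFrameNear e y₀) {X Y Z : (x : M) → TangentSpace (𝓡 (k + l)) x}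
    (hX : ContDiffOn ℝ ∞ (inChart e X) e.target) (hY : ContDiffOn ℝ ∞ (inChart e Y) e.target)
    (hZ : ContDiffOn ℝ ∞ (inChart e Z) e.target) (a : Fin (k + l)) :
    ∃ U, IsOpen U ∧ y₀ ∈ U ∧ ∀ ψ : 𝓓^{1}(chartImage e, ℝ), tsupport ψ ⊆ U →
      g.riem e X Y Z a ψ = 0 := by
  obtain ⟨r, hr, hball, F, hF, hFo⟩ := h
  refine ⟨ball y₀ r, isOpen_ball, mem_ball_self hr, fun ψ hψ ↦ ?_⟩
  have le1 : (1 : WithTop ℕ∞) ≤ ∞ := by simp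
  have hX1 := hX.of_le le1
  have hY1 := hY.of_le le1
  have hZ1 := hZ.of_le le1
  have hL1 := (contDiffOn_lieBracket e.open_target hX hY).of_le le1
  have hF1 := fun i ↦ contDiffOn_of_parallel he isOpen_ball hball (hF i)
  -- The coefficients of `Z` with respect to the parallel frame.
  let ζ : Fin (k + l) → 𝕍 → ℝ := fun i y ↦ sgn k l i * g.chartForm e y (F i y) (inChart e Z y)
  have hζ : ∀ i, ContDiffOn ℝ 1 (ζ i) (ball y₀ r) := fun i ↦ contDiffOn_const.mul
    ((((g.contDiffOn_chartForm he).mono hball).clm_apply (hF1 i)).clm_apply (hZ1.mono hball))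
  have hZζ : ∀ y ∈ ball y₀ r, inChart e Z y = ∑ i, ζ i y • F i y := fun y hy ↦
    eq_sum_of_orthonormal (hFo y hy) _
  have hcov : ∀ V : 𝕍 → 𝕍, ∀ y ∈ ball y₀ r,
      g.covDeriv e V (inChart e Z) y = ∑ i, fderiv ℝ (ζ i) y (V y) • F i y := by
    intro V y hy
    have h1 : HasFDerivAt (fun z ↦ ∑ i, ζ i z • F i z) _ y := HasFDerivAt.fun_sum fun i _ ↦
      (((hζ i).differentiableOn one_ne_zero).differentiableAt
        (isOpen_ball.mem_nhds hy)).hasFDerivAt.smul (hF i y hy)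
    have h2 := h1.congr_of_eventuallyEq (Filter.eventually_of_mem (isOpen_ball.mem_nhds hy) hZζ)
    rw [g.covDeriv_eq h2.differentiableAt, h2.fderiv, hZζ y hy]
    simp [Finset.sum_add_distrib]
  let χ : Fin (k + l) → 𝕍 → ℝ := fun i z ↦ ψ z * F i z a
  have hχ : ∀ i, ContDiff ℝ 1 (χ i) := fun i ↦
    contDiff_smul_of_tsupport_subset isOpen_ball ψ.contDiff hψ ((hF1 i).euclidean_apply a)
  have hχs : ∀ i, tsupport (χ i) ⊆ ball y₀ r := fun i ↦ tsupport_mul_subset_left.trans hψ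
  have hχc : ∀ i, HasCompactSupport (χ i) := fun i ↦ ψ.hasCompactSupport.mul_right
  have hterm : ∀ {V V' : 𝕍 → 𝕍}, ContDiffOn ℝ 1 V e.target → ContDiffOn ℝ 1 V' e.target →
      g.distCovDeriv e V (g.covDeriv e V' (inChart e Z)) a ψ
        = -∑ i, ∫ y, fderiv ℝ (ζ i) y (V' y) * (fderiv ℝ (χ i) y (V y)
          + χ i y * divergence V y) := fun {V V'} hV hV' ↦
    distCovDeriv_apply_of_parallel he isOpen_ball hball hF hV
      (g.continuousOn_covDeriv he hV'.continuousOn hZ1)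
      (fun i ↦ ((hζ i).continuousOn_fderiv_of_isOpen isOpen_ball le_rfl).clm_apply
        (hV'.continuousOn.mono hball)) (hcov V') a ψ hψ
  have hlast := distCovDeriv_apply_of_parallel he isOpen_ball hball hF hL1 hZ1.continuousOn
    (fun i ↦ (hζ i).continuousOn) hZζ a ψ hψ
  have hriem : g.riem e X Y Z a ψ
      = g.distCovDeriv e (inChart e X) (g.covDeriv e (inChart e Y) (inChart e Z)) a ψ
        - g.distCovDeriv e (inChart e Y) (g.covDeriv e (inChart e X) (inChart e Z)) a ψ
        - g.distCovDeriv e (VectorField.lieBracket ℝ (inChart e X) (inChart e Y))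
          (inChart e Z) a ψ := rfl
  rw [hriem, hterm hX1 hY1, hterm hY1 hX1, hlast, neg_sub_neg, sub_neg_eq_add,
    ← Finset.sum_sub_distrib, ← Finset.sum_add_distrib]
  refine Finset.sum_eq_zero fun i _ ↦ ?_
  have h1 := integral_commutator isOpen_ball (hζ i) (hχ i) (hχc i) (hχs i) (hX1.mono hball)
    (hY1.mono hball)
  have h2 := integral_fderiv_apply_mul isOpen_ball (hζ i) (hχ i) (hχc i) (hχs i) (hL1.mono hball)
  simp only [χ] at h1 h2 ⊢
  linarith

/-- Being a distribution, the curvature vanishes if it vanishes near every point. -/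
theorem IsFrameFlat.isCurvatureFlat (hg : g.IsFrameFlat) : g.IsCurvatureFlat := by
  intro X Y Z hX hY hZ e he a
  refine distribution_eq_zero_of_locally _ fun y hy ↦ ?_
  have h := hg.hasParallelFrameNear he (e.map_target hy)
  rw [e.right_inv hy] at h
  exact h.riem_apply_eq_zero he (contDiffOn_inChart_of_contMDiff he hX)
    (contDiffOn_inChart_of_contMDiff he hY) (contDiffOn_inChart_of_contMDiff he hZ) a

end C1Metric

end FlatCurvature

end SemiRiemannian

theorem theorem3p14 (k l : ℕ) {M : Type*} [TopologicalSpace M] [T2Space M]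
    [SecondCountableTopology M] [ChartedSpace (EuclideanSpace ℝ (Fin (k + l))) M]
    [IsManifold (𝓡 (k + l)) ∞ M] (g : SemiRiemannian.C1Metric k l M) :
    [g.IsCurvatureFlat, g.IsFrameFlat, g.IsCoordinateFlat].TFAE := by
  tfae_have 1 → 3 := fun h ↦
    SemiRiemannian.C1Metric.isCoordinateFlat_of_hasParallelFrameNear fun p ↦
      ⟨chartAt _ p, IsManifold.chart_mem_maximalAtlas p, mem_chart_source _ p,
        h.hasParallelFrameNear (IsManifold.chart_mem_maximalAtlas p) (mem_chart_source _ p)⟩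
  tfae_have 3 → 2 := SemiRiemannian.C1Metric.IsCoordinateFlat.isFrameFlat
  tfae_have 2 → 1 := SemiRiemannian.C1Metric.IsFrameFlat.isCurvatureFlat
  tfae_finish
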